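/- Let $N\ge 2$ be an integer, let $p>1$ and $\omega>0$ be real, and let $\mathcal G$ be the star graph made of $N$ half-lines $(0,\infty)$ joined at one vertex. Write $L^2(\mathcal G)=\bigoplus_{j=1}^N L^2(0,\infty)$ and $H^2(\mathcal G)=\bigoplus_{j=1}^N H^2(0,\infty)$ (real- or complex-valued functions), and for $1\le k\le \left[\frac{N-1}{2}\right]$ let $$L^2_k(\mathcal G)=\{\mathbf V=(v_j)_{j=1}^N\in L^2(\mathcal G): v_1=\dots=v_k,\ v_{k+1}=\dots=v_N\}.$$ Put $$\varphi_0(x)=\left[\tfrac{(p+1)\omega}{2}\,\operatorname{sech}^2\!\left(\tfrac{(p-1)\sqrt\omega}{2}x\right)\right]^{\frac1{p-1}},$$ and let $\mathbf L_1^0$ be the operator in $L^2(\mathcal G)$ defined by $$\mathbf L_1^0\mathbf V=\left(-v_j''+\omega v_j-p\,\varphi_0^{p-1}v_j\right)_{j=1}^N,$$ $$\operatorname{dom}(\mathbf L_1^0)=\Big\{\mathbf V\in H^2(\mathcal G): v_1(0)=\dots=v_N(0),\ \sum_{j=1}^N v_j'(0)=0\Big\}.$$ Denote by $n(A)$ the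 number of negative eigenvalues of $A$ counted with multiplicity, and by $\sigma_{\rm ess}(A)$ the spectrum of $A$ without the isolated points that are eigenvalues of finite multiplicity. Then: (i) $\ker(\mathbf L_1^0)=\operatorname{span}\{\hat{\mathbf\Phi}_{0,1},\dots,\hat{\mathbf\Phi}_{0,N-1}\}$, where $\hat{\mathbf\Phi}_{0,j}$ has $j$-th component $\varphi_0'$, $(j+1)$-th component $-\varphi_0'$, and all other components $0$; this kernel has dimension $N-1$. (ii) For every integer $k$ with $1\le k\le\left[\frac{N-1}{2}\right]$, the kernel of the restriction of $\mathbf L_1^0$ to $L^2_k(\mathcal G)$ is one-dimensional and is spanned by $\widetilde{\mathbf\Phi}_{0,k}$, whose components $1,\dots,k$ equal $\frac{N-k}{k}\varphi_0'$ and whose components $k+1,\dots,N$ equal $-\varphi_0'$. (iii) $\mathbf L_1^0$ has exactly one negative eigenvalue in $L^2(\mathcal G)$, and it is simple, i.e. $n(\mathbf L_1^0)=1$. Likewise, for every integer $k$ with $1\le k\le\left[\frac{N-1}{2}\right]$, the restriction of $\mathbf L_1^0$ to $L^2_k(\mathcal G)$ has exactly one negative eigenvalue, and it is simple, i.e. $n(\mathbf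 L_1^0|_{L^2_k(\mathcal G)})=1$. (iv) The positive part of the spectrum of $\mathbf L_1^0$ is bounded away from zero, and $\sigma_{\rm ess}(\mathbf L_1^0)=[\omega,\infty)$. -/

import Mathlib

open MeasureTheory Set Filter Topology
open scoped ENNReal

noncomputable section

namespace KirchhoffStar

/-! ### Unbounded operators: eigenspaces, spectrum, essential spectrum, Morse index -/

section Operators

variable {𝕜 : Type*} [RCLike 𝕜] {E : Type*} [NormedAddCommGroup E] [NormedSpace 𝕜 E]

/-- The space `ker (A - z)` of an unbounded operator `A`, as a subspace of the ambient space. -/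
def eigenspace (A : E →ₗ.[𝕜] E) (z : 𝕜) : Submodule 𝕜 E where
  carrier := {x | ∃ hx : x ∈ A.domain, A ⟨x, hx⟩ = z • x}
  zero_mem' := ⟨A.domain.zero_mem, by
    have h : A ⟨0, A.domain.zero_mem⟩ = 0 := A.map_zero
    rw [h, smul_zero]⟩
  add_mem' := by
    rintro x y ⟨hx, ex⟩ ⟨hy, ey⟩
    refine ⟨A.domain.add_mem hx hy, ?_⟩
    have h := A.map_add ⟨x, hx⟩ ⟨y, hy⟩
    rw [ex, ey, ← smul_add] at h
    exact h
  smul_mem' := by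
    rintro c x ⟨hx, ex⟩
    refine ⟨A.domain.smul_mem c hx, ?_⟩
    have h := A.map_smul c ⟨x, hx⟩
    rw [ex, smul_comm] at h
    exact h

/-- `z` is in the resolvent set of `A`: the map `A - z : dom A → E` is a bijection whose inverse
`R` is a bounded operator on `E`. -/
def InResolventSet (A : E →ₗ.[𝕜] E) (z : 𝕜) : Prop :=
  ∃ R : E →L[𝕜] E,
    (∀ y : E, ∃ h : R y ∈ A.domain, A ⟨R y, h⟩ - z • R y = y) ∧
    (∀ x : A.domain, R (A x - z • (x : E)) = x)

/-- The spectrum: the complement of the resolvent set. -/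
def spectrumOf (A : E →ₗ.[𝕜] E) : Set 𝕜 := {z | ¬ InResolventSet A z}

/-- The discrete spectrum: isolated points of the spectrum that are eigenvalues of finite
multiplicity. -/
def discreteSpectrum (A : E →ₗ.[𝕜] E) : Set 𝕜 :=
  {z | z ∈ spectrumOf A ∧ (∃ ε > 0, ∀ w ∈ spectrumOf A, ‖w - z‖ < ε → w = z) ∧
    eigenspace A z ≠ ⊥ ∧ FiniteDimensional 𝕜 (eigenspace A z)}

/-- The essential spectrum of a self-adjoint operator: what is left of the spectrum when the
discrete spectrum is removed. -/
def essentialSpectrum (A : E →ₗ.[𝕜] E) : Set 𝕜 := spectrumOf A \ discreteSpectrum A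

/-- The Morse index `n(A)`: the number of negative eigenvalues counted with multiplicity, as a
cardinal. -/
def morseIndex (A : E →ₗ.[𝕜] E) : Cardinal :=
  Cardinal.sum fun μ : Iio (0 : ℝ) => Module.rank 𝕜 (eigenspace A ((μ : ℝ) : 𝕜))

/-- The operator `A` has exactly one negative eigenvalue, and that eigenvalue is simple. -/
def HasUniqueSimpleNegativeEigenvalue (A : E →ₗ.[𝕜] E) : Prop :=
  ∃ l : ℝ, l < 0 ∧ Module.finrank 𝕜 (eigenspace A (l : 𝕜)) = 1 ∧
    ∀ m : ℝ, m < 0 → eigenspace A (m : 𝕜) ≠ ⊥ → m = l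

/-- The operator `A` considered in a subspace `S`: its domain consists of the `x ∈ S ∩ dom A` with
`A x ∈ S`. -/
def restrictTo (A : E →ₗ.[𝕜] E) (S : Submodule 𝕜 E) : S →ₗ.[𝕜] S where
  domain :=
    { carrier := {x | ∃ hx : (x : E) ∈ A.domain, A ⟨x, hx⟩ ∈ S}
      zero_mem' := ⟨A.domain.zero_mem, by
        have h : A ⟨((0 : S) : E), A.domain.zero_mem⟩ = 0 := A.map_zero
        rw [h]; exact S.zero_mem⟩
      add_mem' := by
        rintro x y ⟨hx, ex⟩ ⟨hy, ey⟩
        refine ⟨A.domain.add_mem hx hy, ?_⟩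
        have h := A.map_add ⟨x, hx⟩ ⟨y, hy⟩
        exact (congrArg (· ∈ S) h).mpr (S.add_mem ex ey)
      smul_mem' := by
        rintro c x ⟨hx, ex⟩
        refine ⟨A.domain.smul_mem c hx, ?_⟩
        have h := A.map_smul c ⟨x, hx⟩
        exact (congrArg (· ∈ S) h).mpr (S.smul_mem c ex) }
  toFun :=
    { toFun := fun x => ⟨A ⟨(x : S), x.2.choose⟩, x.2.choose_spec⟩
      map_add' := by
        intro x y
        apply Subtype.ext
        exact A.map_add ⟨(x : S), x.2.choose⟩ ⟨(y : S), y.2.choose⟩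
      map_smul' := by
        intro c x
        apply Subtype.ext
        exact A.map_smul c ⟨(x : S), x.2.choose⟩ }

end Operators

/-! ### Function spaces on the half-line and on the star graph -/

section Spaces

open scoped ContDiff

/-- Lebesgue measure on `(0, ∞)`. -/
abbrev halfLine : Measure ℝ := volume.restrict (Ioi 0)

/-- The space `L²(0, ∞)` with values in `𝕜`. -/
abbrev L2Half (𝕜 : Type*) [RCLike 𝕜] := Lp 𝕜 2 halfLine

/-- The Hilbert space `L²` of the star graph with `N` half-lines (the `ℓ²` direct sum). -/
abbrev L2Graph (𝕜 : Type*) [RCLike 𝕜] (N : ℕ) := PiLp 2 (fun _ : Fin N => L2Half 𝕜)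

variable {𝕜 : Type*} [RCLike 𝕜]

/-- `g` is the weak derivative of `u` on `(0, ∞)`, tested on `C_c^∞((0, ∞))`. -/
def HasWeakDeriv (u g : L2Half 𝕜) : Prop :=
  ∀ φ : ℝ → ℝ, ContDiff ℝ ∞ φ → HasCompactSupport φ → tsupport φ ⊆ Ioi 0 →
    ∫ x in Ioi (0 : ℝ), deriv φ x • u x = -∫ x in Ioi (0 : ℝ), φ x • g x

/-- The boundary value `u(0)` is `c`: the function `u` has a representative that is continuous
on `[0, ∞)` with value `c` at `0`. -/
def HasTrace (u : L2Half 𝕜) (c : 𝕜) : Prop :=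
  ∃ f : ℝ → 𝕜, ContinuousOn f (Ici 0) ∧ u =ᵐ[halfLine] f ∧ f 0 = c

/-- The boundary value `u'(0)` of the weak derivative is `d`. -/
def HasDerivTrace (u : L2Half 𝕜) (d : 𝕜) : Prop :=
  ∃ g : L2Half 𝕜, HasWeakDeriv u g ∧ HasTrace g d

/-- `h` is the second weak derivative of `u`, and the first weak derivative is in `L²` too. -/
def HasSecondWeakDeriv (u h : L2Half 𝕜) : Prop :=
  ∃ g : L2Half 𝕜, HasWeakDeriv u g ∧ HasWeakDeriv g h

/-- Membership in the Sobolev space `H²(0, ∞)`. -/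
def MemH2 (u : L2Half 𝕜) : Prop := ∃ h : L2Half 𝕜, HasSecondWeakDeriv u h

/-- The second weak derivative of an element of `H²(0, ∞)`; see `HasSecondWeakDeriv.unique`. -/
def secondDeriv (u : L2Half 𝕜) (hu : MemH2 u) : L2Half 𝕜 := hu.choose

theorem integrable_smul_L2 {ψ : ℝ → ℝ} (hψ : Continuous ψ) (hc : HasCompactSupport ψ)
    (u : L2Half 𝕜) : Integrable (fun x => ψ x • u x) halfLine := by
  have h1 : MemLp ψ 2 halfLine := (hψ.memLp_of_hasCompactSupport hc).restrict _
  exact memLp_one_iff_integrable.mp ((Lp.memLp u).smul h1)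

theorem HasWeakDeriv.add {u v g h : L2Half 𝕜} (hu : HasWeakDeriv u g) (hv : HasWeakDeriv v h) :
    HasWeakDeriv (u + v) (g + h) := by
  intro φ hφ hc hs
  have hd : Continuous (deriv φ) := hφ.continuous_deriv (by simp)
  have e1 : ∫ x in Ioi (0 : ℝ), deriv φ x • (u + v : L2Half 𝕜) x
      = ∫ x in Ioi (0 : ℝ), (deriv φ x • u x + deriv φ x • v x) := by
    refine integral_congr_ae ?_
    filter_upwards [Lp.coeFn_add u v] with x hx
    rw [hx, Pi.add_apply, smul_add]
  have e2 : ∫ x in Ioi (0 : ℝ), φ x • (g + h : L2Half 𝕜) x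
      = ∫ x in Ioi (0 : ℝ), (φ x • g x + φ x • h x) := by
    refine integral_congr_ae ?_
    filter_upwards [Lp.coeFn_add g h] with x hx
    rw [hx, Pi.add_apply, smul_add]
  rw [e1, e2, integral_add (integrable_smul_L2 hd hc.deriv u) (integrable_smul_L2 hd hc.deriv v),
    integral_add (integrable_smul_L2 hφ.continuous hc g) (integrable_smul_L2 hφ.continuous hc h),
    hu φ hφ hc hs, hv φ hφ hc hs, neg_add]

theorem HasWeakDeriv.smul {u g : L2Half 𝕜} (c : 𝕜) (hu : HasWeakDeriv u g) :
    HasWeakDeriv (c • u) (c • g) := by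
  intro φ hφ hc hs
  have e1 : ∫ x in Ioi (0 : ℝ), deriv φ x • (c • u : L2Half 𝕜) x
      = ∫ x in Ioi (0 : ℝ), c • (deriv φ x • u x) := by
    refine integral_congr_ae ?_
    filter_upwards [Lp.coeFn_smul c u] with x hx
    rw [hx, Pi.smul_apply, smul_comm]
  have e2 : ∫ x in Ioi (0 : ℝ), φ x • (c • g : L2Half 𝕜) x
      = ∫ x in Ioi (0 : ℝ), c • (φ x • g x) := by
    refine integral_congr_ae ?_
    filter_upwards [Lp.coeFn_smul c g] with x hx
    rw [hx, Pi.smul_apply, smul_comm]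
  rw [e1, e2, integral_smul, integral_smul, hu φ hφ hc hs, smul_neg]

theorem HasWeakDeriv.zero : HasWeakDeriv (0 : L2Half 𝕜) 0 := by
  have h : HasWeakDeriv ((0 : 𝕜) • (0 : L2Half 𝕜)) ((0 : 𝕜) • (0 : L2Half 𝕜)) := by
    intro φ _ _ _
    have e : ∀ ψ : ℝ → ℝ,
        ∫ x in Ioi (0 : ℝ), ψ x • ((0 : 𝕜) • (0 : L2Half 𝕜) : L2Half 𝕜) x = 0 := by
      intro ψ
      refine integral_eq_zero_of_ae ?_
      rw [smul_zero]
      filter_upwards [Lp.coeFn_zero 𝕜 2 halfLine] with x hx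
      exact (congrArg (ψ x • ·) hx).trans (smul_zero _)
    rw [e, e, neg_zero]
  simpa using h

theorem HasWeakDeriv.unique {u g h : L2Half 𝕜} (hg : HasWeakDeriv u g) (hh : HasWeakDeriv u h) :
    g = h := by
  have hd : HasWeakDeriv (0 : L2Half 𝕜) (g + (-1 : 𝕜) • h) := by
    have := hg.add (hh.smul (-1 : 𝕜))
    simpa using this
  have hz : ∀ᵐ x ∂(volume : Measure ℝ), x ∈ Ioi (0 : ℝ) → (g + (-1 : 𝕜) • h : L2Half 𝕜) x = 0 := by
    refine isOpen_Ioi.ae_eq_zero_of_integral_contDiff_smul_eq_zero ?_ ?_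
    · have hl : LocallyIntegrable (g + (-1 : 𝕜) • h : L2Half 𝕜) halfLine :=
        (Lp.memLp (g + (-1 : 𝕜) • h)).locallyIntegrable (by norm_num)
      exact locallyIntegrableOn_of_locallyIntegrable_restrict hl
    · intro φ hφ hc hs
      have h1 := hd φ hφ hc hs
      have h0 : ∫ x in Ioi (0 : ℝ), deriv φ x • (0 : L2Half 𝕜) x = 0 := by
        refine integral_eq_zero_of_ae ?_
        filter_upwards [Lp.coeFn_zero 𝕜 2 halfLine] with x hx
        exact (congrArg (deriv φ x • ·) hx).trans (smul_zero _)
      rw [h0] at h1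
      have h2 : ∫ x in Ioi (0 : ℝ), φ x • (g + (-1 : 𝕜) • h : L2Half 𝕜) x = 0 :=
        neg_eq_zero.mp h1.symm
      rw [← h2]
      refine (setIntegral_eq_integral_of_forall_compl_eq_zero ?_).symm
      intro x hx
      have : φ x = 0 := image_eq_zero_of_notMem_tsupport fun hx' => hx (hs hx')
      rw [this, zero_smul]
  have hz' : (g + (-1 : 𝕜) • h : L2Half 𝕜) = 0 := by
    apply Lp.ext
    have h3 : ∀ᵐ x ∂halfLine, (g + (-1 : 𝕜) • h : L2Half 𝕜) x = 0 :=
      (ae_restrict_iff' measurableSet_Ioi).mpr hz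
    filter_upwards [h3, Lp.coeFn_zero 𝕜 2 halfLine] with x hx h0
    rw [hx, h0, Pi.zero_apply]
  rw [neg_one_smul, ← sub_eq_add_neg] at hz'
  exact sub_eq_zero.mp hz'

theorem HasSecondWeakDeriv.add {u v g h : L2Half 𝕜} (hu : HasSecondWeakDeriv u g)
    (hv : HasSecondWeakDeriv v h) : HasSecondWeakDeriv (u + v) (g + h) := by
  obtain ⟨a, ha, ha'⟩ := hu
  obtain ⟨b, hb, hb'⟩ := hv
  exact ⟨a + b, ha.add hb, ha'.add hb'⟩

theorem HasSecondWeakDeriv.smul {u g : L2Half 𝕜} (c : 𝕜) (hu : HasSecondWeakDeriv u g) :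
    HasSecondWeakDeriv (c • u) (c • g) := by
  obtain ⟨a, ha, ha'⟩ := hu
  exact ⟨c • a, ha.smul c, ha'.smul c⟩

theorem HasSecondWeakDeriv.unique {u g h : L2Half 𝕜} (hg : HasSecondWeakDeriv u g)
    (hh : HasSecondWeakDeriv u h) : g = h := by
  obtain ⟨a, ha, ha'⟩ := hg
  obtain ⟨b, hb, hb'⟩ := hh
  obtain rfl := ha.unique hb
  exact ha'.unique hb'

theorem secondDeriv_spec (u : L2Half 𝕜) (hu : MemH2 u) :
    HasSecondWeakDeriv u (secondDeriv u hu) := hu.choose_spec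

theorem HasTrace.add {u v : L2Half 𝕜} {c d : 𝕜} (hu : HasTrace u c) (hv : HasTrace v d) :
    HasTrace (u + v) (c + d) := by
  obtain ⟨f, hf, huf, rfl⟩ := hu
  obtain ⟨g, hg, hvg, rfl⟩ := hv
  exact ⟨f + g, hf.add hg, (Lp.coeFn_add u v).trans (huf.add hvg), rfl⟩

theorem HasTrace.smul {u : L2Half 𝕜} {c : 𝕜} (a : 𝕜) (hu : HasTrace u c) :
    HasTrace (a • u) (a • c) := by
  obtain ⟨f, hf, huf, rfl⟩ := hu
  exact ⟨a • f, hf.const_smul a, (Lp.coeFn_smul a u).trans (huf.const_smul a), rfl⟩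

theorem HasTrace.zero : HasTrace (0 : L2Half 𝕜) 0 :=
  ⟨0, continuousOn_const, Lp.coeFn_zero 𝕜 2 halfLine, rfl⟩

/-- The vectors `V` in `H²` of the graph with `v_1(0) = ⋯ = v_N(0)` and `∑ v_j'(0) = 0`. -/
def kirchhoffDomain (𝕜 : Type*) [RCLike 𝕜] (N : ℕ) : Submodule 𝕜 (L2Graph 𝕜 N) where
  carrier := {V | (∀ j, MemH2 (V j)) ∧ (∃ c : 𝕜, ∀ j, HasTrace (V j) c) ∧
    ∃ d : Fin N → 𝕜, (∀ j, HasDerivTrace (V j) (d j)) ∧ ∑ j, d j = 0}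
  zero_mem' := ⟨fun _ => ⟨0, 0, HasWeakDeriv.zero, HasWeakDeriv.zero⟩, ⟨0, fun _ => HasTrace.zero⟩,
    0, fun _ => ⟨0, HasWeakDeriv.zero, HasTrace.zero⟩, by simp⟩
  add_mem' := by
    rintro V W ⟨hV, ⟨c, hc⟩, d, hd, sd⟩ ⟨hW, ⟨c', hc'⟩, d', hd', sd'⟩
    refine ⟨fun j => ?_, ⟨c + c', fun j => (hc j).add (hc' j)⟩, d + d', fun j => ?_, ?_⟩
    · obtain ⟨g, hg⟩ := hV j
      obtain ⟨h, hh⟩ := hW j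
      exact ⟨g + h, hg.add hh⟩
    · obtain ⟨g, hg, tg⟩ := hd j
      obtain ⟨h, hh, th⟩ := hd' j
      exact ⟨g + h, hg.add hh, tg.add th⟩
    · simp [Finset.sum_add_distrib, sd, sd']
  smul_mem' := by
    rintro a V ⟨hV, ⟨c, hc⟩, d, hd, sd⟩
    refine ⟨fun j => ?_, ⟨a • c, fun j => (hc j).smul a⟩, a • d, fun j => ?_, ?_⟩
    · obtain ⟨g, hg⟩ := hV j
      exact ⟨a • g, hg.smul a⟩
    · obtain ⟨g, hg, tg⟩ := hd j
      exact ⟨a • g, hg.smul a, tg.smul a⟩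
    · simp [← Finset.mul_sum, sd]

/-- The vectors in `L²` of the graph whose first `k` components coincide and whose last `N - k`
components coincide. -/
def L2Sym (𝕜 : Type*) [RCLike 𝕜] (N k : ℕ) : Submodule 𝕜 (L2Graph 𝕜 N) where
  carrier := {V | (∀ i j : Fin N, (i : ℕ) < k → (j : ℕ) < k → V i = V j) ∧
    ∀ i j : Fin N, k ≤ (i : ℕ) → k ≤ (j : ℕ) → V i = V j}
  zero_mem' := ⟨fun _ _ _ _ => rfl, fun _ _ _ _ => rfl⟩
  add_mem' := by
    rintro V W ⟨hV, hV'⟩ ⟨hW, hW'⟩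
    refine ⟨fun i j hi hj => ?_, fun i j hi hj => ?_⟩
    · rw [PiLp.add_apply, PiLp.add_apply, hV i j hi hj, hW i j hi hj]
    · rw [PiLp.add_apply, PiLp.add_apply, hV' i j hi hj, hW' i j hi hj]
  smul_mem' := by
    rintro a V ⟨hV, hV'⟩
    refine ⟨fun i j hi hj => ?_, fun i j hi hj => ?_⟩
    · rw [PiLp.smul_apply, PiLp.smul_apply, hV i j hi hj]
    · rw [PiLp.smul_apply, PiLp.smul_apply, hV' i j hi hj]

end Spaces

/-! ### The half-soliton and the linearized operator -/

section Soliton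

/-- The half-soliton `φ₀(x) = [((p+1)ω/2) sech²((p-1)√ω x / 2)]^{1/(p-1)}`. -/
def phi0 (p ω x : ℝ) : ℝ :=
  ((p + 1) * ω / 2 * (1 / Real.cosh ((p - 1) * √ω / 2 * x)) ^ 2) ^ (1 / (p - 1))

theorem phi0_rpow {p ω : ℝ} (hp : 1 < p) (hω : 0 < ω) (x : ℝ) : (phi0 p ω x) ^ (p - 1) =
    (p + 1) * ω / 2 * (1 / Real.cosh ((p - 1) * √ω / 2 * x)) ^ 2 := by
  have h : p - 1 ≠ 0 := by linarith
  have h0 : 0 ≤ (p + 1) * ω / 2 * (1 / Real.cosh ((p - 1) * √ω / 2 * x)) ^ 2 := by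
    have : 0 < p + 1 := by linarith
    positivity
  rw [phi0, ← Real.rpow_mul h0, one_div_mul_cancel h, Real.rpow_one]

theorem continuous_potential {p ω : ℝ} (hp : 1 < p) (hω : 0 < ω) :
    Continuous fun x => (phi0 p ω x) ^ (p - 1) := by
  simp_rw [phi0_rpow hp hω]
  have : ∀ x, Real.cosh ((p - 1) * √ω / 2 * x) ≠ 0 := fun x => (Real.cosh_pos _).ne'
  have h2 : Continuous fun x => Real.cosh ((p - 1) * √ω / 2 * x) :=
    Real.continuous_cosh.comp (by fun_prop)
  exact continuous_const.mul ((continuous_const.div h2 this).pow 2)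

theorem potential_bound {p ω : ℝ} (hp : 1 < p) (hω : 0 < ω) (x : ℝ) :
    |(phi0 p ω x) ^ (p - 1)| ≤ (p + 1) * ω / 2 := by
  have hC : 0 ≤ (p + 1) * ω / 2 := by
    have : 0 < p + 1 := by linarith
    positivity
  have h1 : 1 / Real.cosh ((p - 1) * √ω / 2 * x) ≤ 1 :=
    (div_le_one (Real.cosh_pos _)).mpr (Real.one_le_cosh _)
  have h0 : 0 ≤ 1 / Real.cosh ((p - 1) * √ω / 2 * x) := by positivity
  rw [phi0_rpow hp hω, abs_of_nonneg (by positivity)]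
  exact mul_le_of_le_one_right hC (pow_le_one₀ h0 h1)

variable {𝕜 : Type*} [RCLike 𝕜]

theorem memLp_potential_mul {p ω : ℝ} (hp : 1 < p) (hω : 0 < ω) (u : L2Half 𝕜) :
    MemLp (fun x => (phi0 p ω x) ^ (p - 1) • u x) 2 halfLine := by
  refine MemLp.of_le_mul (c := (p + 1) * ω / 2) (Lp.memLp u) ?_ ?_
  · exact (continuous_potential hp hω).aestronglyMeasurable.smul (Lp.aestronglyMeasurable u)
  · refine Eventually.of_forall fun x => ?_
    rw [norm_smul, Real.norm_eq_abs]
    exact mul_le_mul_of_nonneg_right (potential_bound hp hω x) (norm_nonneg _)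

/-- Multiplication by the potential `φ₀^{p-1}` on `L²(0, ∞)`. -/
def potentialMul {p ω : ℝ} (hp : 1 < p) (hω : 0 < ω) : L2Half 𝕜 →ₗ[𝕜] L2Half 𝕜 where
  toFun u := (memLp_potential_mul hp hω u).toLp
    (fun x => (phi0 p ω x) ^ (p - 1) • u x)
  map_add' u v := by
    rw [← MemLp.toLp_add]
    refine MemLp.toLp_congr _ _ ?_
    filter_upwards [Lp.coeFn_add u v] with x hx
    rw [hx, Pi.add_apply, smul_add, Pi.add_apply]
  map_smul' c u := by
    rw [RingHom.id_apply, ← MemLp.toLp_const_smul]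
    refine MemLp.toLp_congr _ _ ?_
    filter_upwards [Lp.coeFn_smul c u] with x hx
    rw [hx, Pi.smul_apply, smul_comm, Pi.smul_apply]

/-- The scalar expression `-u'' + ω u - p φ₀^{p-1} u` for `u ∈ H²(0, ∞)`. -/
def edgeExpr {p ω : ℝ} (hp : 1 < p) (hω : 0 < ω) (u : L2Half 𝕜) (hu : MemH2 u) : L2Half 𝕜 :=
  -secondDeriv u hu + (ω : 𝕜) • u - (p : 𝕜) • potentialMul hp hω u

theorem edgeExpr_add {p ω : ℝ} (hp : 1 < p) (hω : 0 < ω) {u v : L2Half 𝕜} (hu : MemH2 u)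
    (hv : MemH2 v) (huv : MemH2 (u + v)) :
    edgeExpr hp hω (u + v) huv = edgeExpr hp hω u hu + edgeExpr hp hω v hv := by
  have h : secondDeriv (u + v) huv = secondDeriv u hu + secondDeriv v hv :=
    (secondDeriv_spec _ _).unique ((secondDeriv_spec _ _).add (secondDeriv_spec _ _))
  simp only [edgeExpr, h, map_add, smul_add]
  abel

theorem edgeExpr_smul {p ω : ℝ} (hp : 1 < p) (hω : 0 < ω) (c : 𝕜) {u : L2Half 𝕜} (hu : MemH2 u)
    (hcu : MemH2 (c • u)) :
    edgeExpr hp hω (c • u) hcu = c • edgeExpr hp hω u hu := by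
  have h : secondDeriv (c • u) hcu = c • secondDeriv u hu :=
    (secondDeriv_spec _ _).unique ((secondDeriv_spec _ _).smul c)
  simp only [edgeExpr, h, map_smul, smul_sub, smul_add, smul_neg, smul_comm c (ω : 𝕜),
    smul_comm c (p : 𝕜)]

/-- The linearized operator `(-d²/dx² + ω - p φ₀^{p-1}) δ_{ij}` on the star graph with the Kirchhoff
condition at the vertex. -/
def kirchhoffOp (𝕜 : Type*) [RCLike 𝕜] (N : ℕ) {p ω : ℝ} (hp : 1 < p) (hω : 0 < ω) :
    L2Graph 𝕜 N →ₗ.[𝕜] L2Graph 𝕜 N where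
  domain := kirchhoffDomain 𝕜 N
  toFun :=
    { toFun := fun V =>
        WithLp.toLp 2 fun j => edgeExpr hp hω ((V : L2Graph 𝕜 N) j) (V.2.1 j)
      map_add' := by
        intro V W
        ext1 j
        exact edgeExpr_add hp hω (V.2.1 j) (W.2.1 j) ((V + W).2.1 j)
      map_smul' := by
        intro c V
        ext1 j
        exact edgeExpr_smul hp hω c (V.2.1 j) ((c • V).2.1 j) }

/-- The operator maps the symmetric part of its domain into the symmetric subspace, so that
`restrictTo (kirchhoffOp …) (L2Sym …)` has the domain `kirchhoffDomain ∩ L2Sym`. -/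
theorem kirchhoffOp_mem_L2Sym {N k : ℕ} {p ω : ℝ} (hp : 1 < p) (hω : 0 < ω)
    (V : (kirchhoffOp 𝕜 N hp hω).domain) (hV : (V : L2Graph 𝕜 N) ∈ L2Sym 𝕜 N k) :
    kirchhoffOp 𝕜 N hp hω V ∈ L2Sym 𝕜 N k := by
  have key : ∀ (u v : L2Half 𝕜) (hu : MemH2 u) (hv : MemH2 v), u = v →
      edgeExpr hp hω u hu = edgeExpr hp hω v hv := by
    rintro u v hu hv rfl
    rfl
  exact ⟨fun i j hi hj => key _ _ _ _ (hV.1 i j hi hj),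
    fun i j hi hj => key _ _ _ _ (hV.2 i j hi hj)⟩

theorem hasDerivAt_phi0 {p ω : ℝ} (hp : 1 < p) (hω : 0 < ω) (x : ℝ) :
    HasDerivAt (phi0 p ω) (-√ω * Real.tanh ((p - 1) * √ω / 2 * x) * phi0 p ω x) x := by
  have hC : 0 < (p + 1) * ω / 2 := by
    have : 0 < p + 1 := by linarith
    positivity
  have hp1 : p - 1 ≠ 0 := by linarith
  set b : ℝ := (p - 1) * √ω / 2 with hb
  have hc : 0 < Real.cosh (b * x) := Real.cosh_pos _
  have h1 : HasDerivAt (fun y => Real.cosh (b * y)) (Real.sinh (b * x) * b) x := by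
    have := ((hasDerivAt_id x).const_mul b).cosh
    simpa using this
  have h2 : HasDerivAt (fun y => (p + 1) * ω / 2 * (1 / Real.cosh (b * y)) ^ 2)
      ((p + 1) * ω / 2 * (2 * (1 / Real.cosh (b * x)) *
        (-(Real.sinh (b * x) * b) / Real.cosh (b * x) ^ 2))) x := by
    have := ((h1.inv hc.ne').pow 2).const_mul ((p + 1) * ω / 2)
    simpa [one_div, Pi.pow_def] using this
  have h3 := h2.rpow_const (p := 1 / (p - 1)) (Or.inl (by positivity))
  refine h3.congr_deriv ?_
  have hB : 0 < (p + 1) * ω / 2 * (1 / Real.cosh (b * x)) ^ 2 := by positivity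
  rw [phi0, ← hb, Real.rpow_sub_one hB.ne', Real.tanh_eq_sinh_div_cosh]
  generalize ((p + 1) * ω / 2 * (1 / Real.cosh (b * x)) ^ 2) ^ (1 / (p - 1)) = P
  have hp2 : p + 1 ≠ 0 := by linarith
  have : b = (p - 1) * √ω / 2 := hb
  clear_value b
  field_simp
  rw [this]
  ring

theorem phi0_le {p ω : ℝ} (hp : 1 < p) (hω : 0 < ω) (x : ℝ) :
    |phi0 p ω x| ≤ ((p + 1) * ω / 2 * 4) ^ (1 / (p - 1)) * Real.exp (-√ω * x) := by
  have hC : 0 < (p + 1) * ω / 2 := by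
    have : 0 < p + 1 := by linarith
    positivity
  have hp1 : 0 < p - 1 := by linarith
  set y : ℝ := (p - 1) * √ω / 2 * x with hy
  have hB : 0 ≤ (p + 1) * ω / 2 * (1 / Real.cosh y) ^ 2 := by positivity
  have h1 : 1 / Real.cosh y ≤ 2 * Real.exp (-y) := by
    rw [div_le_iff₀ (Real.cosh_pos y), Real.cosh_eq]
    have e1 : Real.exp (-y) * Real.exp y = 1 := by rw [← Real.exp_add]; simp
    nlinarith [Real.exp_pos (-y), Real.exp_pos y, mul_pos (Real.exp_pos (-y)) (Real.exp_pos (-y))]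
  have h2 : (1 / Real.cosh y) ^ 2 ≤ 4 * Real.exp (-2 * y) := by
    have h0 : 0 ≤ 1 / Real.cosh y := by positivity
    have e1 : Real.exp (-2 * y) = Real.exp (-y) ^ 2 := by
      rw [← Real.exp_nat_mul]; congr 1; push_cast; ring
    rw [e1]
    nlinarith [Real.exp_pos (-y)]
  have h3 : phi0 p ω x ≤ ((p + 1) * ω / 2 * 4 * Real.exp (-2 * y)) ^ (1 / (p - 1)) := by
    refine Real.rpow_le_rpow hB ?_ (by positivity)
    rw [mul_assoc]
    exact mul_le_mul_of_nonneg_left h2 hC.le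
  have h4 : ((p + 1) * ω / 2 * 4 * Real.exp (-2 * y)) ^ (1 / (p - 1))
      = ((p + 1) * ω / 2 * 4) ^ (1 / (p - 1)) * Real.exp (-√ω * x) := by
    rw [Real.mul_rpow (by positivity) (Real.exp_pos _).le, ← Real.exp_mul]
    congr 2
    rw [hy]
    field_simp
  have h5 : 0 ≤ phi0 p ω x := Real.rpow_nonneg hB _
  rw [abs_of_nonneg h5, ← h4]
  exact h3

theorem memLp_deriv_phi0 {p ω : ℝ} (hp : 1 < p) (hω : 0 < ω) :
    MemLp (fun x => ((deriv (phi0 p ω) x : ℝ) : 𝕜)) 2 halfLine := by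
  have hs : 0 < √ω := Real.sqrt_pos.mpr hω
  have hd : deriv (phi0 p ω) =
      fun x => -√ω * Real.tanh ((p - 1) * √ω / 2 * x) * phi0 p ω x :=
    funext fun x => (hasDerivAt_phi0 hp hω x).deriv
  have hexp : MemLp (fun x => Real.exp (-√ω * x)) 2 halfLine := by
    rw [memLp_two_iff_integrable_sq (by fun_prop)]
    have h := integrableOn_exp_mul_Ioi (a := -(2 * √ω)) (by linarith) 0
    refine h.congr (Eventually.of_forall fun x => ?_)
    change Real.exp (-(2 * √ω) * x) = Real.exp (-√ω * x) ^ 2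
    rw [← Real.exp_nat_mul]
    congr 1
    push_cast
    ring
  refine MemLp.of_le_mul (c := √ω * ((p + 1) * ω / 2 * 4) ^ (1 / (p - 1))) hexp ?_ ?_
  · exact (RCLike.measurable_ofReal.comp (measurable_deriv _)).aestronglyMeasurable
  · refine Eventually.of_forall fun x => ?_
    rw [RCLike.norm_ofReal, hd, abs_mul, abs_mul, abs_neg, abs_of_pos hs, Real.norm_eq_abs,
      abs_of_pos (Real.exp_pos _), mul_assoc, mul_assoc]
    refine mul_le_mul_of_nonneg_left ?_ hs.le
    calc |Real.tanh ((p - 1) * √ω / 2 * x)| * |phi0 p ω x|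
        ≤ 1 * |phi0 p ω x| :=
          mul_le_mul_of_nonneg_right (Real.abs_tanh_lt_one _).le (abs_nonneg _)
      _ ≤ _ := by rw [one_mul]; exact phi0_le hp hω x

/-- The function `φ₀'` as an element of `L²(0, ∞)`. -/
def phi0Deriv (𝕜 : Type*) [RCLike 𝕜] {p ω : ℝ} (hp : 1 < p) (hω : 0 < ω) : L2Half 𝕜 :=
  (memLp_deriv_phi0 hp hω).toLp (fun x => ((deriv (phi0 p ω) x : ℝ) : 𝕜))

/-- The vector with `φ₀'` on edge `j`, `-φ₀'` on edge `j + 1` and `0` elsewhere (the edges are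
numbered `0, …, N - 1`, and `j + 1 ≤ N - 1`). -/
def kernelVector (𝕜 : Type*) [RCLike 𝕜] (N : ℕ) {p ω : ℝ} (hp : 1 < p) (hω : 0 < ω)
    (j : Fin (N - 1)) : L2Graph 𝕜 N :=
  WithLp.toLp 2 fun i => if (i : ℕ) = j then phi0Deriv 𝕜 hp hω
    else if (i : ℕ) = j + 1 then -phi0Deriv 𝕜 hp hω else 0

/-- The vector with `((N - k) / k) φ₀'` on the first `k` edges and `-φ₀'` on the others. -/
def symKernelVector (𝕜 : Type*) [RCLike 𝕜] (N k : ℕ) {p ω : ℝ} (hp : 1 < p) (hω : 0 < ω) :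
    L2Graph 𝕜 N :=
  WithLp.toLp 2 fun i => if (i : ℕ) < k then (((N : 𝕜) - k) / k) • phi0Deriv 𝕜 hp hω
    else -phi0Deriv 𝕜 hp hω

end Soliton

end KirchhoffStar

end

noncomputable section

namespace KirchhoffStar

/-! ### Absolutely continuous functions with values in `𝕜` -/

section AbsolutelyContinuous

open scoped ContDiff

variable {𝕜 : Type*} [RCLike 𝕜]

/-! Write q = ω - p φ₀^{p-1}. Differentiating φ₀'' = ω φ₀ - φ₀^p shows that φ₀' solves -f'' + q f =
0; it vanishes at 0 and nowhere on (0, ∞). This one function governs both the kernel and the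
negative spectrum.

Kernel. On an edge, the Wronskian of a square integrable solution with φ₀' is constant and
integrable, hence zero, so the component is c_j φ₀' (`IsSol.eq_mul_deriv_phi0`). Continuity at the
vertex is then automatic, and the derivative condition reads (∑ c_j) φ₀''(0) = 0 with φ₀''(0) ≠ 0.
The kernel is therefore a copy of the hyperplane ∑ c_j = 0, and in L²_k the relation k a + (N - k) b
= 0 leaves a line.

Negative eigenvalues. The function φ₀ sech((p-1)√ω x / 2), repeated on every edge, is an eigenvector
for ω - (p+1)²ω/4 < 0. Uniqueness rests on Jacobi's argument: S = φ₀''/φ₀' solves S' = q - S², and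
completing the square makes the quadratic form nonnegative on vectors vanishing at the vertex
(`IsSol.integral_inner_nonneg`). By continuity, vanishing there is a single linear condition, met by
any eigenvector minus a suitable multiple of the ground state; a second negative direction would
contradict the sign (`eq_smul_groundVector_of_mem_eigenspace`). The ground state lies in every L²_k,
which settles the restrictions too.

Essential spectrum. With W the multiplication by p φ₀^{p-1}, the operator A + W - (ω - 1) is -d²/dx²
+ 1 with the Kirchhoff condition. It has a bounded inverse B with 0 ≤ B ≤ 1, and W B is compact
because the potential decays (`isCompactOperator_mul_comp`). For z outside [ω, ∞), (A - z) B is thus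
an invertible operator times a compact perturbation of the identity, and every spectral point there
is an isolated eigenvalue of finite multiplicity (`IsRegularizer.mem_discreteSpectrum`). Truncated
waves put all of [ω, ∞) into the spectrum (`exists_approximate_solution`). The gap above 0 is the
isolation of the eigenvalue 0. -/

theorem absolutelyContinuousOnInterval_primitive {f : ℝ → 𝕜} {a b : ℝ}
    (h : IntervalIntegrable f volume a b) :
    AbsolutelyContinuousOnInterval (fun x => ∫ t in a..x, f t) a b := by
  -- The increments of the primitive of `f` are dominated by those of the real primitive of `‖f‖`,
  -- so the δ belonging to the latter serves.
  have hn := h.norm.absolutelyContinuousOnInterval_intervalIntegral (c := a) left_mem_uIcc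
  rw [absolutelyContinuousOnInterval_iff] at hn ⊢
  intro ε hε
  obtain ⟨δ, hδ, H⟩ := hn ε hε
  refine ⟨δ, hδ, fun E hE hlen => lt_of_le_of_lt (Finset.sum_le_sum fun i hi => ?_) (H E hE hlen)⟩
  have hm := hE.1 i hi
  have hsub : ∀ x ∈ uIcc a b, IntervalIntegrable f volume a x := fun x hx =>
    h.mono_set (uIcc_subset_uIcc left_mem_uIcc hx)
  rw [dist_eq_norm, dist_eq_norm,
    intervalIntegral.integral_interval_sub_left (hsub _ hm.1) (hsub _ hm.2),
    intervalIntegral.integral_interval_sub_left (hsub _ hm.1).norm (hsub _ hm.2).norm]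
  exact intervalIntegral.norm_integral_le_abs_integral_norm

/-- The product rule for primitives of integrable functions. -/
theorem integral_primitive_mul {f₁ f₂ g₁ g₂ : ℝ → 𝕜} {a b : ℝ} (hab : a ≤ b)
    (h₁ : IntervalIntegrable g₁ volume a b) (h₂ : IntervalIntegrable g₂ volume a b)
    (hf₁ : ∀ x ∈ Icc a b, f₁ x = f₁ a + ∫ t in a..x, g₁ t)
    (hf₂ : ∀ x ∈ Icc a b, f₂ x = f₂ a + ∫ t in a..x, g₂ t) :
    ∫ x in a..b, (g₁ x * f₂ x + f₁ x * g₂ x) = f₁ b * f₂ b - f₁ a * f₂ a := by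
  set F₁ : ℝ → 𝕜 := fun x => f₁ a + ∫ t in a..x, g₁ t with hF₁
  set F₂ : ℝ → 𝕜 := fun x => f₂ a + ∫ t in a..x, g₂ t with hF₂
  have cst : ∀ c : 𝕜, AbsolutelyContinuousOnInterval (fun _ : ℝ => c) a b := fun c =>
    (contDiff_const.contDiffOn (n := 1)).absolutelyContinuousOnInterval
  have A₁ : AbsolutelyContinuousOnInterval F₁ a b :=
    (cst _).fun_add (absolutelyContinuousOnInterval_primitive h₁)
  have A₂ : AbsolutelyContinuousOnInterval F₂ a b :=
    (cst _).fun_add (absolutelyContinuousOnInterval_primitive h₂)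
  have hint : IntervalIntegrable (fun x => g₁ x * F₂ x + F₁ x * g₂ x) volume a b :=
    (h₁.mul_continuousOn A₂.continuousOn).add (h₂.continuousOn_mul A₁.continuousOn)
  -- The product minus the primitive of its formal derivative is absolutely continuous with
  -- derivative zero almost everywhere, hence constant; comparing the endpoints gives the formula.
  have A₃ : AbsolutelyContinuousOnInterval
      (fun x => F₁ x * F₂ x - ∫ t in a..x, (g₁ t * F₂ t + F₁ t * g₂ t)) a b :=
    (A₁.fun_smul A₂).fun_sub (absolutelyContinuousOnInterval_primitive hint)
  obtain ⟨C, hC⟩ := A₃.const_of_ae_hasDerivAt_zero (by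
    filter_upwards [h₁.ae_hasDerivAt_integral, h₂.ae_hasDerivAt_integral,
      hint.ae_hasDerivAt_integral] with x e₁ e₂ e₃ hx
    have d₁ := (e₁ hx a left_mem_uIcc).const_add (f₁ a)
    have d₂ := (e₂ hx a left_mem_uIcc).const_add (f₂ a)
    exact ((d₁.mul d₂).sub (e₃ hx a left_mem_uIcc)).congr_deriv (by simp [hF₁, hF₂]))
  have ha := hC a left_mem_uIcc
  have hb := hC b right_mem_uIcc
  have e₁ : F₁ a = f₁ a := by simp [hF₁]
  have e₂ : F₂ a = f₂ a := by simp [hF₂]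
  rw [intervalIntegral.integral_same, e₁, e₂, sub_zero] at ha
  have e₃ : ∫ t in a..b, (g₁ t * F₂ t + F₁ t * g₂ t)
      = ∫ t in a..b, (g₁ t * f₂ t + f₁ t * g₂ t) := by
    refine intervalIntegral.integral_congr fun x hx => ?_
    rw [uIcc_of_le hab] at hx
    simp only [hf₁ x hx, hf₂ x hx, hF₁, hF₂]
  have e₄ : f₁ b = F₁ b := hf₁ b (right_mem_Icc.mpr hab)
  have e₅ : f₂ b = F₂ b := hf₂ b (right_mem_Icc.mpr hab)
  rw [e₄, e₅, ← e₃]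
  linear_combination ha - hb

end AbsolutelyContinuous

/-! ### Weak derivatives on the half-line -/

section WeakDerivatives

open scoped ContDiff

variable {𝕜 : Type*} [RCLike 𝕜]

theorem intervalIntegrable_of_memLp {f : ℝ → 𝕜} (hf : MemLp f 2 halfLine) {a b : ℝ} (ha : 0 ≤ a)
    (hab : a ≤ b) : IntervalIntegrable f volume a b := by
  rw [intervalIntegrable_iff_integrableOn_Ioc_of_le hab]
  have h : MemLp f 2 (volume.restrict (Ioc a b)) :=
    hf.mono_measure (Measure.restrict_mono (fun x hx => lt_of_le_of_lt ha hx.1) le_rfl)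
  exact h.integrable (by norm_num)

theorem intervalIntegrable_L2 (g : L2Half 𝕜) {a b : ℝ} (ha : 0 ≤ a) (hab : a ≤ b) :
    IntervalIntegrable g volume a b :=
  intervalIntegrable_of_memLp (Lp.memLp g) ha hab

theorem continuousOn_primitive_L2 (g : L2Half 𝕜) :
    ContinuousOn (fun x => ∫ t in (0 : ℝ)..x, g t) (Ici 0) := by
  intro x hx
  have h := intervalIntegral.continuousOn_primitive_interval'
    (intervalIntegrable_L2 g le_rfl (show (0 : ℝ) ≤ x + 1 by simp at hx; linarith)) left_mem_uIcc
  have hx0 : (0 : ℝ) ≤ x := hx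
  rw [uIcc_of_le (by linarith)] at h
  refine (h x ⟨hx0, by linarith⟩).mono_of_mem_nhdsWithin ?_
  rw [← Ici_inter_Iic]
  exact inter_mem_nhdsWithin _ (Iic_mem_nhds (by linarith))

/-- The two sides of an integration by parts against a test function, for a primitive. -/
theorem integral_deriv_smul_primitive {φ : ℝ → ℝ} (hφ : ContDiff ℝ ∞ φ)
    (hc : HasCompactSupport φ) (hs : tsupport φ ⊆ Ioi 0) (g : L2Half 𝕜) :
    ∫ x in Ioi (0 : ℝ), deriv φ x • (∫ t in (0 : ℝ)..x, g t)
      = -∫ x in Ioi (0 : ℝ), φ x • g x := by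
  obtain ⟨R, hR0, hR⟩ : ∃ R : ℝ, 0 < R ∧ tsupport φ ⊆ Ioo 0 R := by
    obtain ⟨R, hR⟩ := hc.isCompact.isBounded.subset_closedBall 0
    refine ⟨max R 0 + 1, by positivity, fun x hx => ⟨hs hx, ?_⟩⟩
    have := hR hx
    rw [Metric.mem_closedBall, dist_zero_right, Real.norm_eq_abs] at this
    have h2 := le_abs_self x
    have h3 := le_max_left R 0
    linarith
  have hφ0 : ∀ x, x ∉ Ioo 0 R → φ x = 0 := fun x hx =>
    image_eq_zero_of_notMem_tsupport fun h => hx (hR h)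
  have hφ0' : ∀ x, x ∉ Ioo 0 R → deriv φ x = 0 := fun x hx =>
    image_eq_zero_of_notMem_tsupport fun h => hx (hR (tsupport_deriv_subset h))
  have hd : Continuous (deriv φ) := hφ.continuous_deriv (by simp)
  have key := integral_primitive_mul (𝕜 := 𝕜) (f₁ := fun x => (φ x : 𝕜))
    (g₁ := fun x => ((deriv φ x : ℝ) : 𝕜)) (f₂ := fun x => ∫ t in (0 : ℝ)..x, g t) (g₂ := g)
    hR0.le (Continuous.intervalIntegrable (by fun_prop) _ _)
    (intervalIntegrable_L2 g le_rfl hR0.le)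
    (fun x _ => by
      have : ∫ t in (0 : ℝ)..x, ((deriv φ t : ℝ) : 𝕜) = ((∫ t in (0 : ℝ)..x, deriv φ t : ℝ) : 𝕜) :=
        (RCLike.ofRealCLM : ℝ →L[ℝ] 𝕜).intervalIntegral_comp_comm (hd.intervalIntegrable _ _)
      rw [this, intervalIntegral.integral_deriv_eq_sub]
      · push_cast; ring
      · intro y _; exact hφ.differentiable (by simp) y
      · exact hd.intervalIntegrable _ _)
    (fun x _ => by simp)
  have conv : ∀ F : ℝ → 𝕜, (∀ x, x ∉ Ioo 0 R → F x = 0) →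
      ∫ x in (0 : ℝ)..R, F x = ∫ x in Ioi (0 : ℝ), F x := by
    intro F hF
    rw [intervalIntegral.integral_of_le hR0.le]
    exact (setIntegral_eq_of_subset_of_forall_sdiff_eq_zero measurableSet_Ioi
      (fun x hx => hx.1)
      (fun x hx => hF x fun h : x ∈ Ioo 0 R => hx.2 (Ioo_subset_Ioc_self h))).symm
  have i₁ : IntervalIntegrable (fun x => ((deriv φ x : ℝ) : 𝕜) * ∫ t in (0 : ℝ)..x, g t)
      volume 0 R := by
    refine ContinuousOn.intervalIntegrable ?_
    rw [uIcc_of_le hR0.le]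
    exact (Continuous.continuousOn (by fun_prop)).mul
      ((continuousOn_primitive_L2 g).mono fun x hx => hx.1)
  have i₂ : IntervalIntegrable (fun x => (φ x : 𝕜) * g x) volume 0 R :=
    (intervalIntegrable_L2 g le_rfl hR0.le).continuousOn_mul
      (Continuous.continuousOn (RCLike.continuous_ofReal.comp hφ.continuous))
  rw [intervalIntegral.integral_add i₁ i₂, conv _ (fun x hx => by simp [hφ0' x hx]),
    conv _ (fun x hx => by simp [hφ0 x hx]), hφ0 R (by simp)] at key
  simp only [RCLike.real_smul_eq_coe_mul]
  rw [eq_neg_iff_add_eq_zero, key]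
  simp

/-- A locally integrable function on `(0, ∞)` with vanishing weak derivative is constant. -/
theorem ae_eq_const_of_integral_deriv_smul_eq_zero {w : ℝ → 𝕜}
    (hw : LocallyIntegrableOn w (Ioi 0))
    (h : ∀ φ : ℝ → ℝ, ContDiff ℝ ∞ φ → HasCompactSupport φ → tsupport φ ⊆ Ioi 0 →
      ∫ x in Ioi (0 : ℝ), deriv φ x • w x = 0) :
    ∃ c : 𝕜, w =ᵐ[halfLine] fun _ => c := by
  have hint : ∀ ψ : ℝ → ℝ, Continuous ψ → HasCompactSupport ψ → tsupport ψ ⊆ Ioi 0 →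
      IntegrableOn (fun x => ψ x • w x) (Ioi 0) := by
    intro ψ hψ hc hs
    have h1 : IntegrableOn w (tsupport ψ) := hw.integrableOn_compact_subset hs hc
    have h2 : IntegrableOn (fun x => ψ x • w x) (tsupport ψ) :=
      h1.continuousOn_smul hψ.continuousOn hc
    have h3 : Integrable (fun x => ψ x • w x) := by
      refine (integrableOn_iff_integrable_of_support_subset ?_).mp h2
      exact (Function.support_smul_subset_left ψ w).trans (subset_tsupport ψ)
    exact h3.integrableOn
  -- A reference mass: any bump of integral 1 supported in (0, ∞) would do. The constant sought is
  -- the average of `w` against it.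
  let β : ContDiffBump (2 : ℝ) := ⟨1 / 2, 1, by norm_num, by norm_num⟩
  have hβs : tsupport (β.normed volume) ⊆ Icc 1 3 := by
    rw [β.tsupport_normed_eq]
    intro x hx
    rw [Metric.mem_closedBall, Real.dist_eq, abs_le] at hx
    change -1 ≤ x - 2 ∧ x - 2 ≤ 1 at hx
    constructor <;> linarith
  set ρ : ℝ → ℝ := β.normed volume with hρ
  have ρc : HasCompactSupport ρ := β.hasCompactSupport_normed
  have ρs : ContDiff ℝ ∞ ρ := β.contDiff_normed
  have ρp : tsupport ρ ⊆ Ioi 0 := fun x hx => lt_of_lt_of_le one_pos (hβs hx).1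
  have ρ1 : ∫ x, ρ x = 1 := β.integral_normed
  set c : 𝕜 := ∫ x in Ioi (0 : ℝ), ρ x • w x with hcdef
  refine ⟨c, ?_⟩
  have hz : ∀ᵐ x ∂(volume : Measure ℝ), x ∈ Ioi (0 : ℝ) → w x - c = 0 := by
    refine isOpen_Ioi.ae_eq_zero_of_integral_contDiff_smul_eq_zero ?_ ?_
    · exact hw.sub ((locallyIntegrable_const c).locallyIntegrableOn _)
    · intro ψ hψ ψc ψs
      have ψi : Integrable ψ := hψ.continuous.integrable_of_hasCompactSupport ψc
      have ρi : Integrable ρ := ρs.continuous.integrable_of_hasCompactSupport ρc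
      set m : ℝ := ∫ x, ψ x with hm
      -- The du Bois-Reymond device: subtracting the mass of ψ leaves a function of integral zero,
      -- whose primitive Θ has compact support in (0, ∞) and is an admissible test function.
      set θ : ℝ → ℝ := fun x => ψ x - m * ρ x with hθ
      have θs : ContDiff ℝ ∞ θ := hψ.sub (contDiff_const.mul ρs)
      have θi : Integrable θ := ψi.sub (ρi.const_mul m)
      obtain ⟨a, r, ha, har, hψI, hρI⟩ : ∃ a r : ℝ, 0 < a ∧ a < r ∧ tsupport ψ ⊆ Icc a r ∧
          tsupport ρ ⊆ Icc a r := by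
        obtain ⟨r, hr⟩ := ψc.isCompact.isBounded.subset_closedBall 0
        obtain ⟨a, ha, hψa⟩ : ∃ a > 0, ∀ x ∈ tsupport ψ, a ≤ x := by
          rcases (tsupport ψ).eq_empty_or_nonempty with he | hne
          · exact ⟨1, one_pos, by simp [he]⟩
          · obtain ⟨a, ha, hm⟩ := ψc.isCompact.exists_isMinOn hne continuousOn_id
            exact ⟨a, ψs ha, fun x hx => hm hx⟩
        refine ⟨min a 1, max r 4, by positivity, ?_, fun x hx => ⟨?_, ?_⟩, fun x hx => ⟨?_, ?_⟩⟩
        · have := min_le_right a 1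
          have := le_max_right r 4
          linarith
        · exact (min_le_left _ _).trans (hψa x hx)
        · have := hr hx
          rw [Metric.mem_closedBall, dist_zero_right, Real.norm_eq_abs] at this
          exact ((le_abs_self x).trans this).trans (le_max_left _ _)
        · exact (min_le_right _ _).trans (hβs hx).1
        · exact ((hβs hx).2.trans (by norm_num)).trans (le_max_right r 4)
      have θ0 : ∀ x, x ∉ Icc a r → θ x = 0 := fun x hx => by
        have e1 : ψ x = 0 := image_eq_zero_of_notMem_tsupport fun h' => hx (hψI h')
        have e2 : ρ x = 0 := image_eq_zero_of_notMem_tsupport fun h' => hx (hρI h')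
        simp [hθ, e1, e2]
      set Θ : ℝ → ℝ := fun x => ∫ t in a..x, θ t with hΘ
      have Θd : ∀ x, HasDerivAt Θ (θ x) x := fun x =>
        intervalIntegral.integral_hasDerivAt_right (θs.continuous.intervalIntegrable _ _)
          θs.continuous.stronglyMeasurable.stronglyMeasurableAtFilter θs.continuous.continuousAt
      have Θd' : deriv Θ = θ := funext fun x => (Θd x).deriv
      have Θs : ContDiff ℝ ∞ Θ := by
        rw [contDiff_infty_iff_deriv]
        exact ⟨fun x => (Θd x).differentiableAt, Θd' ▸ θs⟩
      have Θ0 : ∀ x, x ∉ Icc a r → Θ x = 0 := by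
        intro x hx
        rcases lt_or_ge x a with hxa | hxa
        · simp only [hΘ]
          rw [intervalIntegral.integral_congr_ae (g := fun _ => (0 : ℝ))]
          · simp
          · have hne : ∀ᵐ t : ℝ, t ≠ a := by simp [ae_iff, measure_singleton]
            filter_upwards [hne] with t hta ht
            rw [uIoc_of_ge hxa.le] at ht
            exact θ0 t fun h' => hta (le_antisymm ht.2 h'.1)
        · have hxr : r < x := by
            by_contra hcon
            exact hx ⟨hxa, not_lt.mp hcon⟩
          have e1 : Θ x = ∫ t, θ t := by
            simp only [hΘ]
            rw [intervalIntegral.integral_of_le hxa]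
            refine setIntegral_eq_integral_of_ae_compl_eq_zero ?_
            have hne : ∀ᵐ t : ℝ, t ≠ a := by simp [ae_iff, measure_singleton]
            filter_upwards [hne] with t hta ht
            exact θ0 t fun h' => ht ⟨lt_of_le_of_ne h'.1 (Ne.symm hta), h'.2.trans hxr.le⟩
          rw [e1]
          simp only [hθ]
          rw [integral_sub ψi (ρi.const_mul m), integral_const_mul, ρ1, ← hm]
          ring
      have Θt : tsupport Θ ⊆ Icc a r := closure_minimal
        (fun x hx => by_contra fun h' => hx (Θ0 x h')) isClosed_Icc
      have Θc : HasCompactSupport Θ := HasCompactSupport.intro isCompact_Icc Θ0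
      have hΘ0 := h Θ Θs Θc (Θt.trans fun x hx => lt_of_lt_of_le ha hx.1)
      rw [Θd'] at hΘ0
      have j1 := hint ψ hψ.continuous ψc ψs
      have j2 := hint ρ ρs.continuous ρc ρp
      have e2 : ∫ x in Ioi (0 : ℝ), θ x • w x
          = (∫ x in Ioi (0 : ℝ), ψ x • w x) - (m : 𝕜) * c := by
        have : ∀ x, θ x • w x = ψ x • w x - m • (ρ x • w x) := fun x => by
          simp only [hθ, sub_smul, mul_smul]
        simp_rw [this]
        have j3 : Integrable (fun x => m • ρ x • w x) halfLine := j2.smul m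
        rw [integral_sub j1 j3, integral_smul, RCLike.real_smul_eq_coe_mul]
      have e3 : ∫ x, ψ x • (w x - c) = ∫ x in Ioi (0 : ℝ), (ψ x • w x - ψ x • c) := by
        simp_rw [← smul_sub]
        refine (setIntegral_eq_integral_of_forall_compl_eq_zero fun x hx => ?_).symm
        rw [image_eq_zero_of_notMem_tsupport fun h' => hx (ψs h'), zero_smul]
      have e4 : ∫ x in Ioi (0 : ℝ), ψ x • c = (m : 𝕜) * c := by
        rw [integral_smul_const, RCLike.real_smul_eq_coe_mul, hm]
        congr 2
        refine setIntegral_eq_integral_of_forall_compl_eq_zero fun x hx => ?_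
        exact image_eq_zero_of_notMem_tsupport fun h' => hx (ψs h')
      rw [e3, integral_sub j1 (ψi.integrableOn.smul_const c), e4, ← e2, hΘ0]
  refine (ae_restrict_iff' measurableSet_Ioi).mpr ?_
  filter_upwards [hz] with x hx hx0
  exact sub_eq_zero.mp (hx hx0)

/-- An `L²` function with weak derivative in `L²` is a primitive of the latter. -/
theorem HasWeakDeriv.exists_primitive {u g : L2Half 𝕜} (h : HasWeakDeriv u g) :
    ∃ c : 𝕜, u =ᵐ[halfLine] fun x => c + ∫ t in (0 : ℝ)..x, g t := by
  have hu : LocallyIntegrableOn u (Ioi 0) := locallyIntegrableOn_of_locallyIntegrable_restrict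
    ((Lp.memLp u).locallyIntegrable (by norm_num))
  have hp : ContinuousOn (fun x => ∫ t in (0 : ℝ)..x, g t) (Ioi 0) :=
    (continuousOn_primitive_L2 g).mono Ioi_subset_Ici_self
  obtain ⟨c, hc⟩ := ae_eq_const_of_integral_deriv_smul_eq_zero
    (w := fun x => u x - ∫ t in (0 : ℝ)..x, g t)
    (hu.sub (hp.locallyIntegrableOn measurableSet_Ioi)) (by
      intro φ hφ φc φs
      have hd : Continuous (deriv φ) := hφ.continuous_deriv (by simp)
      simp_rw [smul_sub]
      rw [integral_sub (integrable_smul_L2 hd φc.deriv u), h φ hφ φc φs,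
        integral_deriv_smul_primitive hφ φc φs g, sub_self]
      have hc : Continuous fun x => deriv φ x • ∫ t in (0 : ℝ)..x, g t := by
        rw [continuous_iff_continuousAt]
        intro x
        by_cases hx : 0 < x
        · exact hd.continuousAt.smul (hp.continuousAt (Ioi_mem_nhds hx))
        · have : deriv φ =ᶠ[𝓝 x] 0 := notMem_tsupport_iff_eventuallyEq.mp fun h' =>
            hx (φs (tsupport_deriv_subset h'))
          refine (continuousAt_const (y := (0 : 𝕜))).congr ?_
          filter_upwards [this] with y hy
          simp [hy]
      exact (hc.integrable_of_hasCompactSupport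
        (φc.deriv.smul_right (f' := fun x => ∫ t in (0 : ℝ)..x, g t))).integrableOn)
  refine ⟨c, ?_⟩
  filter_upwards [hc] with x hx
  rw [← hx]
  ring

theorem eqOn_of_ae_eq {f g : ℝ → 𝕜} (hf : ContinuousOn f (Ici 0)) (hg : ContinuousOn g (Ici 0))
    (h : f =ᵐ[halfLine] g) : EqOn f g (Ici 0) := by
  have h1 : EqOn f g (Ioi 0) := Measure.eqOn_open_of_ae_eq h isOpen_Ioi
    (hf.mono Ioi_subset_Ici_self) (hg.mono Ioi_subset_Ici_self)
  intro x hx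
  refine (h1.of_subset_closure hf hg Ioi_subset_Ici_self ?_) hx
  rw [closure_Ioi]

theorem HasTrace.unique {u : L2Half 𝕜} {c d : 𝕜} (hc : HasTrace u c) (hd : HasTrace u d) :
    c = d := by
  obtain ⟨f, hf, hu, rfl⟩ := hc
  obtain ⟨g, hg, hu', rfl⟩ := hd
  exact eqOn_of_ae_eq hf hg (hu.symm.trans hu') self_mem_Ici

theorem HasWeakDeriv.exists_hasTrace {u g : L2Half 𝕜} (h : HasWeakDeriv u g) :
    ∃ c, HasTrace u c := by
  obtain ⟨c, hc⟩ := h.exists_primitive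
  exact ⟨c, _, continuousOn_const.add (continuousOn_primitive_L2 g), hc, by simp⟩

theorem HasWeakDeriv.ae_eq_primitive {u g : L2Half 𝕜} (h : HasWeakDeriv u g) {c : 𝕜}
    (hc : HasTrace u c) : u =ᵐ[halfLine] fun x => c + ∫ t in (0 : ℝ)..x, g t := by
  obtain ⟨d, hd⟩ := h.exists_primitive
  have : HasTrace u d := ⟨_, continuousOn_const.add (continuousOn_primitive_L2 g), hd, by simp⟩
  rwa [hc.unique this]

/-- Integration by parts on the half-line for primitives of square integrable functions. -/
theorem integral_Ioi_primitive_mul {f₁ f₂ g₁ g₂ : ℝ → 𝕜}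
    (hf₁ : MemLp f₁ 2 halfLine) (hf₂ : MemLp f₂ 2 halfLine)
    (hg₁ : MemLp g₁ 2 halfLine) (hg₂ : MemLp g₂ 2 halfLine)
    (h₁ : ∀ x ∈ Ici (0 : ℝ), f₁ x = f₁ 0 + ∫ t in (0 : ℝ)..x, g₁ t)
    (h₂ : ∀ x ∈ Ici (0 : ℝ), f₂ x = f₂ 0 + ∫ t in (0 : ℝ)..x, g₂ t) :
    ∫ x in Ioi (0 : ℝ), (g₁ x * f₂ x + f₁ x * g₂ x) = -(f₁ 0 * f₂ 0) := by
  have i₁ : IntegrableOn (fun x => g₁ x * f₂ x + f₁ x * g₂ x) (Ioi 0) :=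
    (MemLp.integrable_mul hg₁ hf₂).add (MemLp.integrable_mul hf₁ hg₂)
  have i₂ : IntegrableOn (fun x => f₁ x * f₂ x) (Ioi 0) := MemLp.integrable_mul hf₁ hf₂
  have key : ∀ R : ℝ, 0 ≤ R → ∫ x in (0 : ℝ)..R, (g₁ x * f₂ x + f₁ x * g₂ x)
      = f₁ R * f₂ R - f₁ 0 * f₂ 0 := fun R hR =>
    integral_primitive_mul hR (intervalIntegrable_of_memLp hg₁ le_rfl hR)
      (intervalIntegrable_of_memLp hg₂ le_rfl hR) (fun x hx => h₁ x hx.1) (fun x hx => h₂ x hx.1)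
  have lim := intervalIntegral_tendsto_integral_Ioi 0 i₁ tendsto_id
  set I := ∫ x in Ioi (0 : ℝ), (g₁ x * f₂ x + f₁ x * g₂ x)
  have lim2 : Tendsto (fun R => f₁ R * f₂ R) atTop (𝓝 (I + f₁ 0 * f₂ 0)) := by
    refine (lim.add_const (f₁ 0 * f₂ 0)).congr' ?_
    filter_upwards [eventually_ge_atTop 0] with R hR
    rw [id, key R hR]
    ring
  -- The product `f₁ f₂` converges at infinity and is integrable on a set of infinite measure, so
  -- its limit is 0.
  have hz : I + f₁ 0 * f₂ 0 = 0 := by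
    by_contra hne
    obtain ⟨s, hs, hsi⟩ : IntegrableAtFilter (fun x => f₁ x * f₂ x) atTop :=
      ⟨Ioi 0, Ioi_mem_atTop _, i₂⟩
    exact hne (IntegrableAtFilter.eq_zero_of_tendsto ⟨s, hs, hsi⟩ (fun s hs => by
      obtain ⟨b, hb⟩ := mem_atTop_sets.mp hs
      rw [← top_le_iff]
      calc (⊤ : ℝ≥0∞) = volume (Ici b) := by simp
        _ ≤ volume s := measure_mono hb) lim2)
  exact eq_neg_of_add_eq_zero_left hz

theorem memLp_primitive {u g : L2Half 𝕜} {c : 𝕜}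
    (h : u =ᵐ[halfLine] fun x => c + ∫ t in (0 : ℝ)..x, g t) :
    MemLp (fun x => c + ∫ t in (0 : ℝ)..x, g t) 2 halfLine :=
  (memLp_congr_ae h).mp (Lp.memLp u)

/-- Integration by parts for `H¹` functions on the half-line. -/
theorem HasWeakDeriv.inner_add_inner {u g v h : L2Half 𝕜} (hu : HasWeakDeriv u g)
    (hv : HasWeakDeriv v h) {a b : 𝕜} (ha : HasTrace u a) (hb : HasTrace v b) :
    inner 𝕜 g v + inner 𝕜 u h = -((starRingEnd 𝕜) a * b) := by
  have eu := hu.ae_eq_primitive ha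
  have ev := hv.ae_eq_primitive hb
  have hconj : ∀ {f : ℝ → 𝕜}, MemLp f 2 halfLine →
      MemLp (fun x => (starRingEnd 𝕜) (f x)) 2 halfLine := fun hf => hf.star
  have key := integral_Ioi_primitive_mul (hconj (memLp_primitive eu)) (memLp_primitive ev)
    (hconj (Lp.memLp g)) (Lp.memLp h)
    (fun x _ => by
      have : ∫ t in (0 : ℝ)..x, (starRingEnd 𝕜) (g t)
          = (starRingEnd 𝕜) (∫ t in (0 : ℝ)..x, g t) := by
        simp only [intervalIntegral, integral_conj, map_sub]
      rw [this]
      simp)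
    (fun x _ => by simp)
  simp only [intervalIntegral.integral_same, add_zero] at key
  rw [← key, L2.inner_def, L2.inner_def, ← integral_add (L2.integrable_inner g v)
    (L2.integrable_inner u h)]
  refine integral_congr_ae ?_
  filter_upwards [eu, ev] with x hx hy
  rw [RCLike.inner_apply, RCLike.inner_apply, hx, hy]
  ring

/-- A continuously differentiable function that is square integrable together with its derivative
has the latter as its weak derivative. -/
theorem hasWeakDeriv_toLp {f g : ℝ → 𝕜} (hd : ∀ x, HasDerivAt f (g x) x) (hg : Continuous g)
    (hf2 : MemLp f 2 halfLine) (hg2 : MemLp g 2 halfLine) :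
    HasWeakDeriv (hf2.toLp f) (hg2.toLp g) := by
  intro φ hφ φc φs
  have h1 := integral_deriv_smul_primitive hφ φc φs (hg2.toLp g)
  rw [← h1]
  have hdφ : Continuous (deriv φ) := hφ.continuous_deriv (by simp)
  have e1 : ∀ x ∈ Ioi (0 : ℝ), ∫ t in (0 : ℝ)..x, (hg2.toLp g) t = f x - f 0 := by
    intro x hx
    rw [← intervalIntegral.integral_eq_sub_of_hasDerivAt (fun y _ => hd y)
      (hg.intervalIntegrable _ _)]
    refine intervalIntegral.integral_congr_ae ?_
    filter_upwards [(ae_restrict_iff' measurableSet_Ioi).mp hg2.coeFn_toLp] with t ht hx'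
    rw [uIoc_of_le (le_of_lt hx)] at hx'
    exact ht hx'.1
  have e2 : ∫ x in Ioi (0 : ℝ), deriv φ x • (∫ t in (0 : ℝ)..x, (hg2.toLp g) t)
      = ∫ x in Ioi (0 : ℝ), (deriv φ x • (hf2.toLp f) x - deriv φ x • f 0) := by
    refine integral_congr_ae ?_
    filter_upwards [hf2.coeFn_toLp, ae_restrict_mem measurableSet_Ioi] with x hx hx0
    rw [e1 x hx0, hx, smul_sub]
  have hi : Integrable (deriv φ) := hdφ.integrable_of_hasCompactSupport φc.deriv
  have e3 : ∫ x in Ioi (0 : ℝ), deriv φ x • f 0 = 0 := by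
    rw [integral_smul_const, setIntegral_eq_integral_of_forall_compl_eq_zero (fun x hx =>
      image_eq_zero_of_notMem_tsupport fun h' => hx (φs (tsupport_deriv_subset h'))),
      integral_eq_zero_of_hasDerivAt_of_integrable
        (fun x => (hφ.differentiable (by simp) x).hasDerivAt) hi
        (hφ.continuous.integrable_of_hasCompactSupport φc), zero_smul]
  rw [e2, integral_sub (integrable_smul_L2 hdφ φc.deriv _) (hi.integrableOn.smul_const _), e3,
    sub_zero]

theorem hasTrace_toLp {f : ℝ → 𝕜} (hf : Continuous f) (hf2 : MemLp f 2 halfLine) :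
    HasTrace (hf2.toLp f) (f 0) :=
  ⟨f, hf.continuousOn, hf2.coeFn_toLp, rfl⟩

end WeakDerivatives

/-! ### Relatively compact perturbations of semibounded operators -/

section Abstract

variable {𝕜 : Type*} [RCLike 𝕜] {E : Type*} [NormedAddCommGroup E] [InnerProductSpace 𝕜 E]

/-- For an eigenvector in `S` the extra domain condition `A x ∈ S` of `restrictTo` is automatic, so
restricted eigenspaces are read off from those of `A`. -/
theorem mem_eigenspace_restrictTo {A : E →ₗ.[𝕜] E} {S : Submodule 𝕜 E} {z : 𝕜} {x : S} :
    x ∈ eigenspace (restrictTo A S) z ↔ (x : E) ∈ eigenspace A z := by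
  constructor
  · rintro ⟨⟨h, h'⟩, e⟩
    exact ⟨h, congrArg Subtype.val e⟩
  · rintro ⟨h, e⟩
    exact ⟨⟨h, e ▸ S.smul_mem z x.2⟩, Subtype.ext e⟩

/-- Symmetry of an unbounded operator. -/
def IsSymmetricOp (A : E →ₗ.[𝕜] E) : Prop :=
  ∀ x y : A.domain, inner 𝕜 (A x) (y : E) = inner 𝕜 (x : E) (A y)

/-- `B` is a positive contraction inverting `A + W - (ω - 1)`, and `W` is compact relative to it. -/
structure IsRegularizer (A : E →ₗ.[𝕜] E) (ω : ℝ) (W B : E →L[𝕜] E) : Prop where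
  right_inv : ∀ y, ∃ h : B y ∈ A.domain, A ⟨B y, h⟩ + W (B y) - ((ω : 𝕜) - 1) • B y = y
  left_inv : ∀ x : A.domain, B (A x + W x - ((ω : 𝕜) - 1) • (x : E)) = x
  inner_nonneg : ∀ y, ∃ b : ℝ, 0 ≤ b ∧ b ≤ ‖y‖ ^ 2 ∧ inner 𝕜 (B y) y = (b : 𝕜)
  compact : IsCompactOperator (W ∘L B)

variable {A : E →ₗ.[𝕜] E} {ω : ℝ} {W B C : E →L[𝕜] E} {z : 𝕜}

/-- Two preimages of the same vector differ by an element of the kernel. The perturbation `C` is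
carried along because the case of an eigenprojection is needed besides `C = 0`. -/
theorem left_inv_of_right_inv {R : E →L[𝕜] E}
    (hR : ∀ y, ∃ h : R y ∈ A.domain, A ⟨R y, h⟩ + C (R y) - z • R y = y)
    (hinj : ∀ x : A.domain, A x + C x - z • (x : E) = 0 → (x : E) = 0) (x : A.domain) :
    R (A x + C x - z • (x : E)) = x := by
  obtain ⟨h, e⟩ := hR (A x + C x - z • (x : E))
  have := hinj (⟨_, h⟩ - x) (by
    rw [LinearPMap.map_sub, Submodule.coe_sub, map_sub C]
    linear_combination (norm := module) e)
  exact sub_eq_zero.mp this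

theorem isCompactOperator_of_finiteDimensional {F G : Type*} [NormedAddCommGroup F]
    [NormedSpace 𝕜 F] [NormedAddCommGroup G] [NormedSpace 𝕜 G] [FiniteDimensional 𝕜 G]
    (f : F →L[𝕜] G) : IsCompactOperator f := by
  have : ProperSpace G := FiniteDimensional.proper 𝕜 G
  refine ⟨Metric.closedBall 0 1, isCompact_closedBall _ _, ?_⟩
  refine f.continuous.continuousAt.preimage_mem_nhds ?_
  rw [map_zero]
  exact Metric.closedBall_mem_nhds 0 one_pos

theorem IsSymmetricOp.conj_eq (hA : IsSymmetricOp A) {x : A.domain} (hx : (x : E) ≠ 0)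
    (e : A x = z • (x : E)) : (starRingEnd 𝕜) z = z := by
  have h := hA x x
  rw [e, inner_smul_left, inner_smul_right] at h
  exact mul_right_cancel₀ (inner_self_ne_zero.mpr hx) h

/-- Weyl's criterion: approximate eigenvalues belong to the spectrum. -/
theorem mem_spectrumOf_of_approx {A : E →ₗ.[𝕜] E} {z : 𝕜}
    (h : ∀ ε > 0, ∃ x : A.domain, (x : E) ≠ 0 ∧ ‖A x - z • (x : E)‖ ≤ ε * ‖(x : E)‖) :
    z ∈ spectrumOf A := by
  rintro ⟨R, -, hR⟩
  -- With this ε a bounded inverse `R` would give ‖x‖ ≤ ‖x‖ / 2; the added 1 allows for `R = 0`.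
  obtain ⟨x, hx0, hx⟩ := h (1 / (2 * (‖R‖ + 1))) (by positivity)
  have h1 : ‖(x : E)‖ ≤ ‖R‖ * ‖A x - z • (x : E)‖ := by
    calc ‖(x : E)‖ = ‖R (A x - z • (x : E))‖ := by rw [hR]
      _ ≤ _ := R.le_opNorm _
  have hpos : 0 < ‖(x : E)‖ := norm_pos_iff.mpr hx0
  have h2 : ‖R‖ * ‖A x - z • (x : E)‖ ≤ ‖R‖ * (1 / (2 * (‖R‖ + 1)) * ‖(x : E)‖) :=
    mul_le_mul_of_nonneg_left hx (norm_nonneg _)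
  have h3 : ‖R‖ * (1 / (2 * (‖R‖ + 1)) * ‖(x : E)‖) ≤ 1 / 2 * ‖(x : E)‖ := by
    rw [← mul_assoc]
    refine mul_le_mul_of_nonneg_right ?_ hpos.le
    rw [mul_one_div, div_le_div_iff₀ (by positivity) (by norm_num)]
    nlinarith [norm_nonneg R]
  linarith

variable [CompleteSpace E]

/-- Lax–Milgram: the inner product of (1 - ζB) y with y is ‖y‖² (1 - ζ̄ s) for some s in [0, 1]. The
second factor has a positive minimum modulus on [0, 1], since 1 = ζ̄ s would make ζ real and at
least 1, that is, z in [ω, ∞). -/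
theorem IsRegularizer.isUnit_one_sub_smul (hB : IsRegularizer A ω W B)
    (hz : ∀ t : ℝ, ω ≤ t → z ≠ t) : IsUnit (1 - (z - ω + 1) • B : E →L[𝕜] E) := by
  set ζ : 𝕜 := z - ω + 1 with hζ
  have hne : ∀ s ∈ Icc (0 : ℝ) 1, 1 - (starRingEnd 𝕜) ζ * (s : 𝕜) ≠ 0 := by
    intro s hs h0
    have h1 : (starRingEnd 𝕜) ζ * (s : 𝕜) = 1 := (sub_eq_zero.mp h0).symm
    have hs0 : s ≠ 0 := by
      rintro rfl
      simp at h1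
    have hs0' : (s : 𝕜) ≠ 0 := by exact_mod_cast hs0
    have h2 : (starRingEnd 𝕜) ζ = ((s⁻¹ : ℝ) : 𝕜) := by
      rw [RCLike.ofReal_inv]
      exact eq_inv_of_mul_eq_one_left h1
    have h3 : ζ = ((s⁻¹ : ℝ) : 𝕜) := by
      rw [← RCLike.conj_conj ζ, h2, RCLike.conj_ofReal]
    have hsp : 0 < s := lt_of_le_of_ne hs.1 (Ne.symm hs0)
    have h4 : 1 ≤ s⁻¹ := (one_le_inv₀ hsp).mpr hs.2
    refine hz (ω - 1 + s⁻¹) (by linarith) ?_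
    push_cast at h3 ⊢
    linear_combination h3
  obtain ⟨s₀, hs₀, hmin⟩ := isCompact_Icc.exists_isMinOn (nonempty_Icc.mpr zero_le_one)
    (f := fun s : ℝ => ‖1 - (starRingEnd 𝕜) ζ * (s : 𝕜)‖)
    (Continuous.continuousOn (by fun_prop))
  set c := ‖1 - (starRingEnd 𝕜) ζ * (s₀ : 𝕜)‖ with hc
  have hcpos : 0 < c := norm_pos_iff.mpr (hne s₀ hs₀)
  refine ContinuousLinearMap.isUnit_of_forall_le_norm_inner_map _ (c := ⟨c, hcpos.le⟩) hcpos ?_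
  intro y
  obtain ⟨b, hb0, hb1, hb⟩ := hB.inner_nonneg y
  rcases eq_or_ne y 0 with rfl | hy
  · simp
  have hy' : 0 < ‖y‖ ^ 2 := by positivity
  have hyk : ((‖y‖ : ℝ) : 𝕜) ≠ 0 := by exact_mod_cast (norm_pos_iff.mpr hy).ne'
  have e1 : inner 𝕜 ((1 - ζ • B : E →L[𝕜] E) y) y
      = ((‖y‖ ^ 2 : ℝ) : 𝕜) * (1 - (starRingEnd 𝕜) ζ * ((b / ‖y‖ ^ 2 : ℝ) : 𝕜)) := by
    simp only [sub_apply, one_apply_eq_self,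
      smul_apply, inner_sub_left, inner_smul_left, hb,
      inner_self_eq_norm_sq_to_K]
    push_cast
    field_simp
  rw [e1, norm_mul, RCLike.norm_ofReal, abs_of_pos hy']
  refine mul_le_mul_of_nonneg_left ?_ hy'.le
  exact hmin ⟨by positivity, (div_le_one hy').mpr hb1⟩

/-- The operator `(A + C - z) B`, factored as an invertible operator times a compact perturbation of
the identity. -/
theorem IsRegularizer.exists_factorization (hB : IsRegularizer A ω W B)
    (hz : ∀ t : ℝ, ω ≤ t → z ≠ t) (hC : IsCompactOperator (C ∘L B)) :
    ∃ (D : (E →L[𝕜] E)ˣ) (K : E →L[𝕜] E), IsCompactOperator K ∧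
      ∀ y, ∃ h : B y ∈ A.domain, A ⟨B y, h⟩ + C (B y) - z • B y = (D : E →L[𝕜] E) (y - K y) := by
  obtain ⟨D, hD⟩ := hB.isUnit_one_sub_smul hz
  -- By `right_inv`, (A + C - z) B = 1 - (z - ω + 1) B - (W - C) B = D - (W - C) B, from which D is
  -- pulled out on the left.
  refine ⟨D, (↑D⁻¹ : E →L[𝕜] E) ∘L (W ∘L B - C ∘L B), (hB.compact.sub hC).clm_comp _, fun y => ?_⟩
  obtain ⟨h, e⟩ := hB.right_inv y
  refine ⟨h, ?_⟩
  have e1 : (D : E →L[𝕜] E) ((↑D⁻¹ : E →L[𝕜] E) (W (B y) - C (B y))) = W (B y) - C (B y) := by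
    rw [← mul_apply_eq_comp, Units.mul_inv, one_apply_eq_self]
  rw [map_sub]
  simp only [ContinuousLinearMap.comp_apply, sub_apply]
  rw [e1, hD]
  simp only [sub_apply, one_apply_eq_self,
    smul_apply]
  have e2 : A ⟨B y, h⟩ = y - W (B y) + ((ω : 𝕜) - 1) • B y := by
    rw [sub_eq_iff_eq_add, ← eq_sub_iff_add_eq] at e
    rw [e]
    abel
  rw [e2]
  module

/-- Fredholm alternative: a fixed vector y of the compact `K` would put B y in the kernel of A + C -
z, so B y = 0 and y = 0. Hence 1 - K is invertible, and the inverse is B (1 - K)⁻¹ D⁻¹. -/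
theorem IsRegularizer.exists_inverse (hB : IsRegularizer A ω W B)
    (hz : ∀ t : ℝ, ω ≤ t → z ≠ t) (hC : IsCompactOperator (C ∘L B))
    (hinj : ∀ x : A.domain, A x + C x - z • (x : E) = 0 → (x : E) = 0) :
    ∃ R : E →L[𝕜] E, (∀ y, ∃ h : R y ∈ A.domain, A ⟨R y, h⟩ + C (R y) - z • R y = y) ∧
      ∀ x : A.domain, R (A x + C x - z • (x : E)) = x := by
  obtain ⟨D, K, hK, hf⟩ := hB.exists_factorization hz hC
  have hB0 : ∀ y, B y = 0 → y = 0 := by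
    intro y hy
    obtain ⟨h, e⟩ := hB.right_inv y
    rw [← e]
    have : (⟨B y, h⟩ : A.domain) = 0 := Subtype.ext hy
    rw [this, hy]
    simp
  have h1 : (1 : 𝕜) ∈ resolventSet 𝕜 K := by
    refine (hK.hasEigenvalue_or_mem_resolventSet one_ne_zero).resolve_left fun hev => ?_
    obtain ⟨y, hy⟩ := hev.exists_hasEigenvector
    have hy1 : K y = y := by simpa using hy.apply_eq_smul
    obtain ⟨h, e⟩ := hf y
    rw [hy1, sub_self, map_zero] at e
    exact hy.2 (hB0 y (hinj ⟨B y, h⟩ e))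
  obtain ⟨V, hV⟩ := (spectrum.mem_resolventSet_iff.mp h1)
  have hV' : ∀ y, (V : E →L[𝕜] E) y = y - K y := by
    intro y
    rw [hV]
    simp
  set R : E →L[𝕜] E := B ∘L ((↑V⁻¹ : E →L[𝕜] E) ∘L (↑D⁻¹ : E →L[𝕜] E)) with hR
  have hr : ∀ y, ∃ h : R y ∈ A.domain, A ⟨R y, h⟩ + C (R y) - z • R y = y := by
    intro y
    obtain ⟨h, e⟩ := hf ((↑V⁻¹ : E →L[𝕜] E) ((↑D⁻¹ : E →L[𝕜] E) y))
    refine ⟨h, e.trans ?_⟩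
    rw [← hV']
    have e1 : ∀ y, (V : E →L[𝕜] E) ((↑V⁻¹ : E →L[𝕜] E) y) = y := fun y => by
      rw [← mul_apply_eq_comp, Units.mul_inv, one_apply_eq_self]
    rw [e1, ← mul_apply_eq_comp, Units.mul_inv, one_apply_eq_self]
  exact ⟨R, hr, left_inv_of_right_inv hr hinj⟩

/-- An eigenvector x equals B y with y = (A + W - (ω - 1)) x, and the factorization makes y a fixed
vector of `K`. The fixed space is finite-dimensional because the identity on it is compact. -/
theorem IsRegularizer.finiteDimensional_eigenspace (hB : IsRegularizer A ω W B)
    (hz : ∀ t : ℝ, ω ≤ t → z ≠ t) : FiniteDimensional 𝕜 (eigenspace A z) := by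
  obtain ⟨D, K, hK, hf⟩ := hB.exists_factorization (C := 0) hz
    (by simpa using isCompactOperator_zero)
  set S : Submodule 𝕜 E := Module.End.eigenspace (K : E →ₗ[𝕜] E) 1 with hS
  have hmem : ∀ y ∈ S, K y = y := fun y hy => by
    simpa using Module.End.mem_eigenspace_iff.mp hy
  have hcl : IsClosed (S : Set E) := by
    have : (S : Set E) = {y | K y = y} := by
      ext y
      simp [hS]
    rw [this]
    exact isClosed_eq K.continuous continuous_id
  have : CompleteSpace S := hcl.completeSpace_coe
  have hfin : FiniteDimensional 𝕜 S := by
    apply FiniteDimensional.of_isCompactOperator_id (𝕜 := 𝕜)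
    have := (hK.comp_clm S.subtypeL).codRestrict (V := S) (fun y => by simp [hmem y.1 y.2]) hcl
    refine (congrArg IsCompactOperator (funext fun y => Subtype.ext ?_)).mp this
    exact hmem y.1 y.2
  refine Submodule.finiteDimensional_of_le (S₂ := S.map (B : E →ₗ[𝕜] E)) ?_
  rintro x ⟨hx, e⟩
  refine ⟨A ⟨x, hx⟩ + W x - ((ω : 𝕜) - 1) • x, ?_, hB.left_inv ⟨x, hx⟩⟩
  set y := A ⟨x, hx⟩ + W x - ((ω : 𝕜) - 1) • x with hy
  have hBy : B y = x := hB.left_inv ⟨x, hx⟩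
  obtain ⟨h, e'⟩ := hf y
  have hx' : (⟨B y, h⟩ : A.domain) = ⟨x, hx⟩ := Subtype.ext hBy
  rw [hx', hBy, e] at e'
  simp only [zero_apply, add_zero, sub_self] at e'
  have e2 : y - K y = 0 := by
    have := congrArg (↑D⁻¹ : E →L[𝕜] E) e'
    rwa [← mul_apply_eq_comp, Units.inv_mul, map_zero,
      one_apply_eq_self, eq_comm] at this
  rw [SetLike.mem_coe, hS, Module.End.mem_eigenspace_iff]
  simpa using (sub_eq_zero.mp e2).symm

/-- Points of the spectrum outside `[ω, ∞)` are isolated eigenvalues of finite multiplicity. -/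
theorem IsRegularizer.mem_discreteSpectrum (hB : IsRegularizer A ω W B) (hA : IsSymmetricOp A)
    (hz : ∀ t : ℝ, ω ≤ t → z ≠ t) (hs : z ∈ spectrumOf A) : z ∈ discreteSpectrum A := by
  have hfin := hB.finiteDimensional_eigenspace hz
  have hne : eigenspace A z ≠ ⊥ := by
    intro hbot
    obtain ⟨R, hR, hR'⟩ := hB.exists_inverse (C := 0) hz (by simpa using isCompactOperator_zero)
      (fun x hx => by
        have : (x : E) ∈ eigenspace A z := ⟨x.2, by simpa [sub_eq_zero] using hx⟩
        rwa [hbot, Submodule.mem_bot] at this)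
    exact hs ⟨R, fun y => by simpa using hR y, fun x => by simpa using hR' x⟩
  refine ⟨hs, ?_, hne, hfin⟩
  set S := eigenspace A z with hS
  obtain ⟨x₀, ⟨hx₀, e₀⟩, hx₀'⟩ := (Submodule.ne_bot_iff _).mp hne
  have hreal : (starRingEnd 𝕜) z = z := hA.conj_eq (x := ⟨x₀, hx₀⟩) hx₀' e₀
  set P : E →L[𝕜] E := S.starProjection with hP
  have hPS : ∀ y, P y ∈ S := fun y => S.starProjection_apply_mem y
  have hPid : ∀ y ∈ S, P y = y := fun y hy => Submodule.starProjection_eq_self_iff.mpr hy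
  -- Symmetry of `A` and reality of `z` make the eigenprojection commute with `A`.
  have hPA : ∀ x : A.domain, P (A x) = z • P x := by
    intro x
    refine Submodule.eq_starProjection_of_mem_of_inner_eq_zero (S.smul_mem _ (hPS _)) ?_
    rintro y ⟨hy, ey⟩
    rw [inner_sub_left, hA x ⟨y, hy⟩, ey, inner_smul_right, inner_smul_left, hreal, ← mul_sub,
      ← inner_sub_left, S.starProjection_inner_eq_zero _ _ ⟨hy, ey⟩, mul_zero]
  have hPA' : ∀ y, ∃ h : P y ∈ A.domain, A ⟨P y, h⟩ = z • P y := fun y => hPS y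
  have hPc : IsCompactOperator (P ∘L B) :=
    (isCompactOperator_of_finiteDimensional (S.orthogonalProjectionOnto ∘L B)).clm_comp S.subtypeL
  -- Adding P moves the eigenvalue z to z + 1, so A + P - z is injective; P is relatively compact,
  -- being of finite rank, and the Fredholm alternative yields a bounded inverse.
  obtain ⟨R, hR, hR'⟩ := hB.exists_inverse hz hPc (fun x hx => by
    have h1 : P x = 0 := by
      have := congrArg P hx
      rw [map_sub, map_add, map_smul, hPA, hPid _ (hPS _), map_zero] at this
      simpa using this
    rw [h1, add_zero, sub_eq_zero] at hx
    rw [← hPid x ⟨x.2, hx⟩, h1])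
  -- The bound 1 keeps w away from the displaced eigenvalue z + 1; the other bound makes 1 - (w - z)
  -- R invertible by a Neumann series, so that A + P - w is still invertible.
  refine ⟨min 1 (1 / (‖R‖ + 1)), by positivity, fun w hw hwz => ?_⟩
  by_contra hwne
  have hw1 : ‖w - z‖ < 1 := hwz.trans_le (min_le_left _ _)
  have hw2 : ‖(w - z) • R‖ < 1 := by
    rw [norm_smul]
    have h1 : ‖w - z‖ < 1 / (‖R‖ + 1) := hwz.trans_le (min_le_right _ _)
    rw [lt_div_iff₀ (by positivity)] at h1
    nlinarith [norm_nonneg (w - z), norm_nonneg R]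
  have hzw : z - w ≠ 0 := sub_ne_zero.mpr (Ne.symm hwne)
  have hzw1 : z - w + 1 ≠ 0 := by
    intro h
    have : w - z = 1 := by linear_combination -h
    rw [this] at hw1
    simp at hw1
  set V : (E →L[𝕜] E)ˣ := Units.oneSub ((w - z) • R) hw2 with hV
  set Q : E →L[𝕜] E := R ∘L (↑V⁻¹ : E →L[𝕜] E) with hQ
  have hQ1 : ∀ y, ∃ h : Q y ∈ A.domain, A ⟨Q y, h⟩ + P (Q y) - w • Q y = y := by
    intro y
    obtain ⟨h, e⟩ := hR ((↑V⁻¹ : E →L[𝕜] E) y)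
    refine ⟨h, ?_⟩
    have e2 : (V : E →L[𝕜] E) ((↑V⁻¹ : E →L[𝕜] E) y) = y := by
      rw [← mul_apply_eq_comp, Units.mul_inv, one_apply_eq_self]
    rw [hV, Units.val_oneSub, ← hV, sub_apply,
      one_apply_eq_self, smul_apply] at e2
    change A ⟨R _, h⟩ + P (R _) - w • R _ = y
    linear_combination (norm := module) e + e2
  have hinj : ∀ x : A.domain, A x - w • (x : E) = 0 → (x : E) = 0 := by
    intro x hx
    have h1 : P x = 0 := by
      have := congrArg P hx
      rw [map_sub, map_smul, hPA, map_zero, ← sub_smul] at this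
      exact (smul_eq_zero.mp this).resolve_left hzw
    have h2 := hR' x
    rw [sub_eq_zero] at hx
    rw [h1, add_zero, hx, ← sub_smul, map_smul] at h2
    have h3 : (V : E →L[𝕜] E) x = 0 := by
      rw [hV, Units.val_oneSub, sub_apply,
        one_apply_eq_self, smul_apply, h2, sub_self]
    have := congrArg (↑V⁻¹ : E →L[𝕜] E) h3
    rwa [← mul_apply_eq_comp, Units.inv_mul, map_zero,
      one_apply_eq_self] at this
  -- The resolvent of `A` at w in two pieces: on the complement of the eigenspace A agrees with A +
  -- P, and on the eigenspace A - w is the scalar z - w.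
  set T : E →L[𝕜] E := Q ∘L (1 - P) + (z - w)⁻¹ • P
  have hright : ∀ y, ∃ h : T y ∈ A.domain, A ⟨T y, h⟩ - w • T y = y := by
      intro y
      obtain ⟨h1, e1⟩ := hQ1 ((1 - P) y)
      obtain ⟨h2, e2⟩ := hPA' y
      have hPQ : P (Q ((1 - P) y)) = 0 := by
        have := congrArg P e1
        have h3 : P ((1 - P) y) = 0 := by
          rw [sub_apply, map_sub, one_apply_eq_self, hPid _ (hPS _), sub_self]
        rw [map_sub, map_add, map_smul, hPA, hPid _ (hPS _), h3] at this
        have h0 : (z - w + 1) • P (Q ((1 - P) y)) = 0 := by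
          rw [← this]
          module
        exact (smul_eq_zero.mp h0).resolve_left hzw1
      rw [hPQ, add_zero] at e1
      refine ⟨A.domain.add_mem h1 (A.domain.smul_mem _ h2), ?_⟩
      have e3 : A ⟨T y, A.domain.add_mem h1 (A.domain.smul_mem _ h2)⟩
          = A ⟨Q ((1 - P) y), h1⟩ + (z - w)⁻¹ • A ⟨P y, h2⟩ := by
        rw [← LinearPMap.map_smul, ← LinearPMap.map_add]
        rfl
      rw [e3, e2]
      change _ - w • (Q ((1 - P) y) + (z - w)⁻¹ • P y) = y
      rw [sub_eq_iff_eq_add] at e1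
      rw [e1, sub_apply, one_apply_eq_self]
      have e4 : (z - w)⁻¹ • z • P y - w • (z - w)⁻¹ • P y = P y := by
        rw [smul_comm w, ← smul_sub, ← sub_smul, smul_smul, inv_mul_cancel₀ hzw, one_smul]
      rw [smul_add]
      calc _ = y - P y + ((z - w)⁻¹ • z • P y - w • (z - w)⁻¹ • P y) := by abel
        _ = y := by rw [e4]; abel
  refine hw ⟨_, hright, fun x => ?_⟩
  simpa using left_inv_of_right_inv (C := 0) (R := T)
    (fun y => by simpa using hright y) (fun x hx => hinj x (by simpa using hx)) x

/-- The half-line [ω, ∞) consists of spectrum and has no isolated points, so none of it is discrete;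
all other spectral points are. -/
theorem IsRegularizer.essentialSpectrum_eq (hB : IsRegularizer A ω W B) (hA : IsSymmetricOp A)
    (h : ∀ t : ℝ, ω ≤ t → (t : 𝕜) ∈ spectrumOf A) :
    essentialSpectrum A = (fun t : ℝ => (t : 𝕜)) '' Ici ω := by
  ext z
  constructor
  · rintro ⟨hs, hd⟩
    by_contra hz
    refine hd (hB.mem_discreteSpectrum hA (fun t ht e => hz ⟨t, ht, e.symm⟩) hs)
  · rintro ⟨t, ht, rfl⟩
    refine ⟨h t ht, fun hd => ?_⟩
    obtain ⟨ε, hε, hiso⟩ := hd.2.1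
    have h1 := hiso ((t + ε / 2 : ℝ) : 𝕜) (h _ (by linarith [show ω ≤ t from ht])) (by
      rw [← RCLike.ofReal_sub, RCLike.norm_ofReal, abs_of_pos] <;> linarith)
    have h2 : t + ε / 2 = t := RCLike.ofReal_injective h1
    linarith

end Abstract

/-! ### Counting negative eigenvalues -/

section MorseIndex

variable {𝕜 : Type*} [RCLike 𝕜] {E : Type*} [NormedAddCommGroup E] [NormedSpace 𝕜 E]

theorem HasUniqueSimpleNegativeEigenvalue.morseIndex_eq_one {A : E →ₗ.[𝕜] E}
    (h : HasUniqueSimpleNegativeEigenvalue A) : morseIndex A = 1 := by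
  obtain ⟨l, hl, h1, hu⟩ := h
  have hrank : Module.rank 𝕜 (eigenspace A (l : 𝕜)) = 1 := by
    have : Module.finrank 𝕜 (eigenspace A (l : 𝕜)) ≠ 0 := by omega
    exact Module.rank_eq_one_iff_finrank_eq_one.mpr h1
  have hz : ∀ m : Iio (0 : ℝ), m ≠ ⟨l, hl⟩ →
      Module.rank 𝕜 (eigenspace A ((m : ℝ) : 𝕜)) = 0 := by
    intro m hm
    have : eigenspace A ((m : ℝ) : 𝕜) = ⊥ := by
      by_contra hne
      exact hm (Subtype.ext (hu m m.2 hne))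
    rw [this, rank_bot]
  set f : Iio (0 : ℝ) → Cardinal := fun m => Module.rank 𝕜 (eigenspace A ((m : ℝ) : 𝕜)) with hf
  have hl1 : Cardinal.mk (f ⟨l, hl⟩).out = 1 := by rw [Cardinal.mk_out, ← hrank]
  rw [Cardinal.eq_one_iff_unique] at hl1
  obtain ⟨hsub, ⟨a⟩⟩ := hl1
  have hemp : ∀ m : Iio (0 : ℝ), m ≠ ⟨l, hl⟩ → IsEmpty (f m).out := fun m hm => by
    rw [← Cardinal.mk_eq_zero_iff, Cardinal.mk_out]
    exact hz m hm
  -- The cardinal sum is the cardinality of a sigma type in which one fibre is a singleton and all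
  -- the others are empty.
  change Cardinal.mk (Σ m, (f m).out) = 1
  rw [Cardinal.eq_one_iff_unique]
  refine ⟨⟨?_⟩, ⟨⟨⟨l, hl⟩, a⟩⟩⟩
  rintro ⟨m, x⟩ ⟨n, y⟩
  obtain rfl : m = ⟨l, hl⟩ := by_contra fun hm => (hemp m hm).false x
  obtain rfl : n = ⟨l, hl⟩ := by_contra fun hn => (hemp n hn).false y
  rw [Subsingleton.elim x y]

end MorseIndex

/-! ### The equation `-u'' + u = f` -/

section Resolvent

open scoped ContDiff

variable {𝕜 : Type*} [RCLike 𝕜]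

theorem hasDerivAt_ofReal {f : ℝ → ℝ} {f' x : ℝ} (h : HasDerivAt f f' x) :
    HasDerivAt (fun y => (f y : 𝕜)) (f' : 𝕜) x :=
  (RCLike.ofRealCLM : ℝ →L[ℝ] 𝕜).hasFDerivAt.comp_hasDerivAt x h

theorem memLp_ofReal_of_hasCompactSupport {ψ : ℝ → ℝ} (hψ : Continuous ψ)
    (hc : HasCompactSupport ψ) : MemLp (fun x => (ψ x : 𝕜)) 2 halfLine :=
  ((hψ.memLp_of_hasCompactSupport hc).restrict _).ofReal

theorem integral_smul_eq_inner {ψ : ℝ → ℝ} (hψ : MemLp (fun x => (ψ x : 𝕜)) 2 halfLine)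
    (u : L2Half 𝕜) :
    ∫ x in Ioi (0 : ℝ), ψ x • u x = inner 𝕜 (hψ.toLp (fun x => (ψ x : 𝕜))) u := by
  rw [L2.inner_def]
  refine integral_congr_ae ?_
  filter_upwards [hψ.coeFn_toLp] with x hx
  rw [hx, RCLike.inner_apply, RCLike.conj_ofReal, RCLike.real_smul_eq_coe_mul, mul_comm]

/-- The graph of the weak derivative. -/
def weakDerivGraph (𝕜 : Type*) [RCLike 𝕜] : Submodule 𝕜 (WithLp 2 (L2Half 𝕜 × L2Half 𝕜)) where
  carrier := {q | HasWeakDeriv q.fst q.snd}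
  zero_mem' := HasWeakDeriv.zero
  add_mem' := fun ha hb => HasWeakDeriv.add ha hb
  smul_mem' := fun c _ ha => HasWeakDeriv.smul c ha

/-- Each test function imposes an equality of two continuous inner products. Closedness provides the
orthogonal projection used to solve the edge equation. -/
theorem isClosed_weakDerivGraph :
    IsClosed (weakDerivGraph 𝕜 : Set (WithLp 2 (L2Half 𝕜 × L2Half 𝕜))) := by
  have : (weakDerivGraph 𝕜 : Set (WithLp 2 (L2Half 𝕜 × L2Half 𝕜))) =
      ⋂ (φ : ℝ → ℝ) (_ : ContDiff ℝ ∞ φ) (_ : HasCompactSupport φ) (_ : tsupport φ ⊆ Ioi 0),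
        {q | ∫ x in Ioi (0 : ℝ), deriv φ x • q.fst x = -∫ x in Ioi (0 : ℝ), φ x • q.snd x} := by
    ext q
    simp only [mem_iInter]
    rfl
  rw [this]
  refine isClosed_iInter fun φ => isClosed_iInter fun hφ => isClosed_iInter fun hc =>
    isClosed_iInter fun _ => ?_
  have hd : Continuous (deriv φ) := hφ.continuous_deriv (by simp)
  simp_rw [integral_smul_eq_inner (memLp_ofReal_of_hasCompactSupport hd hc.deriv),
    integral_smul_eq_inner (memLp_ofReal_of_hasCompactSupport hφ.continuous hc)]
  exact isClosed_eq
    (continuous_const.inner (WithLp.prod_continuous_ofLp 2 _ _).fst)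
    (continuous_const.inner (WithLp.prod_continuous_ofLp 2 _ _).snd).neg

/-- The pair (u, g) is the orthogonal projection of (f, 0) onto the graph of the weak derivative.
Orthogonality of the residual to (φ, φ') reads ⟨φ', g⟩ = -⟨φ, u - f⟩, the weak form of -u'' + u = f.
Boundary values are adjusted afterwards. -/
theorem exists_hasWeakDeriv_hasWeakDeriv_sub (f : L2Half 𝕜) :
    ∃ u g : L2Half 𝕜, HasWeakDeriv u g ∧ HasWeakDeriv g (u - f) := by
  have : CompleteSpace (weakDerivGraph 𝕜) := isClosed_weakDerivGraph.completeSpace_coe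
  set q := (weakDerivGraph 𝕜).starProjection (WithLp.toLp 2 (f, 0)) with hq
  have hqm : q ∈ weakDerivGraph 𝕜 := (weakDerivGraph 𝕜).starProjection_apply_mem _
  refine ⟨q.fst, q.snd, hqm, fun φ hφ hc hs => ?_⟩
  have hd : Continuous (deriv φ) := hφ.continuous_deriv (by simp)
  have m₀ := memLp_ofReal_of_hasCompactSupport (𝕜 := 𝕜) hφ.continuous hc
  have m₁ := memLp_ofReal_of_hasCompactSupport (𝕜 := 𝕜) hd hc.deriv
  have hw : HasWeakDeriv (m₀.toLp _) (m₁.toLp _) := hasWeakDeriv_toLp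
    (fun x => hasDerivAt_ofReal (hφ.differentiable (by simp) x).hasDerivAt)
    (RCLike.continuous_ofReal.comp hd) m₀ m₁
  have horth := (weakDerivGraph 𝕜).starProjection_inner_eq_zero (WithLp.toLp 2 (f, 0))
    (WithLp.toLp 2 (m₀.toLp _, m₁.toLp _)) hw
  rw [← hq, inner_eq_zero_symm, WithLp.prod_inner_apply] at horth
  simp only [WithLp.ofLp_sub, Prod.fst_sub, Prod.snd_sub, zero_sub, inner_neg_right] at horth
  rw [integral_smul_eq_inner m₀, integral_smul_eq_inner m₁]
  change inner 𝕜 (m₁.toLp _) q.ofLp.2 = -inner 𝕜 (m₀.toLp _) (q.ofLp.1 - f)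
  rw [inner_sub_right] at horth ⊢
  linear_combination -horth

theorem memLp_exp_neg : MemLp (fun x : ℝ => ((Real.exp (-x) : ℝ) : 𝕜)) 2 halfLine := by
  have h : MemLp (fun x : ℝ => Real.exp (-x)) 2 halfLine := by
    rw [memLp_two_iff_integrable_sq (by fun_prop)]
    refine (integrableOn_exp_mul_Ioi (a := -2) (by norm_num) 0).congr
      (Eventually.of_forall fun x => ?_)
    change Real.exp (-2 * x) = Real.exp (-x) ^ 2
    rw [← Real.exp_nat_mul]
    congr 1
    push_cast
    ring
  exact h.ofReal

/-- The function `e^{-x}` as an element of `L²(0, ∞)`. -/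
def expNeg (𝕜 : Type*) [RCLike 𝕜] : L2Half 𝕜 :=
  memLp_exp_neg.toLp (fun x : ℝ => ((Real.exp (-x) : ℝ) : 𝕜))

theorem hasWeakDeriv_expNeg : HasWeakDeriv (expNeg 𝕜) (-expNeg 𝕜) := by
  have h := hasWeakDeriv_toLp (𝕜 := 𝕜) (f := fun x => ((Real.exp (-x) : ℝ) : 𝕜))
    (g := -fun x => ((Real.exp (-x) : ℝ) : 𝕜))
    (fun x => by
      refine (hasDerivAt_ofReal (hasDerivAt_neg x).exp).congr_deriv ?_
      simp)
    (by fun_prop) memLp_exp_neg memLp_exp_neg.neg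
  rwa [MemLp.toLp_neg] at h

theorem HasWeakDeriv.neg {u g : L2Half 𝕜} (h : HasWeakDeriv u g) : HasWeakDeriv (-u) (-g) := by
  simpa using h.smul (-1 : 𝕜)

theorem HasTrace.neg {u : L2Half 𝕜} {c : 𝕜} (h : HasTrace u c) : HasTrace (-u) (-c) := by
  simpa using h.smul (-1 : 𝕜)

theorem hasTrace_expNeg : HasTrace (expNeg 𝕜) 1 := by
  have h := hasTrace_toLp (𝕜 := 𝕜) (f := fun x => ((Real.exp (-x) : ℝ) : 𝕜)) (by fun_prop)
    memLp_exp_neg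
  rwa [neg_zero, Real.exp_zero, RCLike.ofReal_one] at h

/-- The equation `-v_j'' + v_j = f_j` can be solved in the domain of the Kirchhoff operator. -/
theorem exists_mem_kirchhoffDomain {N : ℕ} (hN : N ≠ 0) (f : L2Graph 𝕜 N) :
    ∃ V ∈ kirchhoffDomain 𝕜 N, ∀ j, HasSecondWeakDeriv (V j) (V j - f j) := by
  choose u g hu hg using fun j => exists_hasWeakDeriv_hasWeakDeriv_sub (f j)
  choose a ha using fun j => (hu j).exists_hasTrace
  choose d hd using fun j => (hg j).exists_hasTrace
  -- Adding (m - a_j) e^{-x}, a decaying homogeneous solution, brings every vertex value to m and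
  -- turns the derivatives into d_j + a_j - m; their sum vanishes exactly for this mean.
  set m : 𝕜 := (∑ j, (d j + a j)) / N with hm
  have hN' : (N : 𝕜) ≠ 0 := by exact_mod_cast hN
  have h1 : ∀ j, HasWeakDeriv (u j + (m - a j) • expNeg 𝕜) (g j + (m - a j) • -expNeg 𝕜) :=
    fun j => (hu j).add (hasWeakDeriv_expNeg.smul _)
  have h2 : ∀ j, HasWeakDeriv (g j + (m - a j) • -expNeg 𝕜)
      (u j - f j + (m - a j) • -(-expNeg 𝕜)) :=
    fun j => (hg j).add (hasWeakDeriv_expNeg.neg.smul _)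
  refine ⟨WithLp.toLp 2 fun j => u j + (m - a j) • expNeg 𝕜,
    ⟨fun j => ⟨_, _, h1 j, h2 j⟩, ⟨m, fun j => ?_⟩, fun j => d j + (m - a j) • -1,
      fun j => ⟨_, h1 j, (hd j).add (hasTrace_expNeg.neg.smul _)⟩, ?_⟩, fun j => ?_⟩
  · have := (ha j).add (hasTrace_expNeg.smul (m - a j))
    simpa using this
  · have : ∀ j, d j + (m - a j) • (-1 : 𝕜) = (d j + a j) - m := fun j => by
      rw [smul_eq_mul]
      ring
    simp_rw [this]
    rw [Finset.sum_sub_distrib, Finset.sum_const, Finset.card_univ, Fintype.card_fin, hm,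
      nsmul_eq_mul, mul_div_cancel₀ _ hN', sub_self]
  · refine ⟨_, h1 j, ?_⟩
    convert h2 j using 1
    change u j + (m - a j) • expNeg 𝕜 - f j = _
    rw [neg_neg]
    abel

end Resolvent

/-! ### Symmetry and lower bound -/

section Symmetry

variable {𝕜 : Type*} [RCLike 𝕜] {N : ℕ} {p ω : ℝ} (hp : 1 < p) (hω : 0 < ω)

theorem potentialMul_ae (u : L2Half 𝕜) :
    potentialMul hp hω u =ᵐ[halfLine] fun x => (phi0 p ω x) ^ (p - 1) • u x :=
  (memLp_potential_mul hp hω u).coeFn_toLp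

theorem norm_potentialMul_le (u : L2Half 𝕜) :
    ‖potentialMul hp hω u‖ ≤ (p + 1) * ω / 2 * ‖u‖ := by
  refine Lp.norm_le_mul_norm_of_ae_le_mul ?_
  filter_upwards [potentialMul_ae hp hω u] with x hx
  rw [hx, norm_smul, Real.norm_eq_abs]
  exact mul_le_mul_of_nonneg_right (potential_bound hp hω x) (norm_nonneg _)

/-- Multiplication by the potential as a bounded operator. -/
def potentialCLM (𝕜 : Type*) [RCLike 𝕜] {p ω : ℝ} (hp : 1 < p) (hω : 0 < ω) :
    L2Half 𝕜 →L[𝕜] L2Half 𝕜 :=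
  (potentialMul hp hω).mkContinuous _ (norm_potentialMul_le hp hω)

theorem inner_potentialMul (u v : L2Half 𝕜) :
    inner 𝕜 (potentialMul hp hω u) v = inner 𝕜 u (potentialMul hp hω v) := by
  rw [L2.inner_def, L2.inner_def]
  refine integral_congr_ae ?_
  filter_upwards [potentialMul_ae hp hω u, potentialMul_ae hp hω v] with x hx hy
  rw [hx, hy, inner_smul_left_eq_star_smul, inner_smul_right_eq_smul]
  simp

/-- Inclusion of the functions supported on the edge `j`. -/
def edgeIncl (𝕜 : Type*) [RCLike 𝕜] (N : ℕ) (j : Fin N) : L2Half 𝕜 →L[𝕜] L2Graph 𝕜 N :=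
  (PiLp.continuousLinearEquiv 2 𝕜 fun _ : Fin N => L2Half 𝕜).symm.toContinuousLinearMap ∘L
    ContinuousLinearMap.single 𝕜 (fun _ : Fin N => L2Half 𝕜) j

theorem edgeIncl_apply (i j : Fin N) (u : L2Half 𝕜) :
    edgeIncl 𝕜 N j u i = if i = j then u else 0 := by
  change (Pi.single j u : Fin N → L2Half 𝕜) i = _
  rw [Pi.single_apply]

/-- Restriction to the edge `j`. -/
def edgeProj (𝕜 : Type*) [RCLike 𝕜] (N : ℕ) (j : Fin N) : L2Graph 𝕜 N →L[𝕜] L2Half 𝕜 :=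
  PiLp.proj 2 (fun _ : Fin N => L2Half 𝕜) j

/-- Multiplication by `p φ₀^{p-1}` on all edges. -/
def graphPotential (𝕜 : Type*) [RCLike 𝕜] (N : ℕ) {p ω : ℝ} (hp : 1 < p) (hω : 0 < ω) :
    L2Graph 𝕜 N →L[𝕜] L2Graph 𝕜 N :=
  ∑ j, (p : 𝕜) • (edgeIncl 𝕜 N j ∘L potentialCLM 𝕜 hp hω ∘L edgeProj 𝕜 N j)

theorem graphPotential_apply (V : L2Graph 𝕜 N) (j : Fin N) :
    graphPotential 𝕜 N hp hω V j = (p : 𝕜) • potentialMul hp hω (V j) := by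
  have h : graphPotential 𝕜 N hp hω V j = edgeProj 𝕜 N j (graphPotential 𝕜 N hp hω V) := rfl
  rw [h, graphPotential, sum_apply, map_sum]
  have : ∀ i, edgeProj 𝕜 N j
      (((p : 𝕜) • (edgeIncl 𝕜 N i ∘L potentialCLM 𝕜 hp hω ∘L edgeProj 𝕜 N i)) V)
      = if j = i then (p : 𝕜) • potentialMul hp hω (V i) else 0 := by
    intro i
    change (p : 𝕜) • edgeIncl 𝕜 N i (potentialMul hp hω (V i)) j = _
    rw [edgeIncl_apply, smul_ite, smul_zero]
  simp_rw [this]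
  simp

theorem kirchhoffOp_apply (V : (kirchhoffOp 𝕜 N hp hω).domain) (j : Fin N) {h : L2Half 𝕜}
    (hh : HasSecondWeakDeriv ((V : L2Graph 𝕜 N) j) h) :
    kirchhoffOp 𝕜 N hp hω V j = -h + (ω : 𝕜) • (V : L2Graph 𝕜 N) j
      - (p : 𝕜) • potentialMul hp hω ((V : L2Graph 𝕜 N) j) := by
  change edgeExpr hp hω _ (V.2.1 j) = _
  rw [edgeExpr, (secondDeriv_spec _ _).unique hh]

/-- Integration by parts on each edge leaves the vertex terms conj(d_j) c, with c common to all
edges and ∑ d_j = 0, so they cancel in the sum. -/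
theorem inner_kirchhoffOp (U V : (kirchhoffOp 𝕜 N hp hω).domain) {g k : Fin N → L2Half 𝕜}
    (hg : ∀ j, HasWeakDeriv ((U : L2Graph 𝕜 N) j) (g j))
    (hk : ∀ j, HasWeakDeriv ((V : L2Graph 𝕜 N) j) (k j)) :
    inner 𝕜 (kirchhoffOp 𝕜 N hp hω U) (V : L2Graph 𝕜 N)
      = ∑ j, (inner 𝕜 (g j) (k j) + ω * inner 𝕜 ((U : L2Graph 𝕜 N) j) ((V : L2Graph 𝕜 N) j)
        - p * inner 𝕜 (potentialMul hp hω ((U : L2Graph 𝕜 N) j)) ((V : L2Graph 𝕜 N) j)) := by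
  obtain ⟨hU, -, d, hd, hsum⟩ := U.2
  obtain ⟨-, ⟨c, hc⟩, -⟩ := V.2
  have key : ∀ j, inner 𝕜 (kirchhoffOp 𝕜 N hp hω U j) ((V : L2Graph 𝕜 N) j)
      = (inner 𝕜 (g j) (k j) + ω * inner 𝕜 ((U : L2Graph 𝕜 N) j) ((V : L2Graph 𝕜 N) j)
        - p * inner 𝕜 (potentialMul hp hω ((U : L2Graph 𝕜 N) j)) ((V : L2Graph 𝕜 N) j))
        + (starRingEnd 𝕜) (d j) * c := by
    intro j
    obtain ⟨h, g', hg', hh⟩ := hU j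
    obtain rfl := (hg j).unique hg'
    obtain ⟨g'', hg'', tr⟩ := hd j
    obtain rfl := (hg j).unique hg''
    have ibp := hh.inner_add_inner (hk j) tr (hc j)
    rw [kirchhoffOp_apply hp hω U j ⟨_, hg j, hh⟩, inner_sub_left, inner_add_left, inner_neg_left,
      inner_smul_left, inner_smul_left, RCLike.conj_ofReal, RCLike.conj_ofReal]
    linear_combination -ibp
  rw [PiLp.inner_apply]
  simp_rw [key]
  rw [Finset.sum_add_distrib, ← Finset.sum_mul, ← map_sum, hsum, map_zero, zero_mul, add_zero]

theorem exists_weakDeriv (U : (kirchhoffOp 𝕜 N hp hω).domain) :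
    ∃ g : Fin N → L2Half 𝕜, ∀ j, HasWeakDeriv ((U : L2Graph 𝕜 N) j) (g j) := by
  choose h g hg _ using U.2.1
  exact ⟨g, hg⟩

theorem isSymmetricOp_kirchhoffOp : IsSymmetricOp (kirchhoffOp 𝕜 N hp hω) := by
  intro U V
  obtain ⟨g, hg⟩ := exists_weakDeriv hp hω U
  obtain ⟨k, hk⟩ := exists_weakDeriv hp hω V
  rw [← inner_conj_symm _ (kirchhoffOp 𝕜 N hp hω V), inner_kirchhoffOp hp hω U V hg hk,
    inner_kirchhoffOp hp hω V U hk hg, map_sum]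
  refine Finset.sum_congr rfl fun j _ => ?_
  simp only [map_sub, map_add, map_mul, RCLike.conj_ofReal, inner_conj_symm,
    inner_potentialMul]

/-- The operator `A + W - (ω - 1)`, that is, `-d²/dx² + 1` with the Kirchhoff condition. -/
def shiftedOp (𝕜 : Type*) [RCLike 𝕜] (N : ℕ) {p ω : ℝ} (hp : 1 < p) (hω : 0 < ω) :
    (kirchhoffOp 𝕜 N hp hω).domain →ₗ[𝕜] L2Graph 𝕜 N :=
  (kirchhoffOp 𝕜 N hp hω).toFun +
    ((graphPotential 𝕜 N hp hω : L2Graph 𝕜 N →ₗ[𝕜] L2Graph 𝕜 N)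
      - ((ω : 𝕜) - 1) • LinearMap.id) ∘ₗ (kirchhoffOp 𝕜 N hp hω).domain.subtype

theorem shiftedOp_apply (V : (kirchhoffOp 𝕜 N hp hω).domain) :
    shiftedOp 𝕜 N hp hω V = kirchhoffOp 𝕜 N hp hω V + graphPotential 𝕜 N hp hω V
      - ((ω : 𝕜) - 1) • (V : L2Graph 𝕜 N) :=
  (add_sub_assoc _ _ _).symm

/-- The shift removes the potential and leaves the constant 1, so the form is the squared H¹ norm.
Injectivity and all bounds on the inverse follow from this. -/
theorem inner_shiftedOp (V : (kirchhoffOp 𝕜 N hp hω).domain) {g : Fin N → L2Half 𝕜}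
    (hg : ∀ j, HasWeakDeriv ((V : L2Graph 𝕜 N) j) (g j)) :
    inner 𝕜 (shiftedOp 𝕜 N hp hω V) (V : L2Graph 𝕜 N)
      = ((∑ j, ‖g j‖ ^ 2 + ‖(V : L2Graph 𝕜 N)‖ ^ 2 : ℝ) : 𝕜) := by
  rw [shiftedOp_apply, inner_sub_left, inner_add_left, inner_kirchhoffOp hp hω V V hg hg,
    inner_smul_left, PiLp.inner_apply, PiLp.inner_apply, PiLp.norm_sq_eq_of_L2]
  simp only [graphPotential_apply, inner_smul_left, RCLike.conj_ofReal, map_sub, map_one]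
  push_cast
  rw [Finset.mul_sum, ← Finset.sum_add_distrib, ← Finset.sum_add_distrib, ← Finset.sum_sub_distrib]
  refine Finset.sum_congr rfl fun j _ => ?_
  rw [inner_self_eq_norm_sq_to_K, inner_self_eq_norm_sq_to_K]
  ring

theorem bijective_shiftedOp (hN : N ≠ 0) : Function.Bijective (shiftedOp 𝕜 N hp hω) := by
  constructor
  · rw [injective_iff_map_eq_zero]
    intro V hV
    obtain ⟨g, hg⟩ := exists_weakDeriv hp hω V
    have h := inner_shiftedOp hp hω V hg
    rw [hV, inner_zero_left] at h
    have h' : (0 : ℝ) = ∑ j, ‖g j‖ ^ 2 + ‖(V : L2Graph 𝕜 N)‖ ^ 2 := by exact_mod_cast h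
    have h1 : 0 ≤ ∑ j, ‖g j‖ ^ 2 := Finset.sum_nonneg fun j _ => by positivity
    have h2 : ‖(V : L2Graph 𝕜 N)‖ ^ 2 = 0 := le_antisymm (by linarith) (by positivity)
    exact Subtype.ext (by simpa using h2)
  · intro f
    obtain ⟨V, hV, hs⟩ := exists_mem_kirchhoffDomain hN f
    refine ⟨⟨V, hV⟩, ?_⟩
    rw [shiftedOp_apply]
    ext1 j
    rw [PiLp.sub_apply, PiLp.add_apply, PiLp.smul_apply, graphPotential_apply,
      kirchhoffOp_apply hp hω ⟨V, hV⟩ j (hs j)]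
    module

/-- For x = B y the form identity gives ⟨x, y⟩ = ∑ ‖g_j‖² + ‖x‖². Cauchy–Schwarz yields ‖x‖ ≤ ‖y‖,
then the bound ‖y‖² on the whole expression, hence on each ‖g_j‖². The final clause, boundedness
into H¹, feeds the compactness argument. -/
theorem exists_bounded_inverse (𝕜 : Type*) [RCLike 𝕜] {N : ℕ} (hN : N ≠ 0) :
    ∃ B : L2Graph 𝕜 N →L[𝕜] L2Graph 𝕜 N,
      (∀ y, ∃ h : B y ∈ (kirchhoffOp 𝕜 N hp hω).domain, shiftedOp 𝕜 N hp hω ⟨B y, h⟩ = y) ∧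
      (∀ x, B (shiftedOp 𝕜 N hp hω x) = x) ∧
      (∀ y, ∃ b : ℝ, 0 ≤ b ∧ b ≤ ‖y‖ ^ 2 ∧ inner 𝕜 (B y) y = (b : 𝕜)) ∧
      ∀ y j, ∃ g, HasWeakDeriv (B y j) g ∧ ‖g‖ ≤ ‖y‖ := by
  set T := LinearEquiv.ofBijective _ (bijective_shiftedOp (𝕜 := 𝕜) hp hω hN) with hT
  have main : ∀ y, ∃ b : ℝ, ∃ g : Fin N → L2Half 𝕜,
      (∀ j, HasWeakDeriv ((T.symm y : L2Graph 𝕜 N) j) (g j)) ∧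
      inner 𝕜 (T.symm y : L2Graph 𝕜 N) y = (b : 𝕜) ∧
      b = ∑ j, ‖g j‖ ^ 2 + ‖(T.symm y : L2Graph 𝕜 N)‖ ^ 2 ∧
      ‖(T.symm y : L2Graph 𝕜 N)‖ ≤ ‖y‖ ∧ b ≤ ‖y‖ ^ 2 := by
    intro y
    obtain ⟨g, hg⟩ := exists_weakDeriv hp hω (T.symm y)
    have h := inner_shiftedOp hp hω (T.symm y) hg
    have hy : shiftedOp 𝕜 N hp hω (T.symm y) = y := T.apply_symm_apply y
    rw [hy] at h
    set x : L2Graph 𝕜 N := (T.symm y : L2Graph 𝕜 N) with hx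
    set b : ℝ := ∑ j, ‖g j‖ ^ 2 + ‖x‖ ^ 2 with hb
    have h' : inner 𝕜 x y = (b : 𝕜) := by rw [← inner_conj_symm, h, RCLike.conj_ofReal]
    have h1 : 0 ≤ ∑ j, ‖g j‖ ^ 2 := Finset.sum_nonneg fun j _ => by positivity
    have hb0 : 0 ≤ b := by positivity
    have h2 : b ≤ ‖x‖ * ‖y‖ := by
      have := norm_inner_le_norm (𝕜 := 𝕜) x y
      rwa [h', RCLike.norm_ofReal, abs_of_nonneg hb0] at this
    have h3 : ‖x‖ ≤ ‖y‖ := by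
      by_contra hlt
      nlinarith [norm_nonneg x, norm_nonneg y]
    exact ⟨b, g, hg, h', rfl, h3, h2.trans (by nlinarith [norm_nonneg x, norm_nonneg y])⟩
  set L : L2Graph 𝕜 N →ₗ[𝕜] L2Graph 𝕜 N :=
    (kirchhoffOp 𝕜 N hp hω).domain.subtype ∘ₗ (T.symm : L2Graph 𝕜 N →ₗ[𝕜] _) with hL
  refine ⟨L.mkContinuous 1 fun y => ?_, fun y => ⟨(T.symm y).2, T.apply_symm_apply y⟩,
    fun x => congrArg Subtype.val (T.symm_apply_apply x), fun y => ?_, fun y j => ?_⟩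
  · obtain ⟨b, g, -, -, -, h, -⟩ := main y
    rw [one_mul]
    exact h
  · obtain ⟨b, g, -, h1, h2, -, h3⟩ := main y
    refine ⟨b, ?_, h3, h1⟩
    rw [h2]
    exact add_nonneg (Finset.sum_nonneg fun j _ => by positivity) (by positivity)
  · obtain ⟨b, g, hg, -, h2, -, h3⟩ := main y
    refine ⟨g j, hg j, ?_⟩
    have h4 : ‖g j‖ ^ 2 ≤ ∑ j, ‖g j‖ ^ 2 :=
      Finset.single_le_sum (f := fun j => ‖g j‖ ^ 2) (fun j _ => by positivity) (Finset.mem_univ j)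
    refine le_of_sq_le_sq ?_ (norm_nonneg y)
    nlinarith [sq_nonneg ‖(T.symm y : L2Graph 𝕜 N)‖]

end Symmetry

/-! ### Compactness of multiplication by a decaying function on `H¹` -/

section Compactness

variable {𝕜 : Type*} [RCLike 𝕜]

theorem norm_sq_L2 (v : L2Half 𝕜) : ‖v‖ ^ 2 = ∫ x in Ioi (0 : ℝ), ‖v x‖ ^ 2 := by
  have h := inner_self_eq_norm_sq_to_K (𝕜 := 𝕜) v
  rw [L2.inner_def] at h
  simp_rw [inner_self_eq_norm_sq_to_K] at h
  have e : ∫ x in Ioi (0 : ℝ), ((‖v x‖ : ℝ) : 𝕜) ^ 2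
      = ((∫ x in Ioi (0 : ℝ), ‖v x‖ ^ 2 : ℝ) : 𝕜) := by
    rw [← integral_ofReal]
    push_cast
    rfl
  rw [e] at h
  exact_mod_cast h.symm

theorem integrable_norm_sq_L2 (v : L2Half 𝕜) : Integrable (fun x => ‖v x‖ ^ 2) halfLine :=
  (Lp.memLp v).integrable_norm_pow (by norm_num)

/-- Cauchy–Schwarz in the form that the variance of `‖g‖` over the interval is nonnegative. -/
theorem sq_intervalIntegral_norm_le (g : L2Half 𝕜) {a b : ℝ} (ha : 0 ≤ a) (hab : a < b) :
    (∫ t in a..b, ‖g t‖) ^ 2 ≤ (b - a) * ∫ t in a..b, ‖g t‖ ^ 2 := by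
  have i₁ : IntervalIntegrable (fun t => ‖g t‖) volume a b :=
    (intervalIntegrable_L2 g ha hab.le).norm
  have i₂ : IntervalIntegrable (fun t => ‖g t‖ ^ 2) volume a b := by
    rw [intervalIntegrable_iff_integrableOn_Ioc_of_le hab.le]
    exact (integrable_norm_sq_L2 g).mono_measure
      (Measure.restrict_mono (fun x hx => lt_of_le_of_lt ha hx.1) le_rfl)
  set J := ∫ t in a..b, ‖g t‖
  set m := J / (b - a) with hm
  have hba : 0 < b - a := sub_pos.mpr hab
  have h0 : 0 ≤ ∫ t in a..b, (‖g t‖ - m) ^ 2 :=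
    intervalIntegral.integral_nonneg hab.le fun t _ => sq_nonneg _
  have h1 : ∫ t in a..b, (‖g t‖ - m) ^ 2 = (∫ t in a..b, ‖g t‖ ^ 2) - 2 * m * J
      + (b - a) * m ^ 2 := by
    have : ∀ t, (‖g t‖ - m) ^ 2 = ‖g t‖ ^ 2 - 2 * m * ‖g t‖ + m ^ 2 := fun t => by ring
    simp_rw [this]
    rw [intervalIntegral.integral_add (i₂.sub (i₁.const_mul _)) (by simp),
      intervalIntegral.integral_sub i₂ (i₁.const_mul _), intervalIntegral.integral_const_mul,
      intervalIntegral.integral_const, smul_eq_mul]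
  rw [h1] at h0
  have h2 : J = m * (b - a) := by rw [hm]; field_simp
  rw [h2] at h0 ⊢
  nlinarith

/-- The deviation of an `H¹` function from its mean on an interval. -/
theorem sq_norm_sub_mean_le {u g : L2Half 𝕜} (h : HasWeakDeriv u g) {a b : ℝ} (ha : 0 ≤ a)
    (hab : a < b) : ∀ᵐ x ∂halfLine, x ∈ Ioc a b →
      ‖u x - ((b - a : ℝ) : 𝕜)⁻¹ * ∫ t in a..b, u t‖ ^ 2 ≤ (b - a) * ∫ t in a..b, ‖g t‖ ^ 2 := by
  obtain ⟨c, hc⟩ := h.exists_primitive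
  set f : ℝ → 𝕜 := fun x => c + ∫ t in (0 : ℝ)..x, g t with hf
  have hba : 0 < b - a := sub_pos.mpr hab
  have hba' : ((b - a : ℝ) : 𝕜) ≠ 0 := by exact_mod_cast hba.ne'
  have hfc : ContinuousOn f (Ici 0) := continuousOn_const.add (continuousOn_primitive_L2 g)
  have e1 : ∫ t in a..b, u t = ∫ t in a..b, f t := by
    refine intervalIntegral.integral_congr_ae ?_
    filter_upwards [(ae_restrict_iff' measurableSet_Ioi).mp hc] with t ht hx
    rw [uIoc_of_le hab.le] at hx
    exact ht (lt_of_le_of_lt ha hx.1)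
  have fi : IntervalIntegrable f volume a b := by
    refine (hfc.mono ?_).intervalIntegrable
    rw [uIcc_of_le hab.le]
    exact fun x hx => ha.trans hx.1
  have gi := (intervalIntegrable_L2 g ha hab.le).norm
  -- The oscillation of the continuous representative is at most the integral of `‖g‖`, and so is
  -- its distance from the mean.
  have osc : ∀ x ∈ Icc a b, ∀ y ∈ Icc a b, ‖f x - f y‖ ≤ ∫ t in a..b, ‖g t‖ := by
    intro x hx y hy
    have : f x - f y = ∫ t in y..x, g t := by
      simp only [hf]
      rw [← intervalIntegral.integral_interval_sub_left
        (intervalIntegrable_L2 g le_rfl (ha.trans hx.1))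
        (intervalIntegrable_L2 g le_rfl (ha.trans hy.1))]
      ring
    rw [this]
    refine (intervalIntegral.norm_integral_le_abs_integral_norm).trans ?_
    rw [← abs_of_nonneg (intervalIntegral.integral_nonneg hab.le fun t _ => norm_nonneg (g t))]
    refine intervalIntegral.abs_integral_mono_interval ?_
      (Eventually.of_forall fun t => norm_nonneg _) gi
    rw [uIoc_of_le hab.le]
    exact fun t ht => ⟨(le_min hy.1 hx.1).trans_lt ht.1, ht.2.trans (max_le hy.2 hx.2)⟩
  filter_upwards [hc] with x hx hxm
  rw [hx, e1]
  have hxI : x ∈ Icc a b := Ioc_subset_Icc_self hxm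
  have e2 : f x - ((b - a : ℝ) : 𝕜)⁻¹ * ∫ t in a..b, f t
      = ((b - a : ℝ) : 𝕜)⁻¹ * ∫ t in a..b, (f x - f t) := by
    rw [intervalIntegral.integral_sub (by simp) fi, intervalIntegral.integral_const,
      RCLike.real_smul_eq_coe_mul]
    field_simp
  have e3 : ‖∫ t in a..b, (f x - f t)‖ ≤ (∫ t in a..b, ‖g t‖) * |b - a| :=
    intervalIntegral.norm_integral_le_of_norm_le_const fun t ht => by
      rw [uIoc_of_le hab.le] at ht
      exact osc x hxI t (Ioc_subset_Icc_self ht)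
  have e4 : ‖f x - ((b - a : ℝ) : 𝕜)⁻¹ * ∫ t in a..b, f t‖ ≤ ∫ t in a..b, ‖g t‖ := by
    rw [e2, norm_mul, norm_inv, RCLike.norm_ofReal, abs_of_pos hba, inv_mul_le_iff₀ hba]
    rw [abs_of_pos hba] at e3
    linarith
  exact (pow_le_pow_left₀ (norm_nonneg _) e4 2).trans (sq_intervalIntegral_norm_le g ha hab)

/-- The `i`-th cell of the mesh of width `h` on the half-line. -/
def meshCell (h : ℝ) (i : ℕ) : Set ℝ := Ioc (i * h) ((i + 1 : ℕ) * h)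

theorem measurableSet_meshCell {h : ℝ} {i : ℕ} : MeasurableSet (meshCell h i) := measurableSet_Ioc

theorem measure_meshCell_ne_top {h : ℝ} {i : ℕ} : halfLine (meshCell h i) ≠ ∞ :=
  measure_Ioc_lt_top.ne

/-- The indicator function of a mesh cell. -/
def meshIndicator (𝕜 : Type*) [RCLike 𝕜] (h : ℝ) (i : ℕ) : L2Half 𝕜 :=
  indicatorConstLp 2 (s := meshCell h i) measurableSet_meshCell measure_meshCell_ne_top 1

/-- Averaging over the first `n` mesh cells. -/
def meshAverage (𝕜 : Type*) [RCLike 𝕜] (h : ℝ) (n : ℕ) : L2Half 𝕜 →L[𝕜] L2Half 𝕜 :=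
  ∑ i ∈ Finset.range n,
    (h : 𝕜)⁻¹ • (innerSL 𝕜 (meshIndicator 𝕜 h i)).smulRight (meshIndicator 𝕜 h i)

theorem isCompactOperator_meshAverage (h : ℝ) (n : ℕ) : IsCompactOperator (meshAverage 𝕜 h n) := by
  have : meshAverage 𝕜 h n ∈ compactOperator (RingHom.id 𝕜) (L2Half 𝕜) (L2Half 𝕜) := by
    refine Submodule.sum_mem _ fun i _ => Submodule.smul_mem _ _ ?_
    exact (isCompactOperator_of_finiteDimensional (innerSL 𝕜 (meshIndicator 𝕜 h i))).clm_comp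
      (ContinuousLinearMap.toSpanSingleton 𝕜 (meshIndicator 𝕜 h i))
  exact this

theorem inner_meshIndicator {h : ℝ} (hh : 0 < h) (i : ℕ) (u : L2Half 𝕜) :
    inner 𝕜 (meshIndicator 𝕜 h i) u = ∫ t in (i * h : ℝ)..((i + 1 : ℕ) * h), u t := by
  have hle : (i * h : ℝ) ≤ (i + 1 : ℕ) * h := by push_cast; nlinarith
  rw [meshIndicator, L2.inner_indicatorConstLp_one, intervalIntegral.integral_of_le hle, meshCell,
    Measure.restrict_restrict measurableSet_Ioc, inter_eq_left.mpr]
  exact fun x hx => lt_of_le_of_lt (by positivity) hx.1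

theorem meshAverage_ae {h : ℝ} (hh : 0 < h) (n : ℕ) (u : L2Half 𝕜) :
    meshAverage 𝕜 h n u =ᵐ[halfLine] fun x => ∑ i ∈ Finset.range n, (meshCell h i).indicator
      (fun _ => (h : 𝕜)⁻¹ * ∫ t in (i * h : ℝ)..((i + 1 : ℕ) * h), u t) x := by
  have e1 : meshAverage 𝕜 h n u = ∑ i ∈ Finset.range n,
      ((h : 𝕜)⁻¹ * ∫ t in (i * h : ℝ)..((i + 1 : ℕ) * h), u t) • meshIndicator 𝕜 h i := by
    rw [meshAverage, sum_apply]
    refine Finset.sum_congr rfl fun i _ => ?_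
    rw [smul_apply, ContinuousLinearMap.smulRight_apply, innerSL_apply_apply,
      inner_meshIndicator hh, smul_smul]
  rw [e1]
  have h1 : ∀ᵐ x ∂halfLine, ∀ i ∈ Finset.range n,
      (((h : 𝕜)⁻¹ * ∫ t in (i * h : ℝ)..((i + 1 : ℕ) * h), u t) • meshIndicator 𝕜 h i : L2Half 𝕜) x
        = (meshCell h i).indicator
          (fun _ => (h : 𝕜)⁻¹ * ∫ t in (i * h : ℝ)..((i + 1 : ℕ) * h), u t) x := by
    rw [Finset.eventually_all]
    intro i _
    filter_upwards [Lp.coeFn_smul ((h : 𝕜)⁻¹ * ∫ t in (i * h : ℝ)..((i + 1 : ℕ) * h), u t)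
      (meshIndicator 𝕜 h i), indicatorConstLp_coeFn (p := 2) (s := meshCell h i) (c := (1 : 𝕜))
        (hs := measurableSet_meshCell) (hμs := measure_meshCell_ne_top)] with x h1 h2
    rw [h1, Pi.smul_apply, meshIndicator, h2]
    by_cases hx : x ∈ meshCell h i <;> simp [hx]
  filter_upwards [h1, Lp.coeFn_finsetSum (Finset.range n) (fun i =>
    ((h : 𝕜)⁻¹ * ∫ t in (i * h : ℝ)..((i + 1 : ℕ) * h), u t) • meshIndicator 𝕜 h i)] with x h1 h2
  rw [h2, Finset.sum_apply]
  exact Finset.sum_congr rfl h1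

theorem eq_of_mem_meshCell {h x : ℝ} (hh : 0 < h) {i j : ℕ} (hi : x ∈ meshCell h i)
    (hj : x ∈ meshCell h j) : i = j := by
  have key : ∀ {i j : ℕ}, x ∈ meshCell h i → x ∈ meshCell h j → i ≤ j := by
    intro i j hi hj
    have h1 : (i : ℝ) * h < (j + 1 : ℕ) * h := lt_of_lt_of_le hi.1 hj.2
    have h2 : (i : ℝ) < (j + 1 : ℕ) := lt_of_mul_lt_mul_right h1 hh.le
    exact Nat.lt_succ_iff.mp (by exact_mod_cast h2)
  exact le_antisymm (key hi hj) (key hj hi)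

theorem exists_mem_meshCell {h x : ℝ} (hx : 0 < x) {n : ℕ} (hn : x ≤ n * h) :
    ∃ i < n, x ∈ meshCell h i := by
  induction n with
  | zero => simp at hn; linarith
  | succ n ih =>
    rcases le_or_gt x (n * h) with h1 | h1
    · obtain ⟨i, hi, hx⟩ := ih h1
      exact ⟨i, by omega, hx⟩
    · exact ⟨n, by omega, h1, hn⟩

/-- Multiplication by a function that is small beyond the mesh is well approximated on `H¹` by
averaging. -/
theorem norm_mul_sub_meshAverage_le {Q : L2Half 𝕜 →L[𝕜] L2Half 𝕜} {q : ℝ → ℝ}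
    (hQ : ∀ u, Q u =ᵐ[halfLine] fun x => q x • u x) {M s h : ℝ} (hM : ∀ x, |q x| ≤ M)
    (hh : 0 < h) {n : ℕ} (hs : ∀ x, n * h < x → |q x| ≤ s) {u g : L2Half 𝕜}
    (hu : HasWeakDeriv u g) :
    ‖Q u - Q (meshAverage 𝕜 h n u)‖ ^ 2 ≤ (M * h * ‖g‖) ^ 2 + (s * ‖u‖) ^ 2 := by
  set G : ℕ → ℝ := fun i => ∫ t in (i * h : ℝ)..((i + 1 : ℕ) * h), ‖g t‖ ^ 2 with hG
  have hw : ∀ i : ℕ, ((i + 1 : ℕ) * h - i * h : ℝ) = h := fun i => by push_cast; ring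
  have hlt : ∀ i : ℕ, (i * h : ℝ) < (i + 1 : ℕ) * h := fun i => by linarith [hw i]
  have gint : ∀ {a b : ℝ}, 0 ≤ a → a ≤ b → IntervalIntegrable (fun t => ‖g t‖ ^ 2) volume a b := by
    intro a b ha hab
    rw [intervalIntegrable_iff_integrableOn_Ioc_of_le hab]
    exact (integrable_norm_sq_L2 g).mono_measure
      (Measure.restrict_mono (fun x hx => lt_of_le_of_lt ha hx.1) le_rfl)
  have hGsum : ∑ i ∈ Finset.range n, G i ≤ ‖g‖ ^ 2 := by
    have := intervalIntegral.sum_integral_adjacent_intervals (f := fun t => ‖g t‖ ^ 2)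
      (μ := volume) (a := fun i : ℕ => (i : ℝ) * h) (n := n)
      (fun k _ => gint (by positivity) (hlt k).le)
    rw [this, norm_sq_L2, intervalIntegral.integral_of_le (by simp; positivity)]
    refine setIntegral_mono_set (integrable_norm_sq_L2 g)
      (Eventually.of_forall fun x => by positivity) (LE.le.eventuallyLE ?_)
    intro x hx
    simpa using hx.1
  have hmean : ∀ᵐ x ∂halfLine, ∀ i ∈ Finset.range n, x ∈ meshCell h i →
      ‖u x - (h : 𝕜)⁻¹ * ∫ t in (i * h : ℝ)..((i + 1 : ℕ) * h), u t‖ ^ 2 ≤ h * G i := by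
    rw [Finset.eventually_all]
    intro i _
    have := sq_norm_sub_mean_le hu (a := i * h) (b := (i + 1 : ℕ) * h) (by positivity) (hlt i)
    rwa [hw i] at this
  have hG0 : ∀ i, 0 ≤ G i := fun i =>
    intervalIntegral.integral_nonneg (hlt i).le fun t _ => by positivity
  have hM0 : 0 ≤ M := (abs_nonneg _).trans (hM 0)
  -- A point up to n h lies in exactly one cell, where the mean estimate applies with the factor M²;
  -- beyond n h the average is zero and |q| ≤ s.
  have hpt : ∀ᵐ x ∂halfLine, ‖(Q u - Q (meshAverage 𝕜 h n u) : L2Half 𝕜) x‖ ^ 2 ≤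
      (∑ i ∈ Finset.range n, (meshCell h i).indicator (fun _ => M ^ 2 * (h * G i)) x)
        + s ^ 2 * ‖u x‖ ^ 2 := by
    filter_upwards [hmean, meshAverage_ae hh n u, hQ u, hQ (meshAverage 𝕜 h n u),
      Lp.coeFn_sub (Q u) (Q (meshAverage 𝕜 h n u)), ae_restrict_mem measurableSet_Ioi]
      with x h1 h2 h3 h4 h5 hx0
    rw [h5, Pi.sub_apply, h3, h4, h2, ← smul_sub, norm_smul, mul_pow, Real.norm_eq_abs]
    rcases le_or_gt x (n * h) with hxn | hxn
    · obtain ⟨i, hi, hxi⟩ := exists_mem_meshCell hx0 hxn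
      have hne : ∀ j ∈ Finset.range n, j ≠ i → x ∉ meshCell h j := fun j _ hj hxj =>
        hj (eq_of_mem_meshCell hh hxj hxi)
      rw [Finset.sum_eq_single_of_mem i (Finset.mem_range.mpr hi)
          (fun j hj hji => indicator_of_notMem (hne j hj hji) _),
        Finset.sum_eq_single_of_mem i (Finset.mem_range.mpr hi)
          (fun j hj hji => indicator_of_notMem (hne j hj hji) _),
        indicator_of_mem hxi, indicator_of_mem hxi]
      have := mul_le_mul (pow_le_pow_left₀ (abs_nonneg _) (hM x) 2)
        (h1 i (Finset.mem_range.mpr hi) hxi) (by positivity) (by positivity)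
      nlinarith [sq_nonneg (s * ‖u x‖)]
    · have hne : ∀ j ∈ Finset.range n, x ∉ meshCell h j := fun j hj hxj => by
        have h6 : ((j + 1 : ℕ) : ℝ) ≤ n := by exact_mod_cast Finset.mem_range.mp hj
        have := hxj.2
        nlinarith
      rw [Finset.sum_eq_zero (fun j hj => indicator_of_notMem (hne j hj) _),
        Finset.sum_eq_zero (fun j hj => indicator_of_notMem (hne j hj) _), sub_zero, zero_add]
      exact mul_le_mul_of_nonneg_right (pow_le_pow_left₀ (abs_nonneg _) (hs x hxn) 2)
        (by positivity)
  have hi1 : ∀ i ∈ Finset.range n,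
      Integrable ((meshCell h i).indicator fun _ => M ^ 2 * (h * G i)) halfLine := fun i _ =>
    (integrable_indicator_iff measurableSet_meshCell).mpr
      (integrableOn_const measure_meshCell_ne_top)
  have hi2 : Integrable (fun x => s ^ 2 * ‖u x‖ ^ 2) halfLine :=
    (integrable_norm_sq_L2 u).const_mul _
  have hvol : ∀ i, ∫ x in Ioi (0 : ℝ), (meshCell h i).indicator (fun _ => M ^ 2 * (h * G i)) x
      = h * (M ^ 2 * (h * G i)) := by
    intro i
    have hsub : meshCell h i ⊆ Ioi 0 := fun x hx => lt_of_le_of_lt (by positivity) hx.1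
    rw [integral_indicator measurableSet_meshCell,
      Measure.restrict_restrict measurableSet_meshCell,
      inter_eq_left.mpr hsub, integral_const, smul_eq_mul]
    congr 1
    rw [measureReal_restrict_apply MeasurableSet.univ, univ_inter, meshCell,
      Real.volume_real_Ioc_of_le (hlt i).le, hw]
  rw [norm_sq_L2]
  calc ∫ x in Ioi (0 : ℝ), ‖(Q u - Q (meshAverage 𝕜 h n u) : L2Half 𝕜) x‖ ^ 2
      ≤ ∫ x in Ioi (0 : ℝ), ((∑ i ∈ Finset.range n,
          (meshCell h i).indicator (fun _ => M ^ 2 * (h * G i)) x) + s ^ 2 * ‖u x‖ ^ 2) :=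
        integral_mono_ae (integrable_norm_sq_L2 _) ((integrable_finsetSum _ hi1).add hi2) hpt
    _ = (∑ i ∈ Finset.range n, h * (M ^ 2 * (h * G i))) + s ^ 2 * ‖u‖ ^ 2 := by
        rw [integral_add (integrable_finsetSum _ hi1) hi2, integral_finsetSum _ hi1,
          integral_const_mul, ← norm_sq_L2]
        simp_rw [hvol]
    _ = M ^ 2 * h ^ 2 * (∑ i ∈ Finset.range n, G i) + (s * ‖u‖) ^ 2 := by
        rw [Finset.mul_sum]
        congr 1
        · exact Finset.sum_congr rfl fun i _ => by ring
        · ring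
    _ ≤ (M * h * ‖g‖) ^ 2 + (s * ‖u‖) ^ 2 := by
        have := mul_le_mul_of_nonneg_left hGsum (show 0 ≤ M ^ 2 * h ^ 2 by positivity)
        nlinarith

/-- The operators Q ∘ (mesh average) ∘ T have finite rank and converge to Q ∘ T in norm: T is
bounded into H¹, where averaging is accurate on fine meshes, and the decay of q controls the tail.
Compact operators are norm closed. -/
theorem isCompactOperator_mul_comp {E : Type*} [NormedAddCommGroup E] [NormedSpace 𝕜 E]
    {Q : L2Half 𝕜 →L[𝕜] L2Half 𝕜} {q : ℝ → ℝ}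
    (hQ : ∀ u, Q u =ᵐ[halfLine] fun x => q x • u x) {M : ℝ} (hM : ∀ x, |q x| ≤ M)
    (hq : Tendsto q atTop (𝓝 0)) {T : E →L[𝕜] L2Half 𝕜}
    (hT : ∀ y, ∃ g, HasWeakDeriv (T y) g ∧ ‖g‖ ≤ ‖y‖) : IsCompactOperator (Q ∘L T) := by
  have hM0 : 0 ≤ M := (abs_nonneg _).trans (hM 0)
  have hmem : Q ∘L T ∈ closure {f : E →L[𝕜] L2Half 𝕜 | IsCompactOperator f} := by
    rw [Metric.mem_closure_iff]
    intro ε hε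
    set D := ‖T‖ + M + 1 with hD
    have hDpos : 0 < D := by positivity
    -- One number serves as mesh width and as tail bound: M s ≤ ε/2 and s ‖T‖ ≤ ε/2, and the squares
    -- add up to ε²/2 ≤ (3ε/4)².
    set s := ε / (2 * D) with hs
    have hspos : 0 < s := by positivity
    obtain ⟨R, hR⟩ : ∃ R : ℝ, ∀ x, R ≤ x → |q x| ≤ s := by
      obtain ⟨R, hR⟩ := (Metric.tendsto_atTop.mp hq) s hspos
      refine ⟨R, fun x hx => ?_⟩
      simpa using (hR x hx).le
    obtain ⟨n, hn⟩ := exists_nat_ge (R / s)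
    have hR' : ∀ x, n * s < x → |q x| ≤ s := fun x hx => hR x (by
      rw [div_le_iff₀ hspos] at hn
      linarith)
    refine ⟨Q ∘L meshAverage 𝕜 s n ∘L T,
      ((isCompactOperator_meshAverage s n).comp_clm T).clm_comp Q, ?_⟩
    rw [dist_eq_norm]
    have hb : ‖Q ∘L T - Q ∘L meshAverage 𝕜 s n ∘L T‖ ≤ ε * (3 / 4) := by
      refine ContinuousLinearMap.opNorm_le_bound _ (by positivity) fun y => ?_
      obtain ⟨g, hg, hgy⟩ := hT y
      have h1 := norm_mul_sub_meshAverage_le hQ hM hspos hR' hg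
      have h2 : M * s * ‖g‖ ≤ ε / 2 * ‖y‖ := by
        have : M * s ≤ ε / 2 := by
          rw [hs, mul_div_assoc', div_le_div_iff₀ (by positivity) (by norm_num)]
          nlinarith [norm_nonneg T]
        exact mul_le_mul this hgy (norm_nonneg _) (by positivity)
      have h3 : s * ‖T y‖ ≤ ε / 2 * ‖y‖ := by
        have h4 : s * ‖T‖ ≤ ε / 2 := by
          rw [hs, div_mul_eq_mul_div, div_le_div_iff₀ (by positivity) (by norm_num)]
          nlinarith [norm_nonneg T]
        calc s * ‖T y‖ ≤ s * (‖T‖ * ‖y‖) := mul_le_mul_of_nonneg_left (T.le_opNorm y) hspos.le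
          _ = s * ‖T‖ * ‖y‖ := by ring
          _ ≤ ε / 2 * ‖y‖ := mul_le_mul_of_nonneg_right h4 (norm_nonneg y)
      change ‖Q (T y) - Q (meshAverage 𝕜 s n (T y))‖ ≤ _
      refine le_of_sq_le_sq ?_ (by positivity)
      have h5 := pow_le_pow_left₀ (by positivity) h2 2
      have h6 := pow_le_pow_left₀ (by positivity) h3 2
      have h7 : 0 ≤ (ε * ‖y‖) ^ 2 := by positivity
      nlinarith
    linarith
  rwa [isClosed_setOfPred_isCompactOperator.closure_eq] at hmem

theorem tendsto_potential {p ω : ℝ} (hp : 1 < p) (hω : 0 < ω) :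
    Tendsto (fun x => phi0 p ω x ^ (p - 1)) atTop (𝓝 0) := by
  simp_rw [phi0_rpow hp hω]
  have hb : 0 < (p - 1) * √ω / 2 := by
    have : 0 < p - 1 := by linarith
    positivity
  have h1 : Tendsto (fun x : ℝ => Real.cosh ((p - 1) * √ω / 2 * x)) atTop atTop := by
    have h2 : Tendsto (fun y : ℝ => Real.cosh y) atTop atTop := by
      refine tendsto_atTop_mono (f := fun y => Real.exp y / 2) (fun y => ?_)
        (Real.tendsto_exp_atTop.atTop_div_const (by norm_num))
      rw [Real.cosh_eq]
      linarith [Real.exp_pos (-y)]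
    exact h2.comp (tendsto_id.const_mul_atTop hb)
  have h3 := ((tendsto_inv_atTop_zero.comp h1).pow 2).const_mul ((p + 1) * ω / 2)
  simpa [one_div] using h3

theorem potentialCLM_ae {p ω : ℝ} (hp : 1 < p) (hω : 0 < ω) (u : L2Half 𝕜) :
    potentialCLM 𝕜 hp hω u =ᵐ[halfLine] fun x => (phi0 p ω x) ^ (p - 1) • u x :=
  potentialMul_ae hp hω u

theorem isCompactOperator_graphPotential_comp {N : ℕ} {p ω : ℝ} (hp : 1 < p) (hω : 0 < ω)
    {B : L2Graph 𝕜 N →L[𝕜] L2Graph 𝕜 N}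
    (hB : ∀ y j, ∃ g, HasWeakDeriv (B y j) g ∧ ‖g‖ ≤ ‖y‖) :
    IsCompactOperator (graphPotential 𝕜 N hp hω ∘L B) := by
  have h : ∑ j, (p : 𝕜) • (edgeIncl 𝕜 N j ∘L potentialCLM 𝕜 hp hω ∘L edgeProj 𝕜 N j ∘L B)
      ∈ compactOperator (RingHom.id 𝕜) (L2Graph 𝕜 N) (L2Graph 𝕜 N) := by
    refine Submodule.sum_mem _ fun j _ => Submodule.smul_mem _ _ ?_
    have hT : ∀ y, ∃ g, HasWeakDeriv ((edgeProj 𝕜 N j ∘L B) y) g ∧ ‖g‖ ≤ ‖y‖ := fun y => hB y j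
    have hc : IsCompactOperator (potentialCLM 𝕜 hp hω ∘L edgeProj 𝕜 N j ∘L B) :=
      isCompactOperator_mul_comp (potentialCLM_ae hp hω) (potential_bound hp hω)
        (tendsto_potential hp hω) hT
    exact hc.clm_comp (edgeIncl 𝕜 N j)
  have e : graphPotential 𝕜 N hp hω ∘L B =
      ∑ j, (p : 𝕜) • (edgeIncl 𝕜 N j ∘L potentialCLM 𝕜 hp hω ∘L edgeProj 𝕜 N j ∘L B) := by
    rw [graphPotential, ContinuousLinearMap.finsetSum_comp]
    simp only [ContinuousLinearMap.smul_comp, ContinuousLinearMap.comp_assoc]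
  rw [e]
  exact h

theorem exists_isRegularizer (𝕜 : Type*) [RCLike 𝕜] {N : ℕ} (hN : N ≠ 0) {p ω : ℝ} (hp : 1 < p)
    (hω : 0 < ω) :
    ∃ B, IsRegularizer (kirchhoffOp 𝕜 N hp hω) ω (graphPotential 𝕜 N hp hω) B := by
  obtain ⟨B, h1, h2, h3, h4⟩ := exists_bounded_inverse hp hω 𝕜 hN
  refine ⟨B, fun y => ?_, fun x => ?_, h3, isCompactOperator_graphPotential_comp hp hω h4⟩
  · obtain ⟨h, e⟩ := h1 y
    exact ⟨h, by rwa [shiftedOp_apply] at e⟩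
  · rw [← shiftedOp_apply, h2]

end Compactness

/-! ### Explicit functions built from the soliton -/

section SolitonCalculus

variable {p ω : ℝ}

/-- The function `tanh ((p-1)√ω x / 2)`. -/
def solTanh (p ω x : ℝ) : ℝ := Real.tanh ((p - 1) * √ω / 2 * x)

/-- The potential `ω - p φ₀^{p-1}` of the linearized operator. -/
def linPotential (p ω x : ℝ) : ℝ := ω - p * phi0 p ω x ^ (p - 1)

/-- The second derivative of `φ₀`. -/
def phi0Second (p ω x : ℝ) : ℝ :=
  phi0 p ω x * (ω - (p + 1) * ω / 2 * (1 - solTanh p ω x ^ 2))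

/-- The ground state `φ₀ sech ((p-1)√ω x / 2)`, which is proportional to `φ₀^{(p+1)/2}`. -/
def groundFun (p ω x : ℝ) : ℝ := 1 / Real.cosh ((p - 1) * √ω / 2 * x) * phi0 p ω x

/-- The logarithmic derivative of `φ₀'`. -/
def riccati (p ω x : ℝ) : ℝ :=
  -(√ω * (1 - (p + 1) / 2 * (1 - solTanh p ω x ^ 2))) / solTanh p ω x

theorem phi0_pos (hp : 1 < p) (hω : 0 < ω) (x : ℝ) : 0 < phi0 p ω x := by
  have : 0 < p + 1 := by linarith
  have hc := Real.cosh_pos ((p - 1) * √ω / 2 * x)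
  exact Real.rpow_pos_of_pos (by positivity) _

/-- Lets everything be expressed through `solTanh`, whose derivative is a polynomial in itself, so
that the differential equations below become algebraic identities. -/
theorem sq_one_div_cosh (p ω x : ℝ) :
    (1 / Real.cosh ((p - 1) * √ω / 2 * x)) ^ 2 = 1 - solTanh p ω x ^ 2 := by
  have hc := (Real.cosh_pos ((p - 1) * √ω / 2 * x)).ne'
  rw [solTanh, Real.tanh_eq_sinh_div_cosh]
  have h := Real.cosh_sq ((p - 1) * √ω / 2 * x)
  generalize (p - 1) * √ω / 2 * x = y at *
  field_simp
  linarith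

theorem linPotential_eq (hp : 1 < p) (hω : 0 < ω) (x : ℝ) :
    linPotential p ω x = ω - p * ((p + 1) * ω / 2 * (1 - solTanh p ω x ^ 2)) := by
  rw [linPotential, phi0_rpow hp hω, sq_one_div_cosh]

theorem continuous_linPotential (hp : 1 < p) (hω : 0 < ω) : Continuous (linPotential p ω) :=
  continuous_const.sub (continuous_const.mul (continuous_potential hp hω))

theorem abs_solTanh_le (p ω x : ℝ) : |solTanh p ω x| ≤ 1 := (Real.abs_tanh_lt_one _).le

theorem hasDerivAt_solTanh (p ω x : ℝ) :
    HasDerivAt (solTanh p ω) ((p - 1) * √ω / 2 * (1 - solTanh p ω x ^ 2)) x := by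
  have hc := (Real.cosh_pos ((p - 1) * √ω / 2 * x)).ne'
  have hl : HasDerivAt (fun y => (p - 1) * √ω / 2 * y) ((p - 1) * √ω / 2) x := by
    simpa using (hasDerivAt_id x).const_mul ((p - 1) * √ω / 2)
  have h := hl.sinh.div hl.cosh hc
  have e : solTanh p ω = (fun y => Real.sinh ((p - 1) * √ω / 2 * y)) /
      fun y => Real.cosh ((p - 1) * √ω / 2 * y) :=
    funext fun y => Real.tanh_eq_sinh_div_cosh _
  rw [← sq_one_div_cosh, e]
  refine h.congr_deriv ?_
  have := Real.cosh_sq ((p - 1) * √ω / 2 * x)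
  generalize (p - 1) * √ω / 2 * x = y at *
  generalize (p - 1) * √ω / 2 = b at *
  field_simp
  rw [this]
  ring

theorem continuous_solTanh (p ω : ℝ) : Continuous (solTanh p ω) :=
  continuous_iff_continuousAt.mpr fun x => (hasDerivAt_solTanh p ω x).continuousAt

theorem hasDerivAt_phi0' (hp : 1 < p) (hω : 0 < ω) (x : ℝ) :
    HasDerivAt (phi0 p ω) (-√ω * solTanh p ω x * phi0 p ω x) x := hasDerivAt_phi0 hp hω x

theorem continuous_phi0 (hp : 1 < p) (hω : 0 < ω) : Continuous (phi0 p ω) :=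
  continuous_iff_continuousAt.mpr fun x => (hasDerivAt_phi0 hp hω x).continuousAt

theorem deriv_phi0_eq (hp : 1 < p) (hω : 0 < ω) :
    deriv (phi0 p ω) = fun x => -√ω * solTanh p ω x * phi0 p ω x :=
  funext fun x => (hasDerivAt_phi0 hp hω x).deriv

theorem hasDerivAt_deriv_phi0 (hp : 1 < p) (hω : 0 < ω) (x : ℝ) :
    HasDerivAt (deriv (phi0 p ω)) (phi0Second p ω x) x := by
  rw [deriv_phi0_eq hp hω]
  have h := ((hasDerivAt_solTanh p ω x).const_mul (-√ω)).mul (hasDerivAt_phi0' hp hω x)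
  refine h.congr_deriv ?_
  rw [phi0Second]
  have hs : √ω ^ 2 = ω := Real.sq_sqrt hω.le
  linear_combination (phi0 p ω x) * (solTanh p ω x ^ 2 - (p - 1) / 2 * (1 - solTanh p ω x ^ 2)) * hs

/-- The differentiated soliton equation φ₀''' = q φ₀': the translation mode φ₀' solves the edge
equation at energy zero. -/
theorem hasDerivAt_phi0Second (hp : 1 < p) (hω : 0 < ω) (x : ℝ) :
    HasDerivAt (phi0Second p ω) (linPotential p ω x * deriv (phi0 p ω) x) x := by
  have h1 : HasDerivAt (fun y => ω - (p + 1) * ω / 2 * (1 - solTanh p ω y ^ 2))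
      ((p + 1) * ω / 2 * (2 * solTanh p ω x * ((p - 1) * √ω / 2 * (1 - solTanh p ω x ^ 2)))) x := by
    have := ((((hasDerivAt_solTanh p ω x).pow 2).const_sub 1).const_mul
      ((p + 1) * ω / 2)).const_sub ω
    refine this.congr_deriv ?_
    push_cast
    ring
  refine ((hasDerivAt_phi0' hp hω x).mul h1).congr_deriv ?_
  rw [linPotential_eq hp hω, deriv_phi0_eq hp hω]
  ring

theorem hasDerivAt_groundFun (hp : 1 < p) (hω : 0 < ω) (x : ℝ) :
    HasDerivAt (groundFun p ω) (-((p + 1) / 2 * √ω) * solTanh p ω x * groundFun p ω x) x := by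
  have hc := (Real.cosh_pos ((p - 1) * √ω / 2 * x)).ne'
  have hl : HasDerivAt (fun y => (p - 1) * √ω / 2 * y) ((p - 1) * √ω / 2) x := by
    simpa using (hasDerivAt_id x).const_mul ((p - 1) * √ω / 2)
  have h1 : HasDerivAt (fun y => 1 / Real.cosh ((p - 1) * √ω / 2 * y))
      (-((p - 1) * √ω / 2) * solTanh p ω x * (1 / Real.cosh ((p - 1) * √ω / 2 * x))) x := by
    have := hl.cosh.inv hc
    simp only [one_div]
    refine this.congr_deriv ?_
    rw [solTanh, Real.tanh_eq_sinh_div_cosh]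
    field_simp
  refine (h1.mul (hasDerivAt_phi0' hp hω x)).congr_deriv ?_
  rw [groundFun]
  ring

/-- The negative eigenvalue `ω - (p+1)²ω/4`. -/
def groundEnergy (p ω : ℝ) : ℝ := ω - (p + 1) ^ 2 * ω / 4

theorem groundEnergy_neg (hp : 1 < p) (hω : 0 < ω) : groundEnergy p ω < 0 := by
  rw [groundEnergy]
  nlinarith [mul_pos hω (show 0 < p - 1 by linarith)]

/-- This is the bottom Pöschl–Teller state: with b = (p-1)√ω/2 the function is a constant times
sech^α(b x), α = (p+1)/(p-1). The potential depth p(p+1)ω/2 equals α(α+1)b², and the energy is ω -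
(αb)². -/
theorem hasDerivAt_deriv_groundFun (hp : 1 < p) (hω : 0 < ω) (x : ℝ) :
    HasDerivAt (fun y => -((p + 1) / 2 * √ω) * solTanh p ω y * groundFun p ω y)
      ((linPotential p ω x - groundEnergy p ω) * groundFun p ω x) x := by
  refine (((hasDerivAt_solTanh p ω x).const_mul _).mul
    (hasDerivAt_groundFun hp hω x)).congr_deriv ?_
  rw [linPotential_eq hp hω, groundEnergy]
  have hs : √ω ^ 2 = ω := Real.sq_sqrt hω.le
  linear_combination groundFun p ω x * ((p + 1) ^ 2 / 4 * solTanh p ω x ^ 2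
    - (p + 1) / 2 * ((p - 1) / 2) * (1 - solTanh p ω x ^ 2)) * hs

theorem solTanh_pos (hp : 1 < p) (hω : 0 < ω) {x : ℝ} (hx : 0 < x) : 0 < solTanh p ω x := by
  have hs : 0 < √ω := Real.sqrt_pos.mpr hω
  have hp' : 0 < p - 1 := by linarith
  rw [solTanh, Real.tanh_eq_sinh_div_cosh]
  exact div_pos (Real.sinh_pos_iff.mpr (by positivity)) (Real.cosh_pos _)

/-- For S = φ₀''/φ₀' the quotient rule gives S' = φ₀'''/φ₀' - S² = q - S². The origin is excluded
because φ₀' vanishes there. -/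
theorem hasDerivAt_riccati (hp : 1 < p) (hω : 0 < ω) {x : ℝ} (hx : 0 < x) :
    HasDerivAt (riccati p ω) (linPotential p ω x - riccati p ω x ^ 2) x := by
  have ht := (solTanh_pos hp hω hx).ne'
  have h1 : HasDerivAt (fun y => -(√ω * (1 - (p + 1) / 2 * (1 - solTanh p ω y ^ 2))))
      (-(√ω * ((p + 1) / 2 * (2 * solTanh p ω x *
        ((p - 1) * √ω / 2 * (1 - solTanh p ω x ^ 2)))))) x := by
    have := (((((hasDerivAt_solTanh p ω x).pow 2).const_sub 1).const_mul
      ((p + 1) / 2)).const_sub 1).const_mul (√ω) |>.neg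
    refine this.congr_deriv ?_
    push_cast
    ring
  refine (h1.div (hasDerivAt_solTanh p ω x) ht).congr_deriv ?_
  rw [linPotential_eq hp hω, riccati]
  have hs : ω = √ω ^ 2 := (Real.sq_sqrt hω.le).symm
  generalize solTanh p ω x = t at *
  generalize √ω = s at *
  subst hs
  field_simp
  ring

/-- Bounds for the denominator of `riccati`. With b = (p-1)√ω/2 the constant b / cosh b works on (0,
1] because sinh(bx) ≥ bx and cosh(bx) ≤ cosh b, and beyond 1 because tanh increases and tanh b ≥ b /
cosh b. -/
theorem exists_solTanh_bounds (hp : 1 < p) (hω : 0 < ω) :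
    ∃ c > 0, (∀ x, 0 < x → x ≤ 1 → c * x ≤ solTanh p ω x) ∧ ∀ x, 1 ≤ x → c ≤ solTanh p ω x := by
  have hs : 0 < √ω := Real.sqrt_pos.mpr hω
  have hp' : 0 < p - 1 := by linarith
  set b := (p - 1) * √ω / 2 with hb
  have hbpos : 0 < b := by positivity
  have hcb := Real.cosh_pos b
  refine ⟨b / Real.cosh b, by positivity, fun x hx hx1 => ?_, fun x hx => ?_⟩
  · rw [solTanh, ← hb, Real.tanh_eq_sinh_div_cosh, div_mul_eq_mul_div]
    refine div_le_div₀ (Real.sinh_nonneg_iff.mpr (by positivity))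
      (Real.self_le_sinh_iff.mpr (by positivity)) (Real.cosh_pos _) ?_
    rw [Real.cosh_le_cosh, abs_of_pos (by positivity), abs_of_pos hbpos]
    nlinarith
  · rw [solTanh, ← hb, Real.tanh_eq_sinh_div_cosh, div_le_div_iff₀ hcb (Real.cosh_pos _)]
    have h1 : 0 ≤ Real.sinh (b * x - b) := Real.sinh_nonneg_iff.mpr (by nlinarith)
    rw [Real.sinh_sub] at h1
    have h2 : b ≤ Real.sinh b := Real.self_le_sinh_iff.mpr hbpos.le
    nlinarith [Real.cosh_pos (b * x)]

/-- The singularity of S at 0 is no worse than 1/x, which functions vanishing linearly at 0 absorb.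
-/
theorem exists_riccati_bounds (hp : 1 < p) (hω : 0 < ω) :
    ∃ C, (∀ x, 0 < x → x ≤ 1 → |riccati p ω x| * x ≤ C) ∧ ∀ x, 1 ≤ x → |riccati p ω x| ≤ C := by
  obtain ⟨c, hc, h1, h2⟩ := exists_solTanh_bounds hp hω
  have hnum : ∀ x, |-(√ω * (1 - (p + 1) / 2 * (1 - solTanh p ω x ^ 2)))| ≤ √ω * (1 + (p + 1)) := by
    intro x
    rw [abs_neg, abs_mul, abs_of_nonneg (Real.sqrt_nonneg ω)]
    refine mul_le_mul_of_nonneg_left ?_ (Real.sqrt_nonneg ω)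
    have h3 := (abs_le.mp (abs_solTanh_le p ω x))
    have h4 : solTanh p ω x ^ 2 ≤ 1 := by nlinarith
    rw [abs_le]
    constructor <;> nlinarith [sq_nonneg (solTanh p ω x)]
  refine ⟨√ω * (1 + (p + 1)) / c, fun x hx hx1 => ?_, fun x hx => ?_⟩
  · have ht := solTanh_pos hp hω hx
    rw [riccati, abs_div, abs_of_pos ht, div_mul_eq_mul_div]
    rw [div_le_div_iff₀ ht hc]
    have := hnum x
    calc _ = |-(√ω * (1 - (p + 1) / 2 * (1 - solTanh p ω x ^ 2)))| * (c * x) := by ring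
      _ ≤ _ := mul_le_mul this (h1 x hx hx1) (by positivity)
          ((abs_nonneg _).trans this)
  · have ht := solTanh_pos hp hω (lt_of_lt_of_le one_pos hx)
    rw [riccati, abs_div, abs_of_pos ht]
    exact div_le_div₀ ((abs_nonneg _).trans (hnum x)) (hnum x) hc (h2 x hx)

end SolitonCalculus

/-! ### Square integrability of the soliton functions -/

section SolitonL2

variable {𝕜 : Type*} [RCLike 𝕜] {p ω : ℝ}

theorem memLp_phi0 (hp : 1 < p) (hω : 0 < ω) : MemLp (phi0 p ω) 2 halfLine := by
  have hs : 0 < √ω := Real.sqrt_pos.mpr hω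
  have hexp : MemLp (fun x => Real.exp (-√ω * x)) 2 halfLine := by
    rw [memLp_two_iff_integrable_sq (by fun_prop)]
    refine (integrableOn_exp_mul_Ioi (a := -(2 * √ω)) (by linarith) 0).congr
      (Eventually.of_forall fun x => ?_)
    change Real.exp (-(2 * √ω) * x) = Real.exp (-√ω * x) ^ 2
    rw [← Real.exp_nat_mul]
    congr 1
    push_cast
    ring
  refine MemLp.of_le_mul (c := ((p + 1) * ω / 2 * 4) ^ (1 / (p - 1))) hexp
    (continuous_phi0 hp hω).aestronglyMeasurable (Eventually.of_forall fun x => ?_)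
  rw [Real.norm_eq_abs, Real.norm_eq_abs, abs_of_pos (Real.exp_pos _)]
  exact phi0_le hp hω x

theorem memLp_mul_phi0 (hp : 1 < p) (hω : 0 < ω) {m : ℝ → ℝ} (hm : Continuous m) {M : ℝ}
    (hM : ∀ x, |m x| ≤ M) : MemLp (fun x => ((m x * phi0 p ω x : ℝ) : 𝕜)) 2 halfLine := by
  have h : MemLp (fun x => m x * phi0 p ω x) 2 halfLine :=
    MemLp.of_le_mul (c := M) (memLp_phi0 hp hω)
      (hm.mul (continuous_phi0 hp hω)).aestronglyMeasurable (Eventually.of_forall fun x => by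
        rw [norm_mul, Real.norm_eq_abs]
        exact mul_le_mul_of_nonneg_right (hM x) (norm_nonneg _))
  exact h.ofReal

theorem abs_one_sub_sq_solTanh_le (p ω x : ℝ) : |1 - solTanh p ω x ^ 2| ≤ 1 := by
  have h := abs_le.mp (abs_solTanh_le p ω x)
  rw [abs_le]
  constructor <;> nlinarith

theorem memLp_phi0Second (hp : 1 < p) (hω : 0 < ω) :
    MemLp (fun x => ((phi0Second p ω x : ℝ) : 𝕜)) 2 halfLine := by
  have h := memLp_mul_phi0 (𝕜 := 𝕜) hp hω
    (m := fun x => ω - (p + 1) * ω / 2 * (1 - solTanh p ω x ^ 2))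
    (by have := continuous_solTanh p ω; fun_prop) (M := ω + (p + 1) * ω / 2 * 1) (fun x => by
      have hC : 0 ≤ (p + 1) * ω / 2 := by
        have : 0 < p + 1 := by linarith
        positivity
      refine (abs_sub _ _).trans ?_
      rw [abs_of_pos hω, abs_mul, abs_of_nonneg hC]
      linarith [mul_le_mul_of_nonneg_left (abs_one_sub_sq_solTanh_le p ω x) hC])
  refine (memLp_congr_ae (Eventually.of_forall fun x => ?_)).mp h
  simp only [phi0Second, mul_comm]

theorem abs_linPotential_le (hp : 1 < p) (hω : 0 < ω) (x : ℝ) :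
    |linPotential p ω x| ≤ ω + p * ((p + 1) * ω / 2) := by
  refine (abs_sub _ _).trans ?_
  rw [abs_of_pos hω, abs_mul, abs_of_pos (by linarith)]
  linarith [mul_le_mul_of_nonneg_left (potential_bound hp hω x) (by linarith : (0 : ℝ) ≤ p)]

theorem memLp_linPotential_mul (hp : 1 < p) (hω : 0 < ω) {f : ℝ → 𝕜} (hf : MemLp f 2 halfLine)
    (c : ℝ) : MemLp (fun x => (linPotential p ω x - c) • f x) 2 halfLine := by
  refine MemLp.of_le_mul (c := ω + p * ((p + 1) * ω / 2) + |c|) hf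
    (((continuous_linPotential hp hω).sub continuous_const).aestronglyMeasurable.smul hf.1)
    (Eventually.of_forall fun x => ?_)
  rw [norm_smul, Real.norm_eq_abs]
  exact mul_le_mul_of_nonneg_right
    ((abs_sub _ _).trans (by linarith [abs_linPotential_le hp hω x])) (norm_nonneg _)

theorem continuous_one_div_cosh (c : ℝ) : Continuous fun x => 1 / Real.cosh (c * x) :=
  continuous_const.div (Real.continuous_cosh.comp (by fun_prop)) fun _ => (Real.cosh_pos _).ne'

theorem abs_one_div_cosh_le (y : ℝ) : |1 / Real.cosh y| ≤ 1 := by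
  rw [abs_of_pos (by positivity [Real.cosh_pos y]), div_le_one (Real.cosh_pos _)]
  exact Real.one_le_cosh _

theorem memLp_groundFun (hp : 1 < p) (hω : 0 < ω) :
    MemLp (fun x => ((groundFun p ω x : ℝ) : 𝕜)) 2 halfLine :=
  memLp_mul_phi0 hp hω (continuous_one_div_cosh _) fun _ => abs_one_div_cosh_le _

theorem memLp_deriv_groundFun (hp : 1 < p) (hω : 0 < ω) :
    MemLp (fun x => ((-((p + 1) / 2 * √ω) * solTanh p ω x * groundFun p ω x : ℝ) : 𝕜)) 2
      halfLine := by
  have h := memLp_mul_phi0 (𝕜 := 𝕜) hp hω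
    (m := fun x => -((p + 1) / 2 * √ω) * solTanh p ω x * (1 / Real.cosh ((p - 1) * √ω / 2 * x)))
    ((continuous_const.mul (continuous_solTanh p ω)).mul (continuous_one_div_cosh _))
    (M := |(-((p + 1) / 2 * √ω))| * 1 * 1) (fun x => by
      rw [abs_mul, abs_mul]
      gcongr
      · exact abs_solTanh_le p ω x
      · exact abs_one_div_cosh_le _)
  refine (memLp_congr_ae (Eventually.of_forall fun x => ?_)).mp h
  simp only [groundFun, mul_assoc]

end SolitonL2

/-! ### Classical solutions on the half-line -/

section Classical

variable {𝕜 : Type*} [RCLike 𝕜]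

/-- `f` is a solution of `-f'' + q f = k` on `(0, ∞)` with derivative `f₁`; the functions are square
integrable and continuous up to `0`. -/
structure IsSol (q : ℝ → ℝ) (f f₁ k : ℝ → 𝕜) : Prop where
  memLp : MemLp f 2 halfLine
  memLp_deriv : MemLp f₁ 2 halfLine
  memLp_rhs : MemLp k 2 halfLine
  cont : ContinuousOn f (Ici 0)
  cont_deriv : ContinuousOn f₁ (Ici 0)
  cont_rhs : ContinuousOn k (Ici 0)
  hasDerivAt : ∀ x, 0 < x → HasDerivAt f (f₁ x) x
  hasDerivAt_deriv : ∀ x, 0 < x → HasDerivAt f₁ (q x • f x - k x) x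

variable {q S : ℝ → ℝ} {f f₁ k g g₁ l : ℝ → 𝕜}

/-- A right-hand side is allowed in `IsSol` because a combination of eigenfunctions with different
eigenvalues is no longer an eigenfunction. -/
theorem IsSol.sub_smul (hf : IsSol q f f₁ k) (hg : IsSol q g g₁ l) (c : 𝕜) :
    IsSol q (f - c • g) (f₁ - c • g₁) (k - c • l) where
  memLp := hf.memLp.sub (hg.memLp.const_smul c)
  memLp_deriv := hf.memLp_deriv.sub (hg.memLp_deriv.const_smul c)
  memLp_rhs := hf.memLp_rhs.sub (hg.memLp_rhs.const_smul c)
  cont := hf.cont.sub (hg.cont.const_smul c)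
  cont_deriv := hf.cont_deriv.sub (hg.cont_deriv.const_smul c)
  cont_rhs := hf.cont_rhs.sub (hg.cont_rhs.const_smul c)
  hasDerivAt x hx := (hf.hasDerivAt x hx).sub ((hg.hasDerivAt x hx).const_smul c)
  hasDerivAt_deriv x hx := by
    refine ((hf.hasDerivAt_deriv x hx).sub
      ((hg.hasDerivAt_deriv x hx).const_smul c)).congr_deriv ?_
    simp only [Pi.sub_apply, Pi.smul_apply, smul_eq_mul, RCLike.real_smul_eq_coe_mul]
    ring

theorem hasDerivAt_primitive {r : ℝ → 𝕜} (hr : ContinuousOn r (Ici 0)) {x : ℝ} (hx : 0 < x) :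
    HasDerivAt (fun y => ∫ t in (0 : ℝ)..y, r t) (r x) x := by
  refine intervalIntegral.integral_hasDerivAt_right ?_ ?_ ?_
  · refine ContinuousOn.intervalIntegrable (hr.mono ?_)
    rw [uIcc_of_le hx.le]
    exact fun y hy => hy.1
  · exact (hr.mono Ioi_subset_Ici_self).stronglyMeasurableAtFilter isOpen_Ioi x hx
  · exact hr.continuousAt (Ici_mem_nhds hx)

/-- Regularity bootstrap: primitives serve as representatives, and the equation identifies `h`
almost everywhere with a continuous function, so its primitive is classically differentiable. -/
theorem isSol_of_hasWeakDeriv (hq : Continuous q) {u v h : L2Half 𝕜} {c d : 𝕜}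
    (z : 𝕜) (hu : HasWeakDeriv u v) (hv : HasWeakDeriv v h) (tu : HasTrace u c)
    (tv : HasTrace v d) (hh : h =ᵐ[halfLine] fun x => q x • u x - z * u x) :
    ∃ f f₁ : ℝ → 𝕜, IsSol q f f₁ (z • f) ∧ u =ᵐ[halfLine] f ∧ f 0 = c ∧ f₁ 0 = d := by
  have eu := hu.ae_eq_primitive tu
  have ev := hv.ae_eq_primitive tv
  set f : ℝ → 𝕜 := fun x => c + ∫ t in (0 : ℝ)..x, v t with hf
  set f₁ : ℝ → 𝕜 := fun x => d + ∫ t in (0 : ℝ)..x, h t with hf₁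
  have cf : ContinuousOn f (Ici 0) := continuousOn_const.add (continuousOn_primitive_L2 v)
  have cf₁ : ContinuousOn f₁ (Ici 0) := continuousOn_const.add (continuousOn_primitive_L2 h)
  have mf : MemLp f 2 halfLine := memLp_primitive eu
  have cr : ContinuousOn (fun x => q x • f x - (z • f) x) (Ici 0) :=
    (hq.continuousOn.smul cf).sub (cf.const_smul z)
  have congr : ∀ {a b : ℝ → 𝕜}, a =ᵐ[halfLine] b → ∀ x : ℝ, 0 < x →
      ∫ t in (0 : ℝ)..x, a t = ∫ t in (0 : ℝ)..x, b t := by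
    intro a b hab x hx
    rw [intervalIntegral.integral_of_le hx.le, intervalIntegral.integral_of_le hx.le]
    exact integral_congr_ae (ae_restrict_of_ae_restrict_of_subset Ioc_subset_Ioi_self hab)
  refine ⟨f, f₁, ⟨mf, memLp_primitive ev, mf.const_smul z, cf, cf₁, cf.const_smul z,
    fun x hx => ?_, fun x hx => ?_⟩, eu, by simp [hf], by simp [hf₁]⟩
  · refine ((hasDerivAt_primitive cf₁ hx).const_add c).congr_of_eventuallyEq ?_
    filter_upwards [Ioi_mem_nhds hx] with y hy
    rw [hf, ← congr ev y hy]
  · refine ((hasDerivAt_primitive cr hx).const_add d).congr_of_eventuallyEq ?_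
    filter_upwards [Ioi_mem_nhds hx] with y hy
    have : h =ᵐ[halfLine] fun x => q x • f x - (z • f) x := by
      filter_upwards [hh, eu] with t h1 h2
      rw [h1, h2, Pi.smul_apply, smul_eq_mul]
    rw [hf₁, ← congr this y hy]

theorem integrable_inner_of_memLp (hf : MemLp f 2 halfLine) (hg : MemLp g 2 halfLine) :
    Integrable (fun x => inner 𝕜 (f x) (g x)) halfLine := by
  have h := hg.integrable_mul (p := 2) (q := 2) hf.star
  refine h.congr (Eventually.of_forall fun x => ?_)
  exact (RCLike.inner_apply _ _).symm

/-- Since f is the integral of the bounded f₁ from 0, it vanishes linearly, which beats the 1/x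
singularity of S. -/
theorem IsSol.exists_norm_le (hf : IsSol q f f₁ k) (h0 : f 0 = 0) :
    ∃ M, ∀ x ∈ Icc (0 : ℝ) 1, ‖f₁ x‖ ≤ M ∧ ‖f x‖ ≤ M * x := by
  obtain ⟨M, hM⟩ := isCompact_Icc.exists_bound_of_continuousOn
    (hf.cont_deriv.mono (Icc_subset_Ici_self : Icc (0 : ℝ) 1 ⊆ Ici 0))
  refine ⟨M, fun x hx => ⟨hM x hx, ?_⟩⟩
  have h := intervalIntegral.integral_eq_sub_of_hasDerivAt_of_le hx.1
    (hf.cont.mono Icc_subset_Ici_self) (fun y hy => hf.hasDerivAt y hy.1)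
    (intervalIntegrable_of_memLp hf.memLp_deriv le_rfl hx.1)
  rw [h0, sub_zero] at h
  have h' := intervalIntegral.norm_integral_le_of_norm_le_const (a := 0) (b := x) (f := f₁) (C := M)
    fun y hy => by
      rw [uIoc_of_le hx.1] at hy
      exact hM y ⟨hy.1.le, hy.2.trans hx.2⟩
  rwa [h, sub_zero, abs_of_nonneg hx.1] at h'

/-- Jacobi's form of the second variation: a solution `S` of the Riccati equation `S' = q - S²`
makes the quadratic form of `-d²/dx² + q` nonnegative on functions vanishing at `0`. -/
theorem IsSol.integral_inner_nonneg (hf : IsSol q f f₁ k) (h0 : f 0 = 0)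
    (hS : ∀ x, 0 < x → HasDerivAt S (q x - S x ^ 2) x) {C : ℝ}
    (hS0 : ∀ x, 0 < x → x ≤ 1 → |S x| * x ≤ C) (hS1 : ∀ x, 1 ≤ x → |S x| ≤ C) :
    0 ≤ ∫ x in Ioi (0 : ℝ), RCLike.re (inner 𝕜 (f x) (k x)) := by
  set r : ℝ → ℝ := fun x => RCLike.re (inner 𝕜 (f x) (k x)) with hr
  -- By the Riccati equation F' = ‖f₁ - S f‖² - r. The claim follows once F is known to vanish at
  -- both ends.
  set F : ℝ → ℝ := fun x => RCLike.re (inner 𝕜 (f x) (f₁ x)) - S x * ‖f x‖ ^ 2 with hF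
  have cr : ContinuousOn r (Ici 0) := RCLike.continuous_re.comp_continuousOn (hf.cont.inner hf.cont_rhs)
  have ir : IntegrableOn r (Ioi 0) := (integrable_inner_of_memLp hf.memLp hf.memLp_rhs).re
  have dF : ∀ x, 0 < x → HasDerivAt F (‖f₁ x - S x • f x‖ ^ 2 - r x) x := by
    intro x hx
    have h1 := (hf.hasDerivAt x hx).inner 𝕜 (hf.hasDerivAt_deriv x hx)
    have h2 := (RCLike.reCLM (K := 𝕜)).hasFDerivAt.comp_hasDerivAt x h1
    have h3 := (RCLike.reCLM (K := 𝕜)).hasFDerivAt.comp_hasDerivAt x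
      ((hf.hasDerivAt x hx).inner 𝕜 (hf.hasDerivAt x hx))
    have h4 := h2.sub ((hS x hx).mul h3)
    have e : F = (RCLike.reCLM (K := 𝕜) ∘ fun t => inner 𝕜 (f t) (f₁ t)) -
        S * (RCLike.reCLM (K := 𝕜) ∘ fun t => inner 𝕜 (f t) (f t)) := by
      ext t
      change _ = RCLike.re (inner 𝕜 (f t) (f₁ t)) - S t * RCLike.re (inner 𝕜 (f t) (f t))
      rw [inner_self_eq_norm_sq]
    rw [e]
    refine h4.congr_deriv ?_
    have e1 : inner 𝕜 (f x) (q x • f x - k x) = q x * inner 𝕜 (f x) (f x) - inner 𝕜 (f x) (k x) := by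
      rw [inner_sub_right, RCLike.real_smul_eq_coe_smul (K := 𝕜), inner_smul_right]
    have e2 : RCLike.re (inner 𝕜 (f₁ x) (f x)) = RCLike.re (inner 𝕜 (f x) (f₁ x)) :=
      inner_re_symm _ _
    have e3 : RCLike.re (inner 𝕜 (f x) (f x)) = ‖f x‖ ^ 2 := inner_self_eq_norm_sq _
    have e4 : RCLike.re (inner 𝕜 (f₁ x) (f₁ x)) = ‖f₁ x‖ ^ 2 := inner_self_eq_norm_sq _
    have e5 : ‖f₁ x - S x • f x‖ ^ 2 = ‖f₁ x‖ ^ 2 - 2 * S x * RCLike.re (inner 𝕜 (f x) (f₁ x))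
        + S x ^ 2 * ‖f x‖ ^ 2 := by
      rw [RCLike.real_smul_eq_coe_smul (K := 𝕜), norm_sub_sq (𝕜 := 𝕜), inner_smul_right,
        RCLike.re_ofReal_mul, e2, norm_smul, RCLike.norm_ofReal, mul_pow, sq_abs]
      ring
    rw [e5, e1]
    simp only [RCLike.reCLM_apply, map_add, map_sub, RCLike.re_ofReal_mul, e2, e3, e4,
      Function.comp_apply, hr]
    ring
  have sm : AEStronglyMeasurable S halfLine :=
    ContinuousOn.aestronglyMeasurable (fun x hx => (hS x hx).continuousAt.continuousWithinAt)
      measurableSet_Ioi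
  -- Near 0 both terms are O(x): f is O(x), f₁ is bounded, and S is O(1/x).
  have zero_lim : Tendsto F (𝓝[>] 0) (𝓝 0) := by
    obtain ⟨M, hM⟩ := hf.exists_norm_le h0
    have hb : ∀ x ∈ Ioc (0 : ℝ) 1, ‖F x‖ ≤ (M * M + C * (M * M)) * x := by
      intro x hx
      obtain ⟨h1, h2⟩ := hM x ⟨hx.1.le, hx.2⟩
      have h3 : |RCLike.re (inner 𝕜 (f x) (f₁ x))| ≤ M * x * M :=
        (RCLike.abs_re_le_norm _).trans ((norm_inner_le_norm _ _).trans
          (mul_le_mul h2 h1 (norm_nonneg _) ((norm_nonneg _).trans h2)))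
      have h4 : |S x * ‖f x‖ ^ 2| ≤ C * (M * M) * x := by
        rw [abs_mul, abs_of_nonneg (sq_nonneg ‖f x‖)]
        calc |S x| * ‖f x‖ ^ 2 ≤ |S x| * (M * x) ^ 2 := by gcongr
          _ = |S x| * x * (M * M * x) := by ring
          _ ≤ C * (M * M * x) := by
              refine mul_le_mul_of_nonneg_right (hS0 x hx.1 hx.2) ?_
              exact mul_nonneg (mul_self_nonneg M) hx.1.le
          _ = _ := by ring
      rw [Real.norm_eq_abs]
      calc |F x| ≤ _ := abs_sub _ _
        _ ≤ M * x * M + C * (M * M) * x := add_le_add h3 h4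
        _ = _ := by ring
    refine squeeze_zero_norm' (a := fun x => (M * M + C * (M * M)) * x) ?_ ?_
    · filter_upwards [Ioc_mem_nhdsGT one_pos] with x hx using hb x hx
    · have : Tendsto (fun x => (M * M + C * (M * M)) * x) (𝓝 0) (𝓝 ((M * M + C * (M * M)) * 0)) :=
        (continuous_const.mul continuous_id).tendsto 0
      rw [mul_zero] at this
      exact this.mono_left nhdsWithin_le_nhds
  -- Beyond 1 the function S is bounded, so F and F' are both integrable there, which forces F to
  -- tend to 0.
  have top_lim : Tendsto F atTop (𝓝 0) := by
    have hle : volume.restrict (Ioi (1 : ℝ)) ≤ halfLine :=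
      Measure.restrict_mono (Ioi_subset_Ioi zero_le_one) le_rfl
    have mS : ∀ {g : ℝ → 𝕜}, MemLp g 2 halfLine →
        MemLp (fun x => S x • g x) 2 (volume.restrict (Ioi (1 : ℝ))) := by
      intro g hg
      refine MemLp.of_le_mul (c := C) (hg.mono_measure hle)
        ((sm.mono_measure hle).smul (hg.1.mono_measure hle)) ?_
      filter_upwards [ae_restrict_mem measurableSet_Ioi] with x hx
      rw [norm_smul, Real.norm_eq_abs]
      exact mul_le_mul_of_nonneg_right (hS1 x (le_of_lt hx)) (norm_nonneg _)
    refine tendsto_zero_of_hasDerivAt_of_integrableOn_Ioi (a := 1)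
      (fun x hx => dF x (one_pos.trans hx)) ?_ ?_
    · have h1 : MemLp (fun x => f₁ x - S x • f x) 2 (volume.restrict (Ioi (1 : ℝ))) :=
        (hf.memLp_deriv.mono_measure hle).sub (mS hf.memLp)
      exact h1.norm.integrable_sq.sub (Integrable.mono_measure ir hle)
    · have h1 : Integrable (fun x => RCLike.re (inner 𝕜 (f x) (f₁ x)))
          (volume.restrict (Ioi (1 : ℝ))) :=
        ((integrable_inner_of_memLp hf.memLp hf.memLp_deriv).re).mono_measure hle
      refine h1.sub ?_
      have h2 : Integrable (fun x => ‖f x‖ ^ 2) (volume.restrict (Ioi (1 : ℝ))) :=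
        hf.memLp.norm.integrable_sq.mono_measure hle
      refine (h2.norm.const_mul C).mono' ((sm.mono_measure hle).mul h2.1) ?_
      filter_upwards [ae_restrict_mem measurableSet_Ioi] with x hx
      rw [norm_mul, Real.norm_eq_abs]
      exact mul_le_mul_of_nonneg_right (hS1 x (le_of_lt hx)) (norm_nonneg _)
  -- G has the nonnegative derivative ‖f₁ - S f‖² and runs from 0 to the integral of r.
  set G : ℝ → ℝ := fun x => F x + ∫ t in (0 : ℝ)..x, r t with hG
  have dG : ∀ x, 0 < x → HasDerivAt G (‖f₁ x - S x • f x‖ ^ 2) x := by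
    intro x hx
    refine ((dF x hx).add (hasDerivAt_primitive cr hx)).congr_deriv ?_
    ring
  have mono : MonotoneOn G (Ioi 0) := by
    refine monotoneOn_of_deriv_nonneg (convex_Ioi 0)
      (fun x hx => (dG x hx).continuousAt.continuousWithinAt) ?_ ?_
    · rw [interior_Ioi]
      exact fun x hx => (dG x hx).differentiableAt.differentiableWithinAt
    · rw [interior_Ioi]
      intro x hx
      rw [(dG x hx).deriv]
      positivity
  have G0 : Tendsto G (𝓝[>] 0) (𝓝 0) := by
    have h1 : ContinuousOn (fun x => ∫ t in (0 : ℝ)..x, r t) (Icc 0 1) := by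
      have := intervalIntegral.continuousOn_primitive_interval (μ := volume) (a := 0) (b := 1)
        (f := r) (by
          rw [uIcc_of_le zero_le_one]
          exact (cr.mono Icc_subset_Ici_self).integrableOn_Icc)
      rwa [uIcc_of_le zero_le_one] at this
    have h2 := (h1 0 ⟨le_rfl, zero_le_one⟩).tendsto
    rw [intervalIntegral.integral_same] at h2
    have h3 : 𝓝[>] (0 : ℝ) ≤ 𝓝[Icc 0 1] 0 := by
      rw [← nhdsWithin_Ioc_eq_nhdsGT (one_pos : (0 : ℝ) < 1)]
      exact nhdsWithin_mono _ Ioc_subset_Icc_self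
    simpa using zero_lim.add (h2.mono_left h3)
  have Gtop : Tendsto G atTop (𝓝 (∫ x in Ioi (0 : ℝ), r x)) := by
    simpa using top_lim.add (intervalIntegral_tendsto_integral_Ioi 0 ir tendsto_id)
  refine ge_of_tendsto Gtop ?_
  filter_upwards [Ioi_mem_atTop 0] with y hy
  refine le_of_tendsto G0 ?_
  filter_upwards [Ioc_mem_nhdsGT hy] with x hx
  exact mono hx.1 hy hx.2

end Classical

/-! ### Eigenvectors of the Kirchhoff operator -/

section Eigenvectors

variable {𝕜 : Type*} [RCLike 𝕜] {N : ℕ} {p ω : ℝ} (hp : 1 < p) (hω : 0 < ω)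

theorem eq_iff_ae_linPotential {z : 𝕜} {u h : L2Half 𝕜} :
    h = (ω : 𝕜) • u - (p : 𝕜) • potentialMul hp hω u - z • u ↔
      h =ᵐ[halfLine] fun x => linPotential p ω x • u x - z * u x := by
  have key : ((ω : 𝕜) • u - (p : 𝕜) • potentialMul hp hω u - z • u : L2Half 𝕜) =ᵐ[halfLine]
      fun x => linPotential p ω x • u x - z * u x := by
    filter_upwards [Lp.coeFn_sub ((ω : 𝕜) • u - (p : 𝕜) • potentialMul hp hω u) (z • u),
      Lp.coeFn_sub ((ω : 𝕜) • u) ((p : 𝕜) • potentialMul hp hω u), Lp.coeFn_smul (ω : 𝕜) u,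
      Lp.coeFn_smul (p : 𝕜) (potentialMul hp hω u), Lp.coeFn_smul z u,
      potentialMul_ae hp hω u] with x h1 h2 h3 h4 h5 h6
    rw [h1, Pi.sub_apply, h2, Pi.sub_apply, h3, h4, h5, Pi.smul_apply, Pi.smul_apply,
      Pi.smul_apply, h6, linPotential]
    simp only [smul_eq_mul, RCLike.real_smul_eq_coe_mul]
    push_cast
    ring
  exact ⟨fun e => e ▸ key, fun e => Lp.ext (e.trans key.symm)⟩

/-- All explicit vectors have one profile u on every edge, with weights c_j. The hypotheses cover
three cases: φ₀' (a = 0, ∑ c_j = 0), the ground state (b = 0, constant weights) and truncated waves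
(a = b = 0). -/
theorem kirchhoffOp_smul_of_weakDeriv {a b : 𝕜} {u g h : L2Half 𝕜} (hu : HasWeakDeriv u g)
    (hg : HasWeakDeriv g h) (ta : HasTrace u a) (tb : HasTrace g b) (c : Fin N → 𝕜)
    (hc : ∀ i j, c i * a = c j * a) (hs : (∑ j, c j) * b = 0) :
    ∃ hdom : (WithLp.toLp 2 fun j => c j • u : L2Graph 𝕜 N) ∈ (kirchhoffOp 𝕜 N hp hω).domain,
      kirchhoffOp 𝕜 N hp hω ⟨_, hdom⟩ = WithLp.toLp 2 fun j =>
        c j • ((ω : 𝕜) • u - (p : 𝕜) • potentialMul hp hω u - h) := by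
  have h2 : ∀ j, HasSecondWeakDeriv (c j • u) (c j • h) := fun j => ⟨_, hu.smul _, hg.smul _⟩
  have hdom : (WithLp.toLp 2 fun j => c j • u : L2Graph 𝕜 N) ∈ kirchhoffDomain 𝕜 N := by
    refine ⟨fun j => ⟨_, h2 j⟩, ?_, fun j => c j • b, fun j => ⟨_, hu.smul _, tb.smul _⟩, ?_⟩
    · rcases isEmpty_or_nonempty (Fin N) with _ | ⟨⟨i⟩⟩
      · exact ⟨0, isEmptyElim⟩
      · exact ⟨c i * a, fun j => hc j i ▸ ta.smul (c j)⟩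
    · rwa [← Finset.sum_smul]
  refine ⟨hdom, ?_⟩
  ext1 j
  rw [kirchhoffOp_apply hp hω ⟨_, hdom⟩ j (h2 j)]
  change _ + _ • (c j • u) - _ • potentialMul hp hω (c j • u) = c j • (_ - _ - h)
  rw [map_smul]
  module

theorem mem_eigenspace_of_weakDeriv {z a b : 𝕜} {u g h : L2Half 𝕜} (hu : HasWeakDeriv u g)
    (hg : HasWeakDeriv g h) (ta : HasTrace u a) (tb : HasTrace g b)
    (hh : h =ᵐ[halfLine] fun x => linPotential p ω x • u x - z * u x) (c : Fin N → 𝕜)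
    (hc : ∀ i j, c i * a = c j * a) (hs : (∑ j, c j) * b = 0) :
    (WithLp.toLp 2 fun j => c j • u : L2Graph 𝕜 N) ∈ eigenspace (kirchhoffOp 𝕜 N hp hω) z := by
  obtain ⟨hdom, e⟩ := kirchhoffOp_smul_of_weakDeriv hp hω hu hg ta tb c hc hs
  refine ⟨hdom, e.trans ?_⟩
  ext1 j
  change c j • (_ - _ - h) = z • (c j • u)
  rw [(eq_iff_ae_linPotential hp hω).mpr hh]
  module

theorem exists_hasSecondWeakDeriv_of_mem_eigenspace {z : 𝕜} {U : L2Graph 𝕜 N}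
    (hU : U ∈ eigenspace (kirchhoffOp 𝕜 N hp hω) z) (j : Fin N) :
    ∃ g h : L2Half 𝕜, HasWeakDeriv (U j) g ∧ HasWeakDeriv g h ∧
      h =ᵐ[halfLine] fun x => linPotential p ω x • U j x - z * U j x := by
  obtain ⟨hdom, e⟩ := hU
  obtain ⟨h, g, hg, hh⟩ := hdom.1 j
  refine ⟨g, h, hg, hh, (eq_iff_ae_linPotential hp hω).mp ?_⟩
  have e' : z • U j = kirchhoffOp 𝕜 N hp hω ⟨U, hdom⟩ j := by rw [e]; rfl
  rw [kirchhoffOp_apply hp hω ⟨U, hdom⟩ j ⟨g, hg, hh⟩] at e'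
  rw [e']
  module

theorem exists_isSol_of_mem_eigenspace {z a : 𝕜} {U : L2Graph 𝕜 N}
    (hU : U ∈ eigenspace (kirchhoffOp 𝕜 N hp hω) z) (j : Fin N) (ha : HasTrace (U j) a) :
    ∃ f f₁ : ℝ → 𝕜, IsSol (linPotential p ω) f f₁ (z • f) ∧ U j =ᵐ[halfLine] f ∧ f 0 = a := by
  obtain ⟨g, h, hg, hh, e⟩ := exists_hasSecondWeakDeriv_of_mem_eigenspace hp hω hU j
  obtain ⟨d, hd⟩ := hh.exists_hasTrace
  obtain ⟨f, f₁, hs, h1, h2, -⟩ :=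
    isSol_of_hasWeakDeriv (continuous_linPotential hp hω) z hg hh ha hd e
  exact ⟨f, f₁, hs, h1, h2⟩

/-! #### The kernel -/

/-- `φ₀''` as an element of `L²(0, ∞)`. -/
def phi0SecondLp (𝕜 : Type*) [RCLike 𝕜] {p ω : ℝ} (hp : 1 < p) (hω : 0 < ω) : L2Half 𝕜 :=
  (memLp_phi0Second hp hω).toLp (fun x => ((phi0Second p ω x : ℝ) : 𝕜))

theorem continuous_phi0Second (hp : 1 < p) (hω : 0 < ω) : Continuous (phi0Second p ω) :=
  continuous_iff_continuousAt.mpr fun x => (hasDerivAt_phi0Second hp hω x).continuousAt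

theorem continuous_deriv_phi0 (hp : 1 < p) (hω : 0 < ω) : Continuous (deriv (phi0 p ω)) :=
  continuous_iff_continuousAt.mpr fun x => (hasDerivAt_deriv_phi0 hp hω x).continuousAt

theorem hasWeakDeriv_phi0Deriv : HasWeakDeriv (phi0Deriv 𝕜 hp hω) (phi0SecondLp 𝕜 hp hω) :=
  hasWeakDeriv_toLp (fun x => hasDerivAt_ofReal (hasDerivAt_deriv_phi0 hp hω x))
    (RCLike.continuous_ofReal.comp (continuous_phi0Second hp hω)) _ _

theorem hasTrace_phi0Deriv : HasTrace (phi0Deriv 𝕜 hp hω) 0 := by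
  have h := hasTrace_toLp (RCLike.continuous_ofReal.comp (continuous_deriv_phi0 hp hω))
    (memLp_deriv_phi0 (𝕜 := 𝕜) hp hω)
  have h0 : deriv (phi0 p ω) 0 = 0 := by
    rw [deriv_phi0_eq hp hω]
    simp [solTanh]
  rwa [Function.comp_apply, h0, RCLike.ofReal_zero] at h

theorem hasTrace_phi0SecondLp :
    HasTrace (phi0SecondLp 𝕜 hp hω) ((phi0Second p ω 0 : ℝ) : 𝕜) :=
  hasTrace_toLp (RCLike.continuous_ofReal.comp (continuous_phi0Second hp hω))
    (memLp_phi0Second (𝕜 := 𝕜) hp hω)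

theorem phi0Second_zero_ne (hp : 1 < p) (hω : 0 < ω) : phi0Second p ω 0 ≠ 0 := by
  refine mul_ne_zero (phi0_pos hp hω 0).ne' ?_
  have : solTanh p ω 0 = 0 := by simp [solTanh]
  rw [this]
  nlinarith [mul_pos hω (show 0 < p - 1 by linarith)]

/-- The trace of φ₀' is 0 and detects nothing; the trace of its derivative, φ₀''(0), does. -/
theorem phi0Deriv_ne_zero : phi0Deriv 𝕜 hp hω ≠ 0 := by
  intro h
  have h1 := hasWeakDeriv_phi0Deriv (𝕜 := 𝕜) hp hω
  rw [h] at h1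
  have h2 := hasTrace_phi0SecondLp (𝕜 := 𝕜) hp hω
  rw [h1.unique HasWeakDeriv.zero] at h2
  exact phi0Second_zero_ne hp hω (by exact_mod_cast h2.unique HasTrace.zero)

/-- The vector with the components `c_j φ₀'`. -/
def kernelMap (𝕜 : Type*) [RCLike 𝕜] (N : ℕ) {p ω : ℝ} (hp : 1 < p) (hω : 0 < ω) :
    (Fin N → 𝕜) →ₗ[𝕜] L2Graph 𝕜 N where
  toFun c := WithLp.toLp 2 fun j => c j • phi0Deriv 𝕜 hp hω
  map_add' c d := by
    ext1 j
    exact add_smul _ _ _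
  map_smul' a c := by
    ext1 j
    exact mul_smul _ _ _

theorem kernelMap_injective : Function.Injective (kernelMap 𝕜 N hp hω) := by
  intro c d h
  ext j
  have h' : c j • phi0Deriv 𝕜 hp hω = d j • phi0Deriv 𝕜 hp hω :=
    congrArg (fun U : L2Graph 𝕜 N => U j) h
  exact smul_left_injective 𝕜 (phi0Deriv_ne_zero hp hω) h'

theorem kernelMap_mem_eigenspace {c : Fin N → 𝕜} (hc : ∑ j, c j = 0) :
    kernelMap 𝕜 N hp hω c ∈ eigenspace (kirchhoffOp 𝕜 N hp hω) 0 := by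
  have m := memLp_linPotential_mul hp hω (memLp_deriv_phi0 (𝕜 := 𝕜) hp hω) 0
  refine mem_eigenspace_of_weakDeriv hp hω (h := m.toLp _) (hasWeakDeriv_phi0Deriv hp hω)
    (hasWeakDeriv_toLp (fun x => ?_) ?_ _ _) (hasTrace_phi0Deriv hp hω)
    (hasTrace_phi0SecondLp hp hω) ?_ c (by simp) (by rw [hc, zero_mul])
  · refine (hasDerivAt_ofReal (hasDerivAt_phi0Second hp hω x)).congr_deriv ?_
    rw [sub_zero, RCLike.real_smul_eq_coe_mul, RCLike.ofReal_mul]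
  · exact ((continuous_linPotential hp hω).sub continuous_const).smul
      (RCLike.continuous_ofReal.comp (continuous_deriv_phi0 hp hω))
  · filter_upwards [m.coeFn_toLp, (memLp_deriv_phi0 (𝕜 := 𝕜) hp hω).coeFn_toLp] with x h1 h2
    rw [h1, phi0Deriv, h2, sub_zero, zero_mul, sub_zero]

/-- The Wronskian f φ₀'' - f₁ φ₀' is constant, and integrable on a half-line as a combination of
products of L² functions, hence zero. So f / φ₀' has zero derivative on (0, ∞), where φ₀' has no
zeros. -/
theorem IsSol.eq_mul_deriv_phi0 (hp : 1 < p) (hω : 0 < ω) {f f₁ : ℝ → 𝕜}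
    (hf : IsSol (linPotential p ω) f f₁ 0) :
    ∃ C : 𝕜, ∀ x ∈ Ioi (0 : ℝ), f x = C * ((deriv (phi0 p ω) x : ℝ) : 𝕜) := by
  set φ₁ : ℝ → 𝕜 := fun x => ((deriv (phi0 p ω) x : ℝ) : 𝕜) with hφ₁
  set φ₂ : ℝ → 𝕜 := fun x => ((phi0Second p ω x : ℝ) : 𝕜) with hφ₂
  have d₁ : ∀ x, HasDerivAt φ₁ (φ₂ x) x := fun x => hasDerivAt_ofReal (hasDerivAt_deriv_phi0 hp hω x)
  have d₂ : ∀ x, HasDerivAt φ₂ ((linPotential p ω x : 𝕜) * φ₁ x) x := fun x =>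
    (hasDerivAt_ofReal (hasDerivAt_phi0Second hp hω x)).congr_deriv (RCLike.ofReal_mul _ _)
  have df := hf.hasDerivAt
  have df₁ : ∀ x, 0 < x → HasDerivAt f₁ ((linPotential p ω x : 𝕜) * f x) x := fun x hx => by
    simpa [RCLike.real_smul_eq_coe_mul] using hf.hasDerivAt_deriv x hx
  have hne : ∀ x, 0 < x → φ₁ x ≠ 0 := by
    intro x hx
    have h1 : deriv (phi0 p ω) x ≠ 0 := by
      rw [deriv_phi0_eq hp hω]
      exact mul_ne_zero (mul_ne_zero (neg_ne_zero.mpr (Real.sqrt_pos.mpr hω).ne')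
        (solTanh_pos hp hω hx).ne') (phi0_pos hp hω x).ne'
    simpa [hφ₁] using h1
  obtain ⟨w, hw⟩ := isOpen_Ioi.exists_is_const_of_deriv_eq_zero (f := f * φ₂ - f₁ * φ₁)
    (s := Ioi (0 : ℝ)) isPreconnected_Ioi
    (fun x hx => (((df x hx).mul (d₂ x)).sub ((df₁ x hx).mul
      (d₁ x))).differentiableAt.differentiableWithinAt)
    (fun x hx => by
      rw [(((df x hx).mul (d₂ x)).sub ((df₁ x hx).mul (d₁ x))).deriv, Pi.zero_apply]
      ring)
  have hw0 : w = 0 := by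
    have hi : Integrable (f * φ₂ - f₁ * φ₁) halfLine :=
      (hf.memLp.integrable_mul (p := 2) (q := 2) (memLp_phi0Second hp hω)).sub
        (hf.memLp_deriv.integrable_mul (p := 2) (q := 2) (memLp_deriv_phi0 hp hω))
    have hi' : Integrable (fun _ : ℝ => w) halfLine := by
      refine hi.congr ?_
      filter_upwards [ae_restrict_mem measurableSet_Ioi] with x hx using hw x hx
    rcases integrable_const_iff.mp hi' with h | h
    · exact h
    · have := h.measure_univ_lt_top
      simp at this
  obtain ⟨C, hC⟩ := isOpen_Ioi.exists_is_const_of_deriv_eq_zero (f := f / φ₁)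
    (s := Ioi (0 : ℝ)) isPreconnected_Ioi
    (fun x hx => ((df x hx).div (d₁ x) (hne x hx)).differentiableAt.differentiableWithinAt)
    (fun x hx => by
      rw [((df x hx).div (d₁ x) (hne x hx)).deriv, Pi.zero_apply]
      have := hw x hx
      rw [hw0] at this
      simp only [Pi.sub_apply, Pi.mul_apply] at this
      rw [show f₁ x * φ₁ x - f x * φ₂ x = 0 by linear_combination -this, zero_div])
  exact ⟨C, fun x hx => by rw [← hC x hx, Pi.div_apply, div_mul_cancel₀ _ (hne x hx)]⟩

/-- Once every component is c_j φ₀', uniqueness of traces identifies its derivative at the vertex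
with c_j φ₀''(0), and the Kirchhoff condition becomes ∑ c_j = 0. -/
theorem exists_kernelMap_eq {U : L2Graph 𝕜 N} (hU : U ∈ eigenspace (kirchhoffOp 𝕜 N hp hω) 0) :
    ∃ c : Fin N → 𝕜, ∑ j, c j = 0 ∧ kernelMap 𝕜 N hp hω c = U := by
  obtain ⟨-, ⟨a, ha⟩, d, hd, hsum⟩ := hU.choose
  have main : ∀ j, ∃ c : 𝕜, U j = c • phi0Deriv 𝕜 hp hω := by
    intro j
    obtain ⟨f, f₁, hf, h1, -⟩ := exists_isSol_of_mem_eigenspace hp hω hU j (ha j)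
    rw [zero_smul] at hf
    obtain ⟨C, hC⟩ := hf.eq_mul_deriv_phi0 hp hω
    refine ⟨C, Lp.ext ?_⟩
    filter_upwards [h1, Lp.coeFn_smul C (phi0Deriv 𝕜 hp hω),
      (memLp_deriv_phi0 (𝕜 := 𝕜) hp hω).coeFn_toLp, ae_restrict_mem measurableSet_Ioi]
      with x h1 h2 h3 hx
    rw [h1, h2, Pi.smul_apply, phi0Deriv, h3, hC x hx, smul_eq_mul]
  choose c hc using main
  have hcd : ∀ j, d j = c j * ((phi0Second p ω 0 : ℝ) : 𝕜) := by
    intro j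
    obtain ⟨g, hg, tg⟩ := hd j
    have h := (hasWeakDeriv_phi0Deriv (𝕜 := 𝕜) hp hω).smul (c j)
    rw [← hc j] at h
    rw [hg.unique h] at tg
    exact tg.unique ((hasTrace_phi0SecondLp hp hω).smul (c j))
  refine ⟨c, ?_, ?_⟩
  · simp_rw [hcd, ← Finset.sum_mul] at hsum
    have h0 : ((phi0Second p ω 0 : ℝ) : 𝕜) ≠ 0 := by exact_mod_cast phi0Second_zero_ne hp hω
    exact (mul_eq_zero.mp hsum).resolve_right h0
  · ext1 j
    exact (hc j).symm

/-- The sum of the coordinates, as a linear functional. -/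
def coordSum (𝕜 : Type*) [RCLike 𝕜] (N : ℕ) : (Fin N → 𝕜) →ₗ[𝕜] 𝕜 := ∑ j, LinearMap.proj j

theorem mem_ker_coordSum {c : Fin N → 𝕜} : c ∈ LinearMap.ker (coordSum 𝕜 N) ↔ ∑ j, c j = 0 := by
  rw [LinearMap.mem_ker, coordSum, LinearMap.sum_apply]
  rfl

theorem eigenspace_zero_eq_map : eigenspace (kirchhoffOp 𝕜 N hp hω) 0 =
    (LinearMap.ker (coordSum 𝕜 N)).map (kernelMap 𝕜 N hp hω) := by
  ext U
  rw [Submodule.mem_map]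
  constructor
  · intro hU
    obtain ⟨c, hc, e⟩ := exists_kernelMap_eq hp hω hU
    exact ⟨c, mem_ker_coordSum.mpr hc, e⟩
  · rintro ⟨c, hc, rfl⟩
    exact kernelMap_mem_eigenspace hp hω (mem_ker_coordSum.mp hc)

theorem finrank_ker_coordSum (hN : 0 < N) :
    Module.finrank 𝕜 (LinearMap.ker (coordSum 𝕜 N)) = N - 1 := by
  have h := LinearMap.finrank_range_add_finrank_ker (coordSum 𝕜 N)
  have hr : LinearMap.range (coordSum 𝕜 N) = ⊤ := by
    refine LinearMap.range_eq_top.mpr fun a => ⟨Pi.single ⟨0, hN⟩ a, ?_⟩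
    simp [coordSum, LinearMap.sum_apply, Pi.single_apply]
  rw [hr, finrank_top, Module.finrank_self, Module.finrank_fin_fun] at h
  omega

theorem finrank_eigenspace_zero (hN : 0 < N) :
    Module.finrank 𝕜 (eigenspace (kirchhoffOp 𝕜 N hp hω) 0) = N - 1 := by
  rw [eigenspace_zero_eq_map, ← finrank_ker_coordSum (𝕜 := 𝕜) hN]
  exact (Submodule.equivMapOfInjective _ (kernelMap_injective hp hω) _).finrank_eq.symm

/-- The coordinate vector `e_j - e_{j+1}`. -/
def coordDiff (𝕜 : Type*) [RCLike 𝕜] (N : ℕ) (j : Fin (N - 1)) : Fin N → 𝕜 :=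
  Pi.single ⟨j, by omega⟩ 1 - Pi.single ⟨j + 1, by omega⟩ 1

theorem kernelMap_coordDiff (j : Fin (N - 1)) :
    kernelMap 𝕜 N hp hω (coordDiff 𝕜 N j) = kernelVector 𝕜 N hp hω j := by
  ext1 i
  change coordDiff 𝕜 N j i • phi0Deriv 𝕜 hp hω = if (i : ℕ) = j then phi0Deriv 𝕜 hp hω
    else if (i : ℕ) = j + 1 then -phi0Deriv 𝕜 hp hω else 0
  rw [coordDiff, Pi.sub_apply, Pi.single_apply, Pi.single_apply]
  simp only [Fin.ext_iff]
  split_ifs <;> first | omega | simp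

/-- Telescoping: e_0 - e_i is a sum of consecutive differences, and c = -∑ c_i (e_0 - e_i) when ∑
c_i = 0. -/
theorem ker_coordSum_eq_span : LinearMap.ker (coordSum 𝕜 N) =
    Submodule.span 𝕜 (range (coordDiff 𝕜 N)) := by
  apply le_antisymm
  · intro c hc
    rw [mem_ker_coordSum] at hc
    rcases Nat.eq_zero_or_pos N with rfl | hN
    · rw [Subsingleton.elim c 0]
      exact Submodule.zero_mem _
    have key : ∀ i (hi : i < N), (Pi.single ⟨0, hN⟩ 1 - Pi.single ⟨i, hi⟩ 1 : Fin N → 𝕜) ∈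
        Submodule.span 𝕜 (range (coordDiff 𝕜 N)) := by
      intro i
      induction i with
      | zero =>
        intro hi
        rw [sub_self]
        exact Submodule.zero_mem _
      | succ i ih =>
        intro hi
        have h1 := Submodule.add_mem _ (ih (by omega))
          (Submodule.subset_span (mem_range_self (f := coordDiff 𝕜 N) ⟨i, by omega⟩))
        rwa [coordDiff, sub_add_sub_cancel] at h1
    have e : c = -∑ i : Fin N, c i • (Pi.single ⟨0, hN⟩ 1 - Pi.single i 1 : Fin N → 𝕜) := by
      simp_rw [smul_sub, Finset.sum_sub_distrib, ← Finset.sum_smul, hc, zero_smul, zero_sub,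
        neg_neg]
      exact pi_eq_sum_univ' c
    rw [e]
    exact Submodule.neg_mem _ (Submodule.sum_mem _ fun i _ => Submodule.smul_mem _ _ (key i i.2))
  · rw [Submodule.span_le]
    rintro _ ⟨j, rfl⟩
    rw [SetLike.mem_coe, mem_ker_coordSum]
    simp [coordDiff]

theorem eigenspace_zero_eq_span : eigenspace (kirchhoffOp 𝕜 N hp hω) 0 =
    Submodule.span 𝕜 (range (kernelVector 𝕜 N hp hω)) := by
  rw [eigenspace_zero_eq_map, ker_coordSum_eq_span, Submodule.map_span, ← range_comp]
  congr 2
  exact funext fun j => kernelMap_coordDiff hp hω j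

end Eigenvectors

/-! #### The kernel in the symmetric subspaces -/

section SymmetricKernel

variable {𝕜 : Type*} [RCLike 𝕜] {N k : ℕ} {p ω : ℝ} (hp : 1 < p) (hω : 0 < ω)

theorem sum_ite_lt (hkN : k ≤ N) (a b : 𝕜) :
    ∑ i : Fin N, (if (i : ℕ) < k then a else b) = k * a + (N - k) * b := by
  have h1 : (Finset.univ.filter fun i : Fin N => (i : ℕ) < k).card = k := by
    rw [Fin.card_filter_val_lt, min_eq_right hkN]
  have h2 : (Finset.univ.filter fun i : Fin N => ¬(i : ℕ) < k).card = N - k := by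
    have := Finset.card_filter_add_card_filter_not (s := (Finset.univ : Finset (Fin N)))
      (fun i : Fin N => (i : ℕ) < k)
    rw [h1, Finset.card_univ, Fintype.card_fin] at this
    omega
  rw [Finset.sum_ite, Finset.sum_const, Finset.sum_const, h1, h2, nsmul_eq_mul, nsmul_eq_mul,
    Nat.cast_sub hkN]

theorem symKernelVector_eq : symKernelVector 𝕜 N k hp hω =
    kernelMap 𝕜 N hp hω fun i => if (i : ℕ) < k then ((N : 𝕜) - k) / k else -1 := by
  ext1 i
  change (if (i : ℕ) < k then (((N : 𝕜) - k) / k) • phi0Deriv 𝕜 hp hω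
    else -phi0Deriv 𝕜 hp hω) =
      (if (i : ℕ) < k then ((N : 𝕜) - k) / k else -1) • phi0Deriv 𝕜 hp hω
  split_ifs <;> simp

/-- The coefficients are a on the first k edges and b on the others, read off at the edges 0 and k,
with k a + (N - k) b = 0. As the spanning vector has coefficient -1 on the last edges, the factor is
-b. -/
theorem map_eigenspace_restrictTo_zero (hk : 1 ≤ k) (hkN : k < N) :
    (eigenspace (restrictTo (kirchhoffOp 𝕜 N hp hω) (L2Sym 𝕜 N k)) 0).map
      (L2Sym 𝕜 N k).subtype = Submodule.span 𝕜 {symKernelVector 𝕜 N k hp hω} := by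
  have hk0 : (k : 𝕜) ≠ 0 := by exact_mod_cast (by omega : k ≠ 0)
  apply le_antisymm
  · rintro _ ⟨U, hU, rfl⟩
    have hU' := (mem_eigenspace_restrictTo (A := kirchhoffOp 𝕜 N hp hω) (S := L2Sym 𝕜 N k)
      (z := 0) (x := U)).mp hU
    obtain ⟨c, hc, e⟩ := exists_kernelMap_eq hp hω hU'
    have inj : ∀ i j, (U : L2Graph 𝕜 N) i = (U : L2Graph 𝕜 N) j → c i = c j := by
      intro i j h
      rw [← e] at h
      exact smul_left_injective 𝕜 (phi0Deriv_ne_zero hp hω) h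
    set a := c ⟨0, by omega⟩ with ha
    set b := c ⟨k, hkN⟩ with hb
    have hcab : c = fun i : Fin N => if (i : ℕ) < k then a else b := by
      ext i
      split_ifs with h
      · exact inj _ _ (U.2.1 i ⟨0, by omega⟩ h hk)
      · exact inj _ _ (U.2.2 i ⟨k, hkN⟩ (not_lt.mp h) le_rfl)
    rw [hcab, sum_ite_lt hkN.le] at hc
    rw [Submodule.mem_span_singleton]
    refine ⟨-b, ?_⟩
    rw [Submodule.subtype_apply, ← e, symKernelVector_eq, ← map_smul]
    congr 1
    rw [hcab]
    ext i
    rw [Pi.smul_apply, smul_eq_mul]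
    split_ifs
    · field_simp
      linear_combination -hc
    · ring
  · rw [Submodule.span_singleton_le_iff_mem]
    have hS : symKernelVector 𝕜 N k hp hω ∈ L2Sym 𝕜 N k := by
      refine ⟨fun i j hi hj => ?_, fun i j hi hj => ?_⟩
      · simp only [symKernelVector, if_pos hi, if_pos hj]
      · simp only [symKernelVector, if_neg (not_lt.mpr hi), if_neg (not_lt.mpr hj)]
    refine ⟨⟨_, hS⟩, mem_eigenspace_restrictTo.mpr ?_, rfl⟩
    change symKernelVector 𝕜 N k hp hω ∈ _
    rw [symKernelVector_eq]
    refine kernelMap_mem_eigenspace hp hω ?_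
    rw [sum_ite_lt hkN.le]
    field_simp
    ring

theorem symKernelVector_ne_zero (hkN : k < N) : symKernelVector 𝕜 N k hp hω ≠ 0 := by
  intro h
  have h1 : symKernelVector 𝕜 N k hp hω ⟨k, hkN⟩ = 0 := by rw [h]; rfl
  simp only [symKernelVector, lt_irrefl, if_false] at h1
  exact phi0Deriv_ne_zero (𝕜 := 𝕜) hp hω (neg_eq_zero.mp h1)

theorem finrank_eigenspace_restrictTo_zero (hk : 1 ≤ k) (hkN : k < N) :
    Module.finrank 𝕜
      (eigenspace (restrictTo (kirchhoffOp 𝕜 N hp hω) (L2Sym 𝕜 N k)) 0) = 1 := by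
  rw [← Submodule.finrank_map_subtype_eq, map_eigenspace_restrictTo_zero hp hω hk hkN]
  exact finrank_span_singleton (symKernelVector_ne_zero hp hω hkN)

end SymmetricKernel

/-! #### The negative eigenvalue -/

section NegativeEigenvalue

theorem hasUniqueSimpleNegativeEigenvalue_of_eigenvector {𝕜 : Type*} [RCLike 𝕜] {E : Type*}
    [NormedAddCommGroup E] [NormedSpace 𝕜 E] {A : E →ₗ.[𝕜] E} {l : ℝ} (hl : l < 0) {v : E}
    (hv : v ∈ eigenspace A (l : 𝕜)) (hv0 : v ≠ 0)
    (h : ∀ m : ℝ, m < 0 → ∀ u ∈ eigenspace A (m : 𝕜), u ≠ 0 → m = l ∧ ∃ c : 𝕜, u = c • v) :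
    HasUniqueSimpleNegativeEigenvalue A := by
  refine ⟨l, hl, finrank_eq_one (⟨v, hv⟩ : eigenspace A (l : 𝕜)) ?_ ?_, fun m hm hne => ?_⟩
  · exact fun e => hv0 (congrArg Subtype.val e)
  · rintro ⟨u, hu⟩
    by_cases hu0 : u = 0
    · exact ⟨0, Subtype.ext (by simp [hu0])⟩
    · obtain ⟨-, c, rfl⟩ := h l hl u hu hu0
      exact ⟨c, rfl⟩
  · obtain ⟨u, hu, hu0⟩ := Submodule.exists_mem_ne_zero_of_ne_bot hne
    exact (h m hm u hu hu0).1

variable {𝕜 : Type*} [RCLike 𝕜] {N : ℕ} {p ω : ℝ} (hp : 1 < p) (hω : 0 < ω)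

/-- The ground state on one edge, as an element of `L²(0, ∞)`. -/
def groundLp (𝕜 : Type*) [RCLike 𝕜] {p ω : ℝ} (hp : 1 < p) (hω : 0 < ω) : L2Half 𝕜 :=
  (memLp_groundFun hp hω).toLp (fun x => ((groundFun p ω x : ℝ) : 𝕜))

/-- The symmetric ground state on the star graph. -/
def groundVector (𝕜 : Type*) [RCLike 𝕜] (N : ℕ) {p ω : ℝ} (hp : 1 < p) (hω : 0 < ω) :
    L2Graph 𝕜 N := WithLp.toLp 2 fun _ => groundLp 𝕜 hp hω

theorem groundFun_pos (hp : 1 < p) (hω : 0 < ω) (x : ℝ) : 0 < groundFun p ω x :=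
  mul_pos (one_div_pos.mpr (Real.cosh_pos _)) (phi0_pos hp hω x)

theorem continuous_groundFun (hp : 1 < p) (hω : 0 < ω) : Continuous (groundFun p ω) :=
  continuous_iff_continuousAt.mpr fun x => (hasDerivAt_groundFun hp hω x).continuousAt

theorem hasTrace_groundLp : HasTrace (groundLp 𝕜 hp hω) ((groundFun p ω 0 : ℝ) : 𝕜) :=
  hasTrace_toLp (RCLike.continuous_ofReal.comp (continuous_groundFun hp hω))
    (memLp_groundFun (𝕜 := 𝕜) hp hω)

theorem groundVector_mem_eigenspace :
    groundVector 𝕜 N hp hω ∈ eigenspace (kirchhoffOp 𝕜 N hp hω) ((groundEnergy p ω : ℝ) : 𝕜) := by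
  have m := memLp_linPotential_mul hp hω (memLp_groundFun (𝕜 := 𝕜) hp hω) (groundEnergy p ω)
  have m' := memLp_deriv_groundFun (𝕜 := 𝕜) hp hω
  have c' : Continuous fun x => -((p + 1) / 2 * √ω) * solTanh p ω x * groundFun p ω x :=
    continuous_iff_continuousAt.mpr fun x => (hasDerivAt_deriv_groundFun hp hω x).continuousAt
  have t' := hasTrace_toLp (RCLike.continuous_ofReal.comp c') m'
  have h0 : solTanh p ω 0 = 0 := by simp [solTanh]
  have h := mem_eigenspace_of_weakDeriv hp hω (z := ((groundEnergy p ω : ℝ) : 𝕜)) (N := N)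
    (u := groundLp 𝕜 hp hω) (g := m'.toLp _) (h := m.toLp _) (c := fun _ => 1)
    (hasWeakDeriv_toLp (fun x => hasDerivAt_ofReal (hasDerivAt_groundFun hp hω x))
      (RCLike.continuous_ofReal.comp c') _ _)
    (hasWeakDeriv_toLp (fun x => ?_) ?_ _ _) (hasTrace_groundLp hp hω) t' ?_ (by simp)
    (by simp [h0])
  · refine (congrArg (· ∈ _) ?_).mp h
    ext1 j
    exact one_smul _ _
  · refine (hasDerivAt_ofReal (hasDerivAt_deriv_groundFun hp hω x)).congr_deriv ?_
    rw [RCLike.real_smul_eq_coe_mul, RCLike.ofReal_mul]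
  · exact ((continuous_linPotential hp hω).sub continuous_const).smul
      (RCLike.continuous_ofReal.comp (continuous_groundFun hp hω))
  · filter_upwards [m.coeFn_toLp, (memLp_groundFun (𝕜 := 𝕜) hp hω).coeFn_toLp] with x h1 h2
    rw [h1, groundLp, h2, sub_smul]
    simp only [RCLike.real_smul_eq_coe_mul]

theorem groundVector_ne_zero (hN : 0 < N) : groundVector 𝕜 N hp hω ≠ 0 := by
  intro h
  have h1 : groundLp 𝕜 hp hω = 0 := congrArg (fun U : L2Graph 𝕜 N => U ⟨0, hN⟩) h
  have h2 := hasTrace_groundLp (𝕜 := 𝕜) hp hω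
  rw [h1] at h2
  exact (groundFun_pos hp hω 0).ne' (by exact_mod_cast h2.unique HasTrace.zero)

theorem groundVector_mem_L2Sym (k : ℕ) : groundVector 𝕜 N hp hω ∈ L2Sym 𝕜 N k :=
  ⟨fun _ _ _ _ => rfl, fun _ _ _ _ => rfl⟩

/-- The quadratic form of the Kirchhoff operator is nonnegative on those differences of eigenvectors
that vanish at the vertex. -/
theorem re_inner_sub_smul_nonneg {m l a b c : 𝕜} {U V : L2Graph 𝕜 N}
    (hU : U ∈ eigenspace (kirchhoffOp 𝕜 N hp hω) m) (hV : V ∈ eigenspace (kirchhoffOp 𝕜 N hp hω) l)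
    (ha : ∀ j, HasTrace (U j) a) (hb : ∀ j, HasTrace (V j) b) (hab : a = c * b) :
    0 ≤ RCLike.re (inner 𝕜 (U - c • V) (m • U - c • l • V)) := by
  rw [PiLp.inner_apply, map_sum]
  refine Finset.sum_nonneg fun j _ => ?_
  obtain ⟨f, f₁, hf, ef, f0⟩ := exists_isSol_of_mem_eigenspace hp hω hU j (ha j)
  obtain ⟨g, g₁, hg, eg, g0⟩ := exists_isSol_of_mem_eigenspace hp hω hV j (hb j)
  have hs := hf.sub_smul hg c
  obtain ⟨C, hC0, hC1⟩ := exists_riccati_bounds hp hω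
  -- The choice of c makes the difference vanish at 0 on this edge, as Jacobi's argument requires.
  have h := hs.integral_inner_nonneg (S := riccati p ω)
    (by rw [Pi.sub_apply, Pi.smul_apply, f0, g0, hab, smul_eq_mul, sub_self])
    (fun x hx => hasDerivAt_riccati hp hω hx) hC0 hC1
  rw [integral_re (integrable_inner_of_memLp hs.memLp hs.memLp_rhs)] at h
  refine h.trans_eq (congrArg _ ?_)
  rw [L2.inner_def]
  refine integral_congr_ae ?_
  change _ =ᵐ[halfLine] fun x => inner 𝕜 ((U j - c • V j : L2Half 𝕜) x)
    ((m • U j - c • l • V j : L2Half 𝕜) x)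
  filter_upwards [ef, eg, Lp.coeFn_sub (U j) (c • V j), Lp.coeFn_smul c (V j),
    Lp.coeFn_sub (m • U j) (c • l • V j), Lp.coeFn_smul c (l • V j), Lp.coeFn_smul l (V j),
    Lp.coeFn_smul m (U j)] with x h1 h2 h3 h4 h5 h6 h7 h8
  rw [h3, h5]
  simp only [Pi.sub_apply, Pi.smul_apply, h1, h2, h4, h6, h7, h8]

/-- Choose c so that U - cG vanishes at the vertex, where the form is nonnegative. If m = l, the
form equals m ‖U - cG‖², so U = cG. If m ≠ l, then U and G are orthogonal and the form equals m ‖U‖²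
+ l |c|² ‖G‖² < 0, a contradiction. -/
theorem eq_smul_groundVector_of_mem_eigenspace {m : ℝ} (hm : m < 0) {U : L2Graph 𝕜 N}
    (hU : U ∈ eigenspace (kirchhoffOp 𝕜 N hp hω) (m : 𝕜)) (hU0 : U ≠ 0) :
    m = groundEnergy p ω ∧ ∃ c : 𝕜, U = c • groundVector 𝕜 N hp hω := by
  obtain ⟨-, ⟨a, ha⟩, -⟩ := hU.choose
  set G := groundVector 𝕜 N hp hω with hG
  have hGm : G ∈ eigenspace _ _ := groundVector_mem_eigenspace (𝕜 := 𝕜) (N := N) hp hω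
  set l := groundEnergy p ω with hl
  have hl0 : l < 0 := groundEnergy_neg hp hω
  have hg0 : ((groundFun p ω 0 : ℝ) : 𝕜) ≠ 0 := by exact_mod_cast (groundFun_pos hp hω 0).ne'
  set c : 𝕜 := a / ((groundFun p ω 0 : ℝ) : 𝕜) with hc
  have hnn := re_inner_sub_smul_nonneg hp hω (c := c) hU hGm ha
    (fun _ => hasTrace_groundLp hp hω) (by rw [hc, div_mul_cancel₀ _ hg0])
  by_cases hml : m = l
  · refine ⟨hml, c, ?_⟩
    rw [hml, smul_comm c (l : 𝕜), ← smul_sub, inner_smul_right, RCLike.re_ofReal_mul,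
      inner_self_eq_norm_sq] at hnn
    have h1 : ‖U - c • G‖ ^ 2 = 0 := by nlinarith [sq_nonneg ‖U - c • G‖]
    exact sub_eq_zero.mp (by simpa using h1)
  · exfalso
    have horth : inner 𝕜 U G = 0 := by
      have h := isSymmetricOp_kirchhoffOp hp hω ⟨U, hU.choose⟩ ⟨G, hGm.choose⟩
      rw [hU.choose_spec, hGm.choose_spec, inner_smul_left, inner_smul_right,
        RCLike.conj_ofReal] at h
      change (m : 𝕜) * inner 𝕜 U G = l * inner 𝕜 U G at h
      by_contra hne
      exact hml (by exact_mod_cast mul_right_cancel₀ hne h)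
    have horth' : inner 𝕜 G U = 0 := by rw [← inner_conj_symm, horth, map_zero]
    have e : inner 𝕜 (U - c • G) ((m : 𝕜) • U - c • (l : 𝕜) • G)
        = ((m * ‖U‖ ^ 2 + l * (‖c‖ ^ 2 * ‖G‖ ^ 2) : ℝ) : 𝕜) := by
      simp only [inner_sub_left, inner_sub_right, inner_smul_left, inner_smul_right, horth, horth',
        inner_self_eq_norm_sq_to_K]
      push_cast
      rw [← RCLike.conj_mul c]
      ring
    rw [e, RCLike.ofReal_re] at hnn
    have h1 : 0 < ‖U‖ ^ 2 := by positivity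
    have h2 : 0 ≤ ‖c‖ ^ 2 * ‖G‖ ^ 2 := by positivity
    nlinarith

theorem hasUniqueSimpleNegativeEigenvalue_kirchhoffOp (hN : 0 < N) :
    HasUniqueSimpleNegativeEigenvalue (kirchhoffOp 𝕜 N hp hω) :=
  hasUniqueSimpleNegativeEigenvalue_of_eigenvector (groundEnergy_neg hp hω)
    (groundVector_mem_eigenspace hp hω) (groundVector_ne_zero hp hω hN)
    fun _ hm _ hU hU0 => eq_smul_groundVector_of_mem_eigenspace hp hω hm hU hU0

/-- Restriction creates no eigenvectors, and it keeps the ground state, whose components all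
coincide. -/
theorem hasUniqueSimpleNegativeEigenvalue_restrictTo (hN : 0 < N) (k : ℕ) :
    HasUniqueSimpleNegativeEigenvalue
      (restrictTo (kirchhoffOp 𝕜 N hp hω) (L2Sym 𝕜 N k)) := by
  refine hasUniqueSimpleNegativeEigenvalue_of_eigenvector (groundEnergy_neg hp hω)
    (v := ⟨_, groundVector_mem_L2Sym hp hω k⟩)
    ((mem_eigenspace_restrictTo (A := kirchhoffOp 𝕜 N hp hω) (S := L2Sym 𝕜 N k)).mpr
      (groundVector_mem_eigenspace hp hω))
    (fun e => groundVector_ne_zero hp hω hN (congrArg Subtype.val e)) fun m hm U hU hU0 => ?_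
  have hU' := (mem_eigenspace_restrictTo (A := kirchhoffOp 𝕜 N hp hω) (S := L2Sym 𝕜 N k)
    (z := (m : 𝕜)) (x := U)).mp hU
  obtain ⟨h1, c, h2⟩ := eq_smul_groundVector_of_mem_eigenspace hp hω hm hU'
    fun e => hU0 (Subtype.ext e)
  exact ⟨h1, c, Subtype.ext h2⟩

end NegativeEigenvalue

/-! ### Weyl sequences -/

section Cutoff

open scoped ContDiff

/-- Scaled to χ(x/n), the support lies in [n, 3n], away from the vertex and escaping to infinity,
while the cutoff equals 1 on a stretch of length n. -/
theorem exists_cutoff : ∃ χ : ℝ → ℝ, ContDiff ℝ ∞ χ ∧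
    (∀ y, y ∉ Icc (1 : ℝ) 3 → χ y = 0 ∧ deriv χ y = 0 ∧ deriv (deriv χ) y = 0) ∧
    (∀ y ∈ Icc (3 / 2 : ℝ) (5 / 2), χ y = 1) ∧ (∀ y, |χ y| ≤ 1) ∧
    ∃ M, ∀ y, |deriv χ y| ≤ M ∧ |deriv (deriv χ) y| ≤ M := by
  let f : ContDiffBump (2 : ℝ) := ⟨1 / 2, 1, by norm_num, by norm_num⟩
  have hsm : ContDiff ℝ ∞ f := f.contDiff
  have hsm' : ContDiff ℝ ∞ (deriv f) := (contDiff_infty_iff_deriv.mp hsm).2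
  have hb : ∀ {g : ℝ → ℝ}, ContDiff ℝ ∞ g → HasCompactSupport g → ∃ M, ∀ y, |g y| ≤ M := by
    intro g hg hc
    exact hc.exists_bound_of_continuous hg.continuous
  have hs : tsupport f ⊆ Icc 1 3 := by
    rw [f.tsupport_eq, Real.closedBall_eq_Icc]
    exact Icc_subset_Icc (by norm_num [f]) (by norm_num [f])
  have hs' : tsupport (deriv f) ⊆ Icc 1 3 :=
    (closure_minimal support_deriv_subset (isClosed_tsupport _)).trans hs
  refine ⟨f, hsm, fun y hy => ⟨?_, ?_, ?_⟩, fun y hy => ?_, fun y => ?_, ?_⟩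
  · exact image_eq_zero_of_notMem_tsupport fun h => hy (hs h)
  · exact image_eq_zero_of_notMem_tsupport fun h => hy (hs' h)
  · by_contra h
    exact hy (hs' (support_deriv_subset h))
  · refine f.one_of_mem_closedBall ?_
    rw [Real.closedBall_eq_Icc]
    exact Icc_subset_Icc (by norm_num [f]) (by norm_num [f]) hy
  · rw [abs_of_nonneg f.nonneg]
    exact f.le_one
  · obtain ⟨M, hM⟩ := hb hsm' f.hasCompactSupport.deriv
    obtain ⟨M', hM'⟩ := hb (contDiff_infty_iff_deriv.mp hsm').2 f.hasCompactSupport.deriv.deriv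
    exact ⟨max M M', fun y => ⟨(hM y).trans (le_max_left _ _), (hM' y).trans (le_max_right _ _)⟩⟩

end Cutoff

/-! ### Truncated waves, the spectral gap and the essential spectrum -/

section Weyl

variable {𝕜 : Type*} [RCLike 𝕜] {N : ℕ} {p ω : ℝ} (hp : 1 < p) (hω : 0 < ω)

theorem exists_weyl_vector {F F₁ F₂ : ℝ → ℝ} {n t δ : ℝ} (hn : 0 < n)
    (dF : ∀ x, HasDerivAt F (F₁ x) x) (dF₁ : ∀ x, HasDerivAt F₁ (F₂ x) x) (cF₂ : Continuous F₂)
    (h0 : ∀ x, x ∉ Icc n (3 * n) → F x = 0 ∧ F₁ x = 0 ∧ F₂ x = 0)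
    (hδ : ∀ x ∈ Icc n (3 * n), |(linPotential p ω x - t) * F x - F₂ x| ≤ δ) :
    ∃ u g h : L2Half 𝕜, HasWeakDeriv u g ∧ HasWeakDeriv g h ∧ HasTrace u 0 ∧ HasTrace g 0 ∧
      ‖u‖ ^ 2 = ∫ x in Ioi (0 : ℝ), F x ^ 2 ∧
      ‖(ω : 𝕜) • u - (p : 𝕜) • potentialMul hp hω u - h - (t : 𝕜) • u‖ ^ 2
        ≤ δ ^ 2 * (2 * n) := by
  have cF : Continuous F := continuous_iff_continuousAt.mpr fun x => (dF x).continuousAt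
  have cF₁ : Continuous F₁ := continuous_iff_continuousAt.mpr fun x => (dF₁ x).continuousAt
  have hz : (0 : ℝ) ∉ Icc n (3 * n) := fun h => absurd h.1 (not_le.mpr hn)
  have mF : MemLp (fun x => (F x : 𝕜)) 2 halfLine := memLp_ofReal_of_hasCompactSupport cF
    (HasCompactSupport.intro isCompact_Icc fun x hx => (h0 x hx).1)
  have mF₁ : MemLp (fun x => (F₁ x : 𝕜)) 2 halfLine := memLp_ofReal_of_hasCompactSupport cF₁
    (HasCompactSupport.intro isCompact_Icc fun x hx => (h0 x hx).2.1)
  have mF₂ : MemLp (fun x => (F₂ x : 𝕜)) 2 halfLine := memLp_ofReal_of_hasCompactSupport cF₂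
    (HasCompactSupport.intro isCompact_Icc fun x hx => (h0 x hx).2.2)
  have tr : ∀ {f : ℝ → ℝ} (_ : Continuous f) (m : MemLp (fun x => (f x : 𝕜)) 2 halfLine),
      f 0 = 0 → HasTrace (m.toLp _) 0 := by
    intro f hf m hf0
    have h := hasTrace_toLp (RCLike.continuous_ofReal.comp hf) m
    rwa [Function.comp_apply, hf0, RCLike.ofReal_zero] at h
  refine ⟨mF.toLp _, mF₁.toLp _, mF₂.toLp _,
    hasWeakDeriv_toLp (fun x => hasDerivAt_ofReal (dF x)) (RCLike.continuous_ofReal.comp cF₁) _ _,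
    hasWeakDeriv_toLp (fun x => hasDerivAt_ofReal (dF₁ x)) (RCLike.continuous_ofReal.comp cF₂) _ _,
    tr cF mF (h0 0 hz).1, tr cF₁ mF₁ (h0 0 hz).2.1, ?_, ?_⟩
  · rw [norm_sq_L2]
    refine integral_congr_ae ?_
    filter_upwards [mF.coeFn_toLp] with x hx
    rw [hx, RCLike.norm_ofReal, sq_abs]
  · set u := mF.toLp _ with hu
    set h := mF₂.toLp _ with hh
    have e : (ω : 𝕜) • u - (p : 𝕜) • potentialMul hp hω u - h - (t : 𝕜) • u
        = ((ω : 𝕜) • u - (p : 𝕜) • potentialMul hp hω u - (t : 𝕜) • u) - h := by abel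
    have ae := (eq_iff_ae_linPotential hp hω (z := (t : 𝕜)) (u := u)).mp rfl
    rw [e, norm_sq_L2]
    have hind : ∫ x in Ioi (0 : ℝ), (Icc n (3 * n)).indicator (fun _ => δ ^ 2) x
        = δ ^ 2 * (2 * n) := by
      rw [setIntegral_indicator measurableSet_Icc,
        inter_eq_right.mpr fun x (hx : x ∈ Icc _ _) => mem_Ioi.mpr (lt_of_lt_of_le hn hx.1),
        setIntegral_const,
        measureReal_def, Real.volume_Icc, ENNReal.toReal_ofReal (by linarith), smul_eq_mul]
      ring
    rw [← hind]
    refine integral_mono_of_nonneg (Eventually.of_forall fun x => sq_nonneg _) ?_ ?_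
    · refine IntegrableOn.integrable_indicator ?_ measurableSet_Icc
      exact integrableOn_const (by
        refine ((Measure.restrict_apply_le _ _).trans_lt ?_).ne
        rw [Real.volume_Icc]
        exact ENNReal.ofReal_lt_top)
    · filter_upwards [ae, Lp.coeFn_sub ((ω : 𝕜) • u - (p : 𝕜) • potentialMul hp hω u
        - (t : 𝕜) • u) h, mF.coeFn_toLp, mF₂.coeFn_toLp] with x h1 h2 h3 h4
      rw [h2, Pi.sub_apply, h1, hu, h3, hh, h4]
      have e : linPotential p ω x • (F x : 𝕜) - (t : 𝕜) * (F x : 𝕜) - (F₂ x : 𝕜)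
          = (((linPotential p ω x - t) * F x - F₂ x : ℝ) : 𝕜) := by
        rw [RCLike.real_smul_eq_coe_mul]
        push_cast
        ring
      rw [e, RCLike.norm_ofReal]
      by_cases hx : x ∈ Icc n (3 * n)
      · rw [indicator_of_mem hx]
        exact pow_le_pow_left₀ (abs_nonneg _) (hδ x hx) 2
      · rw [indicator_of_notMem hx, (h0 x hx).1, (h0 x hx).2.2]
        simp

/-- With κ² = t - ω the wave cos(κx + θ) solves -u'' + ωu = tu. Truncation by χ(x/n) and the
potential on [n, 3n] produce only small errors. A single phase has no immediate lower bound on its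
norm, so the phases 0 and -π/2 are used together: cos² + sin² = 1 makes their squared norms add up
to at least n, and one of the two must succeed. -/
theorem exists_approximate_solution (𝕜 : Type*) [RCLike 𝕜] {t ε : ℝ} (ht : ω ≤ t) (hε : 0 < ε) :
    ∃ u g h : L2Half 𝕜, HasWeakDeriv u g ∧ HasWeakDeriv g h ∧ HasTrace u 0 ∧ HasTrace g 0 ∧
      u ≠ 0 ∧ ‖(ω : 𝕜) • u - (p : 𝕜) • potentialMul hp hω u - h - (t : 𝕜) • u‖ ≤ ε * ‖u‖ := by
  obtain ⟨χ, hsm, h0, h1, hle, M, hM⟩ := exists_cutoff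
  have dχ : ∀ y, HasDerivAt χ (deriv χ y) y := fun y =>
    ((hsm.differentiable (by simp)) y).hasDerivAt
  have hsm' := (contDiff_infty_iff_deriv.mp hsm).2
  have dχ' : ∀ y, HasDerivAt (deriv χ) (deriv (deriv χ) y) y := fun y =>
    ((hsm'.differentiable (by simp)) y).hasDerivAt
  have cχ : Continuous (deriv (deriv χ)) := hsm'.continuous_deriv (by simp)
  set κ := √(t - ω) with hκ
  have hκ2 : κ ^ 2 = t - ω := Real.sq_sqrt (by linarith)
  have hκ0 : 0 ≤ κ := Real.sqrt_nonneg _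
  -- If both phases failed, adding the two estimates would give ε² n ≤ 2 · δ² · 2n = 4 δ² n.
  obtain ⟨δ, hδ, hδε⟩ : ∃ δ : ℝ, 0 < δ ∧ 4 * δ ^ 2 < ε ^ 2 := ⟨ε / 3, by positivity, by nlinarith⟩
  have ev1 : ∀ᶠ n in atTop, ∀ x, n ≤ x → |p * phi0 p ω x ^ (p - 1)| < δ / 3 := by
    have h := ((tendsto_potential hp hω).const_mul p).abs
    rw [mul_zero, abs_zero] at h
    exact eventually_forall_ge_atTop.mpr (h.eventually_lt_const (by positivity))
  have ev2 : ∀ᶠ n : ℝ in atTop, 2 * κ * M / n < δ / 3 :=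
    (tendsto_const_nhds.div_atTop tendsto_id).eventually_lt_const (by positivity)
  have ev3 : ∀ᶠ n : ℝ in atTop, M / n ^ 2 < δ / 3 :=
    (tendsto_const_nhds.div_atTop (tendsto_pow_atTop two_ne_zero)).eventually_lt_const
      (by positivity)
  obtain ⟨n, en1, en2, en3, hn⟩ := (ev1.and (ev2.and (ev3.and (eventually_gt_atTop 0)))).exists
  have hl : ∀ x : ℝ, HasDerivAt (fun y => y / n) (1 / n) x := fun x => (hasDerivAt_id x).div_const n
  have main : ∀ θ : ℝ, ∃ u g h : L2Half 𝕜, HasWeakDeriv u g ∧ HasWeakDeriv g h ∧ HasTrace u 0 ∧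
      HasTrace g 0 ∧ ‖u‖ ^ 2 = ∫ x in Ioi (0 : ℝ), (χ (x / n) * Real.cos (κ * x + θ)) ^ 2 ∧
      ‖(ω : 𝕜) • u - (p : 𝕜) • potentialMul hp hω u - h - (t : 𝕜) • u‖ ^ 2
        ≤ δ ^ 2 * (2 * n) := by
    intro θ
    have hk : ∀ x : ℝ, HasDerivAt (fun y => κ * y + θ) κ x := fun x => by
      simpa using ((hasDerivAt_id x).const_mul κ).add_const θ
    refine exists_weyl_vector hp hω (F := fun x => χ (x / n) * Real.cos (κ * x + θ))
      (F₁ := fun x => deriv χ (x / n) / n * Real.cos (κ * x + θ)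
        - κ * (χ (x / n) * Real.sin (κ * x + θ)))
      (F₂ := fun x => deriv (deriv χ) (x / n) / n ^ 2 * Real.cos (κ * x + θ)
        - 2 * κ * (deriv χ (x / n) / n * Real.sin (κ * x + θ))
        - κ ^ 2 * (χ (x / n) * Real.cos (κ * x + θ))) hn (fun x => ?_) (fun x => ?_) ?_ ?_ ?_
    · refine (((dχ (x / n)).comp x (hl x)).mul (hk x).cos).congr_deriv ?_
      simp only [Function.comp_apply]
      ring
    · refine (((((dχ' (x / n)).comp x (hl x)).div_const n).mul (hk x).cos).sub
        ((((dχ (x / n)).comp x (hl x)).mul (hk x).sin).const_mul κ)).congr_deriv ?_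
      simp only [Function.comp_apply]
      field_simp
      ring
    · have c1 := hsm.continuous
      have c2 := hsm'.continuous
      fun_prop
    · intro x hx
      have hx' : x / n ∉ Icc (1 : ℝ) 3 := by
        intro h
        rw [mem_Icc, le_div_iff₀ hn, div_le_iff₀ hn, one_mul] at h
        exact hx h
      obtain ⟨e1, e2, e3⟩ := h0 _ hx'
      simp [e1, e2, e3]
    · intro x hx
      have e : (linPotential p ω x - t) * (χ (x / n) * Real.cos (κ * x + θ))
          - (deriv (deriv χ) (x / n) / n ^ 2 * Real.cos (κ * x + θ)
            - 2 * κ * (deriv χ (x / n) / n * Real.sin (κ * x + θ))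
            - κ ^ 2 * (χ (x / n) * Real.cos (κ * x + θ)))
          = 2 * κ * deriv χ (x / n) / n * Real.sin (κ * x + θ)
            - (p * phi0 p ω x ^ (p - 1) * (χ (x / n) * Real.cos (κ * x + θ))
              + deriv (deriv χ) (x / n) / n ^ 2 * Real.cos (κ * x + θ)) := by
        rw [hκ2, linPotential]
        ring
      rw [e]
      have hc := Real.abs_cos_le_one (κ * x + θ)
      have hsn := Real.abs_sin_le_one (κ * x + θ)
      have b1 : |2 * κ * deriv χ (x / n) / n * Real.sin (κ * x + θ)| ≤ δ / 3 := by
        rw [abs_mul, abs_div, abs_mul, abs_of_pos hn, abs_of_nonneg (by positivity : 0 ≤ 2 * κ)]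
        calc _ ≤ 2 * κ * M / n * 1 := by
              gcongr
              · have := (abs_nonneg _).trans (hM (x / n)).1
                positivity
              · exact (hM (x / n)).1
          _ ≤ δ / 3 := by rw [mul_one]; exact en2.le
      have b2 : |p * phi0 p ω x ^ (p - 1) * (χ (x / n) * Real.cos (κ * x + θ))| ≤ δ / 3 := by
        rw [abs_mul, abs_mul (χ (x / n))]
        calc _ ≤ δ / 3 * (1 * 1) := by
              gcongr
              · exact (en1 x hx.1).le
              · exact hle _
          _ = δ / 3 := by ring
      have b3 : |deriv (deriv χ) (x / n) / n ^ 2 * Real.cos (κ * x + θ)| ≤ δ / 3 := by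
        rw [abs_mul, abs_div, abs_of_pos (by positivity : 0 < n ^ 2)]
        calc _ ≤ M / n ^ 2 * 1 := by
              gcongr
              · have := (abs_nonneg _).trans (hM (x / n)).2
                positivity
              · exact (hM (x / n)).2
          _ ≤ δ / 3 := by rw [mul_one]; exact en3.le
      refine (abs_sub _ _).trans ((add_le_add b1 ((abs_add_le _ _).trans
        (add_le_add b2 b3))).trans_eq ?_)
      ring
  obtain ⟨u, g, h, hu, hg, tu, tg, nu, nr⟩ := main 0
  obtain ⟨v, g', h', hv, hg', tv, tg', nv, nr'⟩ := main (-(Real.pi / 2))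
  have hsum : n ≤ ‖u‖ ^ 2 + ‖v‖ ^ 2 := by
    have hint : ∀ θ : ℝ,
        Integrable (fun x => (χ (x / n) * Real.cos (κ * x + θ)) ^ 2) halfLine := by
      intro θ
      refine (Continuous.integrable_of_hasCompactSupport ?_ ?_).restrict
      · have c1 := hsm.continuous
        fun_prop
      · refine HasCompactSupport.intro (K := Icc n (3 * n)) isCompact_Icc fun x hx => ?_
        have hx' : x / n ∉ Icc (1 : ℝ) 3 := by
          intro h
          rw [mem_Icc, le_div_iff₀ hn, div_le_iff₀ hn, one_mul] at h
          exact hx h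
        simp [(h0 _ hx').1]
    rw [nu, nv, ← integral_add (hint 0) (hint _)]
    have hind : ∫ x in Ioi (0 : ℝ), (Icc (3 / 2 * n) (5 / 2 * n)).indicator (fun _ => (1 : ℝ)) x
        = n := by
      rw [setIntegral_indicator measurableSet_Icc,
        inter_eq_right.mpr fun x (hx : x ∈ Icc _ _) =>
          mem_Ioi.mpr (lt_of_lt_of_le (by positivity) hx.1), setIntegral_const,
        measureReal_def, Real.volume_Icc, ENNReal.toReal_ofReal (by linarith), smul_eq_mul]
      ring
    refine hind.symm.le.trans (integral_mono_of_nonneg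
      (Eventually.of_forall fun x => indicator_nonneg (fun _ _ => zero_le_one) x)
      ((hint 0).add (hint _)) (Eventually.of_forall fun x => ?_))
    have e : (χ (x / n) * Real.cos (κ * x + 0)) ^ 2
        + (χ (x / n) * Real.cos (κ * x + -(Real.pi / 2))) ^ 2 = χ (x / n) ^ 2 := by
      rw [add_zero, ← sub_eq_add_neg, Real.cos_sub_pi_div_two]
      linear_combination χ (x / n) ^ 2 * Real.sin_sq_add_cos_sq (κ * x)
    simp only [e]
    by_cases hx : x ∈ Icc (3 / 2 * n) (5 / 2 * n)
    · rw [indicator_of_mem hx, h1 (x / n) ⟨(le_div_iff₀ hn).mpr hx.1, (div_le_iff₀ hn).mpr hx.2⟩,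
        one_pow]
    · rw [indicator_of_notMem hx]
      exact sq_nonneg _
  by_contra hcon
  have bound : ∀ {u g h : L2Half 𝕜}, HasWeakDeriv u g → HasWeakDeriv g h → HasTrace u 0 →
      HasTrace g 0 → ‖(ω : 𝕜) • u - (p : 𝕜) • potentialMul hp hω u - h - (t : 𝕜) • u‖ ^ 2
        ≤ δ ^ 2 * (2 * n) → ε ^ 2 * ‖u‖ ^ 2 ≤ δ ^ 2 * (2 * n) := by
    intro u g h hu hg tu tg hr
    by_contra! hlt
    refine hcon ⟨u, g, h, hu, hg, tu, tg, ?_, ?_⟩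
    · rintro rfl
      rw [norm_zero] at hlt
      have : 0 ≤ δ ^ 2 * (2 * n) := by positivity
      linarith
    · refine le_of_sq_le_sq ?_ (by positivity)
      rw [mul_pow]
      exact hr.trans hlt.le
  have b1 := bound hu hg tu tg nr
  have b2 := bound hv hg' tv tg' nr'
  have b3 := mul_lt_mul_of_pos_right hδε hn
  have b4 := mul_le_mul_of_nonneg_left hsum (sq_nonneg ε)
  linarith

/-- The same approximate solution is placed on every edge. Its traces vanish, so the vertex
conditions hold, and the factor √N appears on both sides of the estimate. -/
theorem mem_spectrumOf_kirchhoffOp (hN : 0 < N) {t : ℝ} (ht : ω ≤ t) :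
    (t : 𝕜) ∈ spectrumOf (kirchhoffOp 𝕜 N hp hω) := by
  refine mem_spectrumOf_of_approx fun ε hε => ?_
  obtain ⟨u, g, h, hu, hg, tu, tg, hu0, hr⟩ := exists_approximate_solution hp hω 𝕜 ht hε
  obtain ⟨hdom, e⟩ := kirchhoffOp_smul_of_weakDeriv hp hω hu hg tu tg (fun _ : Fin N => (1 : 𝕜))
    (fun _ _ => rfl) (mul_zero _)
  have hconst : ∀ v : L2Half 𝕜, ‖(WithLp.toLp 2 fun _ => (1 : 𝕜) • v : L2Graph 𝕜 N)‖
      = √N * ‖v‖ := by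
    intro v
    rw [PiLp.norm_eq_of_L2]
    simp
  refine ⟨⟨_, hdom⟩, fun h0 => hu0 ?_, ?_⟩
  · have := congrArg (fun U : L2Graph 𝕜 N => U ⟨0, hN⟩) h0
    simpa using this
  · have e' : kirchhoffOp 𝕜 N hp hω ⟨_, hdom⟩
        - (t : 𝕜) • (WithLp.toLp 2 fun _ => (1 : 𝕜) • u : L2Graph 𝕜 N)
        = WithLp.toLp 2 fun _ =>
          (1 : 𝕜) • ((ω : 𝕜) • u - (p : 𝕜) • potentialMul hp hω u - h - (t : 𝕜) • u) := by
      rw [e]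
      ext1 j
      change (1 : 𝕜) • _ - (t : 𝕜) • ((1 : 𝕜) • u) = (1 : 𝕜) • _
      module
    rw [e', hconst, hconst, mul_left_comm]
    exact mul_le_mul_of_nonneg_left hr (Real.sqrt_nonneg _)

/-- Since N - 1 ≥ 1, the point 0 is an eigenvalue; it lies outside [ω, ∞), hence is isolated in the
spectrum, and the isolation radius is the gap. -/
theorem exists_spectral_gap (hN : 2 ≤ N) : ∃ δ : ℝ, 0 < δ ∧ ∀ t : ℝ, 0 < t →
    (t : 𝕜) ∈ spectrumOf (kirchhoffOp 𝕜 N hp hω) → δ ≤ t := by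
  obtain ⟨B, hB⟩ := exists_isRegularizer 𝕜 (by omega : N ≠ 0) hp hω
  have h0 : (0 : 𝕜) ∈ spectrumOf (kirchhoffOp 𝕜 N hp hω) := by
    have hne : eigenspace (kirchhoffOp 𝕜 N hp hω) 0 ≠ ⊥ := by
      intro h
      have := finrank_eigenspace_zero (𝕜 := 𝕜) hp hω (by omega : 0 < N)
      rw [h, finrank_bot] at this
      omega
    obtain ⟨x, ⟨hx, e⟩, hx0⟩ := Submodule.exists_mem_ne_zero_of_ne_bot hne
    exact mem_spectrumOf_of_approx fun ε hε => ⟨⟨x, hx⟩, hx0, by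
      rw [e, sub_self, norm_zero]
      positivity⟩
  have hd := hB.mem_discreteSpectrum (isSymmetricOp_kirchhoffOp hp hω) (z := 0) (fun t ht h => by
    have : t = 0 := by exact_mod_cast h.symm
    linarith) h0
  obtain ⟨-, ⟨ε, hε, hiso⟩, -⟩ := hd
  refine ⟨ε, hε, fun t ht hs => ?_⟩
  by_contra! hlt
  have h := hiso t hs (by rwa [sub_zero, RCLike.norm_ofReal, abs_of_pos ht])
  exact ht.ne' (by exact_mod_cast h)

theorem essentialSpectrum_kirchhoffOp (hN : 0 < N) :
    essentialSpectrum (kirchhoffOp 𝕜 N hp hω) = (fun t : ℝ => (t : 𝕜)) '' Ici ω := by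
  obtain ⟨B, hB⟩ := exists_isRegularizer 𝕜 hN.ne' hp hω
  exact hB.essentialSpectrum_eq (isSymmetricOp_kirchhoffOp hp hω) fun t ht =>
    mem_spectrumOf_kirchhoffOp hp hω hN ht

end Weyl

end KirchhoffStar

end

theorem theorem3p6 {𝕜 : Type*} [RCLike 𝕜] (N : ℕ) (hN : 2 ≤ N) (p ω : ℝ) (hp : 1 < p)
    (hω : 0 < ω) :
    -- (i) the kernel in `L²(𝒢)`
    (KirchhoffStar.eigenspace (KirchhoffStar.kirchhoffOp 𝕜 N hp hω) 0 =
        Submodule.span 𝕜 (Set.range (KirchhoffStar.kernelVector 𝕜 N hp hω)) ∧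
      Module.finrank 𝕜
        (KirchhoffStar.eigenspace (KirchhoffStar.kirchhoffOp 𝕜 N hp hω) 0) = N - 1) ∧
    -- (ii) the kernel in `L²_k(𝒢)`
    (∀ k : ℕ, 1 ≤ k → k ≤ (N - 1) / 2 →
      (KirchhoffStar.eigenspace (KirchhoffStar.restrictTo (KirchhoffStar.kirchhoffOp 𝕜 N hp hω)
          (KirchhoffStar.L2Sym 𝕜 N k)) 0).map (KirchhoffStar.L2Sym 𝕜 N k).subtype =
        Submodule.span 𝕜 {KirchhoffStar.symKernelVector 𝕜 N k hp hω} ∧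
      Module.finrank 𝕜
        (KirchhoffStar.eigenspace (KirchhoffStar.restrictTo (KirchhoffStar.kirchhoffOp 𝕜 N hp hω)
          (KirchhoffStar.L2Sym 𝕜 N k)) 0) = 1) ∧
    -- (iii) the negative spectrum in `L²(𝒢)` and in `L²_k(𝒢)`
    (KirchhoffStar.HasUniqueSimpleNegativeEigenvalue (KirchhoffStar.kirchhoffOp 𝕜 N hp hω) ∧
      KirchhoffStar.morseIndex (KirchhoffStar.kirchhoffOp 𝕜 N hp hω) = 1) ∧
    (∀ k : ℕ, 1 ≤ k → k ≤ (N - 1) / 2 →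
      KirchhoffStar.HasUniqueSimpleNegativeEigenvalue
        (KirchhoffStar.restrictTo (KirchhoffStar.kirchhoffOp 𝕜 N hp hω)
          (KirchhoffStar.L2Sym 𝕜 N k)) ∧
      KirchhoffStar.morseIndex
        (KirchhoffStar.restrictTo (KirchhoffStar.kirchhoffOp 𝕜 N hp hω)
          (KirchhoffStar.L2Sym 𝕜 N k)) = 1) ∧
    -- (iv) the positive part of the spectrum and the essential spectrum
    (∃ δ : ℝ, 0 < δ ∧ ∀ t : ℝ, 0 < t →
      (t : 𝕜) ∈ KirchhoffStar.spectrumOf (KirchhoffStar.kirchhoffOp 𝕜 N hp hω) → δ ≤ t) ∧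
    KirchhoffStar.essentialSpectrum (KirchhoffStar.kirchhoffOp 𝕜 N hp hω) =
      (fun t : ℝ => (t : 𝕜)) '' Set.Ici ω := by
  have hN0 : 0 < N := by omega
  have hneg := KirchhoffStar.hasUniqueSimpleNegativeEigenvalue_kirchhoffOp (𝕜 := 𝕜) hp hω hN0
  refine ⟨⟨KirchhoffStar.eigenspace_zero_eq_span hp hω,
    KirchhoffStar.finrank_eigenspace_zero hp hω hN0⟩, fun k hk hkN => ?_,
    ⟨hneg, hneg.morseIndex_eq_one⟩, fun k _ _ => ?_, KirchhoffStar.exists_spectral_gap hp hω hN,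
    KirchhoffStar.essentialSpectrum_kirchhoffOp hp hω hN0⟩
  · exact ⟨KirchhoffStar.map_eigenspace_restrictTo_zero hp hω hk (by omega),
      KirchhoffStar.finrank_eigenspace_restrictTo_zero hp hω hk (by omega)⟩
  · have h := KirchhoffStar.hasUniqueSimpleNegativeEigenvalue_restrictTo (𝕜 := 𝕜) hp hω hN0 k
    exact ⟨h, h.morseIndex_eq_one⟩
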